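/- Let $\rho_0$ be a $C^\infty$ probability density on $\mathbb R$ supported in $[-A,A]$, $A>0$, and let $p(x,y)=p(0,y-x)$, where $z\mapsto p(0,z)$ is a $C^\infty$ probability density vanishing for $|z|\ge \xi$, $\xi>0$. For a finite particle configuration $\underline x$ in $\mathbb R$ (repetitions counted, labels irrelevant) let $\pi_{\underline x}=\sum_{x\in\underline x}\delta_x$, and for finite measures write $\mu\preccurlyeq\nu$ if $\mu([r,\infty))\le \nu([r,\infty))$ for every $r\in\mathbb R$. Fix $N\in\mathbb N$; the initial configuration $\underline x(0)$ consists of $N$ independent points with density $\rho_0$. We consider the following processes, taken right continuous. * Basic process: particles move as independent standard Brownian motions; each carries an independent exponential clock of intensity $1$, and each time it rings for a particle located at $x$ a new particle is created at a position $y$ chosen, independently of everything else, with probability $p(x,y)\,dy$. * True process $\underline x(t)$: the same, started from $\underline x(0)$, except that at each creation of a particle the leftmost particle (the new one included) is simultaneously deleted. * Upper stochastic barrier $\underline x^{\delta,+}(t)$, $\delta>0$: it starts from $\underline x(0)$; in each interval $[(k-1)\delta,k\delta)$, $k\ge1$, it evolves as the basic process, and at each time $k\delta$, $k\ge 1$,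 only the $N$ rightmost particles are kept. * Lower stochastic barrier $\underline x^{\delta,-}(t)$, $\delta>0$, $\alpha_0\in(1/2,1)$: let $M_\delta=(1-e^{-\delta})N+N^{\alpha_0}$, rounded down or up to an integer (either choice is allowed). At time $0$ the $M_\delta$ leftmost particles of $\underline x(0)$ are deleted (all particles if $M_\delta\ge N$). In each interval $[(k-1)\delta,k\delta)$, $k\ge 1$, the particles evolve as the basic process, except that no branching occurs while the number of particles equals $N$. At each time $k\delta$, $k\ge 1$, only the $\max(N-M_\delta,0)$ rightmost particles are kept. Then for every $\delta>0$ there is a coupling of $\underline x(t)$ and $\underline x^{\delta,+}(t)$, i.e. a realization of both processes on one probability space, with the same initial configuration $\underline x(0)$, such that with probability $1$ $$\pi_{\underline x(t)}\preccurlyeq \pi_{\underline x^{\delta,+}(t)}\qquad\text{for all } t\ge 0 .$$ Moreover, for every $\delta>0$ and $\alpha_0\in(1/2,1)$ there is a coupling of $\underline x(t)$ and $\underline x^{\delta,-}(t)$, constructed from the same initial configuration $\underline x(0)$, such that with probability $1$ $$\pi_{\underline x^{\delta,-}(t)}\preccurlyeq \pi_{\underline x(t)}\qquad\text{for all } t\ge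 0 .$$ -/

import Mathlib

open MeasureTheory ProbabilityTheory
open scoped NNReal

noncomputable section

namespace ParticleSystem

/-! ### Counting measures and the mass transport order -/

/-- The counting measure `π_x = ∑_{x ∈ x} δ_x` of a finite particle configuration. Configurations
are lists of positions (labelled particles, repetitions allowed); `π_x` does not depend on the
labelling. -/
def countingMeasure (x : List ℝ) : Measure ℝ := (x.map Measure.dirac).sum

/-- The mass transport order: `μ ≼ ν` iff `μ [r, ∞) ≤ ν [r, ∞)` for all `r`. -/
def MassTransportLE (μ ν : Measure ℝ) : Prop := ∀ r : ℝ, μ (Set.Ici r) ≤ ν (Set.Ici r)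

/-! ### Operations on configurations -/

/-- Delete the `m` leftmost particles (all of them if there are fewer than `m`). -/
def deleteLeftmost (m : ℕ) (y : List ℝ) : List ℝ := (y.insertionSort (· ≤ ·)).drop m

/-- Keep the `m` rightmost particles. -/
def keepRightmost (m : ℕ) (y : List ℝ) : List ℝ := deleteLeftmost (y.length - m) y

/-- The particle with label `i` creates a new particle at distance `z` from itself. -/
def addChild (y : List ℝ) (i : ℕ) (z : ℝ) : List ℝ := y ++ [y.getD i 0 + z]

/-- What happens in the true process when the clock of particle `i` rings: a new particle is
created and then the leftmost of all particles, the new one included, is deleted. -/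
def addChildAndSelect (y : List ℝ) (i : ℕ) (z : ℝ) : List ℝ := deleteLeftmost 1 (addChild y i z)

/-- Branching which is switched off once the number of particles has reached `N`. -/
def addChildUpTo (N : ℕ) (y : List ℝ) (i : ℕ) (z : ℝ) : List ℝ :=
  if y.length < N then addChild y i z else y

/-! ### Evolution of a particle system between and at the rings of the clocks -/

/-- One sample of the randomness used from one ring to the next one: an exponential clock and a
Brownian path for each label, and the displacement of the new particle. By the lack of memory of
exponential clocks, all clocks are started afresh after each ring. -/
structure StepNoise where
  clock : ℕ → ℝ
  path : ℕ → ℝ≥0 → ℝ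
  jump : ℝ

/-- The first time that the clock of one of the particles of `y` rings (`∞` if `y` is empty). -/
def firstRing (y : List ℝ) (w : StepNoise) : ENNReal :=
  ⨅ i : Fin y.length, ENNReal.ofReal (w.clock i)

/-- The label of the particle of `y` whose clock rings first. -/
def ringingLabel (y : List ℝ) (w : StepNoise) : ℕ :=
  sInf {i | i < y.length ∧ ∀ j < y.length, w.clock i ≤ w.clock j}

/-- The particles of `y` after moving for a time `s` along their own paths. -/
def move (y : List ℝ) (w : StepNoise) (s : ℝ≥0) : List ℝ :=
  y.mapIdx fun i a => a + w.path i s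

/-- The time of the `n`-th ring and the configuration right after it (`n = 0`: the initial time
and the initial configuration). `rule y i z` is the configuration which replaces `y` when the clock
of particle `i` rings and the sampled displacement is `z`. -/
def ringState (rule : List ℝ → ℕ → ℝ → List ℝ) (y₀ : List ℝ) (w : ℕ → StepNoise) :
    ℕ → ENNReal × List ℝ
  | 0 => (0, y₀)
  | n + 1 =>
    let S := (ringState rule y₀ w n).1
    let y := (ringState rule y₀ w n).2
    let τ := firstRing y (w n)
    (S + τ, rule (move y (w n) τ.toNNReal) (ringingLabel y (w n)) (w n).jump)

/-- The configuration at time `t`: after the last ring before `t` (ring number `n`) the particles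
have moved along their paths for the remaining time. -/
def evolve (rule : List ℝ → ℕ → ℝ → List ℝ) (y₀ : List ℝ) (w : ℕ → StepNoise) (t : ℝ≥0) :
    List ℝ :=
  let n := sSup {n : ℕ | (ringState rule y₀ w n).1 ≤ (t : ENNReal)}
  move (ringState rule y₀ w n).2 (w n) (t - (ringState rule y₀ w n).1.toNNReal)

/-- The basic process: independent Brownian motions with nonlocal branching. -/
def basicPath (y₀ : List ℝ) (w : ℕ → StepNoise) : ℝ≥0 → List ℝ := evolve addChild y₀ w

/-- The true process: at each branching the leftmost particle is deleted. -/
def truePath (y₀ : List ℝ) (w : ℕ → StepNoise) : ℝ≥0 → List ℝ := evolve addChildAndSelect y₀ w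

/-- The basic process in which branching stops as soon as there are `N` particles. -/
def cappedPath (N : ℕ) (y₀ : List ℝ) (w : ℕ → StepNoise) : ℝ≥0 → List ℝ :=
  evolve (addChildUpTo N) y₀ w

/-! ### Evolutions with selection at the times `k δ` -/

/-- The configuration at time `(k δ)⁺` when the particles evolve by `flow` in each time interval of
length `δ` (using the fresh noise `w k` in the `k`-th one), and are selected by `cut` at the end of
each of them. -/
def blockStart (flow : List ℝ → (ℕ → StepNoise) → ℝ≥0 → List ℝ) (cut : List ℝ → List ℝ) (δ : ℝ≥0)
    (c₀ : List ℝ) (w : ℕ → ℕ → StepNoise) : ℕ → List ℝ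
  | 0 => c₀
  | k + 1 => cut (flow (blockStart flow cut δ c₀ w k) (w k) δ)

/-- The corresponding trajectory, right continuous at the times `k δ`. -/
def blockPath (flow : List ℝ → (ℕ → StepNoise) → ℝ≥0 → List ℝ) (cut : List ℝ → List ℝ) (δ : ℝ≥0)
    (c₀ : List ℝ) (w : ℕ → ℕ → StepNoise) (t : ℝ≥0) : List ℝ :=
  let k := ⌊t / δ⌋₊
  flow (blockStart flow cut δ c₀ w k) (w k) (t - k * δ)

/-- The upper barrier: basic process in each interval, selection of the `N` rightmost particles at
the times `k δ`, `k ≥ 1`. -/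
def upperPath (N : ℕ) (δ : ℝ≥0) (x₀ : List ℝ) (w : ℕ → ℕ → StepNoise) : ℝ≥0 → List ℝ :=
  blockPath basicPath (keepRightmost N) δ x₀ w

/-- The lower barrier: the `M` leftmost particles are deleted at time `0`, in each interval the
particles follow the basic process with branching stopped at `N` particles, and the `N - M`
rightmost particles are kept at the times `k δ`, `k ≥ 1`. -/
def lowerPath (N M : ℕ) (δ : ℝ≥0) (x₀ : List ℝ) (w : ℕ → ℕ → StepNoise) : ℝ≥0 → List ℝ :=
  blockPath (cappedPath N) (keepRightmost (N - M)) δ (deleteLeftmost M x₀) w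

/-- The (not necessarily integer) number `M_δ = (1 - e^{-δ}) N + N^{α₀}`. -/
def removalNumber (N : ℕ) (δ : ℝ≥0) (α₀ : ℝ) : ℝ :=
  (1 - Real.exp (-(δ : ℝ))) * N + (N : ℝ) ^ α₀

/-! ### The random processes -/

/-- The measure `f(r) dr`. -/
def densityMeasure (f : ℝ → ℝ) : Measure ℝ := volume.withDensity fun r => ENNReal.ofReal (f r)

/-- The random noise: clocks, paths and displacements for each step `k : ι`. -/
structure Noise (ι Ω : Type*) where
  clock : ι → ℕ → Ω → ℝ
  path : ι → ℕ → ℝ≥0 → Ω → ℝ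
  jump : ι → Ω → ℝ

/-- The sample of the noise of step `k` at `ω`. -/
def Noise.sample {ι Ω : Type*} (ν : Noise ι Ω) (ω : Ω) (k : ι) : StepNoise where
  clock i := ν.clock k i ω
  path i t := ν.path k i t ω
  jump := ν.jump k ω

/-- `x₀` consists of `N` independent random variables with density `ρ₀`, the clocks are exponential
of intensity one, the paths are standard Brownian motions, the displacements have density `q`,
and all these random objects are mutually independent. -/
structure IsDrivingNoise {ι Ω : Type*} [MeasurableSpace Ω] (P : Measure Ω) (ρ₀ q : ℝ → ℝ) {N : ℕ}
    (x₀ : Fin N → Ω → ℝ) (ν : Noise ι Ω) : Prop where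
  measurable_initial : ∀ i, Measurable (x₀ i)
  measurable_clock : ∀ k i, Measurable (ν.clock k i)
  measurable_path : ∀ k i t, Measurable (ν.path k i t)
  measurable_jump : ∀ k, Measurable (ν.jump k)
  law_initial : ∀ i, HasLaw (x₀ i) (densityMeasure ρ₀) P
  law_clock : ∀ k i, HasLaw (ν.clock k i) (expMeasure 1) P
  law_path : ∀ k i, IsBrownianReal (ν.path k i) P
  law_jump : ∀ k, HasLaw (ν.jump k) (densityMeasure q) P
  indep : iIndep
    (Sum.elim (fun i : Fin N => MeasurableSpace.comap (x₀ i) inferInstance)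
      (Sum.elim (fun a : ι × ℕ => MeasurableSpace.comap (ν.clock a.1 a.2) inferInstance)
        (Sum.elim
          (fun a : ι × ℕ => MeasurableSpace.comap (fun ω t => ν.path a.1 a.2 t ω) inferInstance)
          (fun k : ι => MeasurableSpace.comap (ν.jump k) inferInstance)))) P

/-- `X` is a true process started from the random initial configuration `x₀`. -/
def IsTrueProcess {Ω : Type*} [MeasurableSpace Ω] (P : Measure Ω) (ρ₀ q : ℝ → ℝ) {N : ℕ}
    (x₀ : Fin N → Ω → ℝ) (X : ℝ≥0 → Ω → List ℝ) : Prop :=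
  ∃ ν : Noise ℕ Ω, IsDrivingNoise P ρ₀ q x₀ ν ∧
    ∀ ω t, X t ω = truePath (List.ofFn fun i => x₀ i ω) (ν.sample ω) t

/-- `Y` is an upper stochastic barrier started from the random initial configuration `x₀`. -/
def IsUpperBarrier {Ω : Type*} [MeasurableSpace Ω] (P : Measure Ω) (ρ₀ q : ℝ → ℝ) (δ : ℝ≥0) {N : ℕ}
    (x₀ : Fin N → Ω → ℝ) (Y : ℝ≥0 → Ω → List ℝ) : Prop :=
  ∃ ν : Noise (ℕ × ℕ) Ω, IsDrivingNoise P ρ₀ q x₀ ν ∧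
    ∀ ω t, Y t ω = upperPath N δ (List.ofFn fun i => x₀ i ω) (fun k n => ν.sample ω (k, n)) t

/-- `Y` is a lower stochastic barrier, with `M` particles removed, started from the random initial
configuration `x₀`. -/
def IsLowerBarrier {Ω : Type*} [MeasurableSpace Ω] (P : Measure Ω) (ρ₀ q : ℝ → ℝ) (δ : ℝ≥0) (M : ℕ)
    {N : ℕ} (x₀ : Fin N → Ω → ℝ) (Y : ℝ≥0 → Ω → List ℝ) : Prop :=
  ∃ ν : Noise (ℕ × ℕ) Ω, IsDrivingNoise P ρ₀ q x₀ ν ∧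
    ∀ ω t, Y t ω = lowerPath N M δ (List.ofFn fun i => x₀ i ω) (fun k n => ν.sample ω (k, n)) t

end ParticleSystem

end

/-! Let `c` be a configuration of the process that should stay below and `z` one of the process
above it. By Hall's theorem, `c` is dominated by `z` exactly when the particles of `c` can be
injected into those of `z` without moving any of them to the left (`Dominated.exists_matched`,
`Matched.dominated`). Let the two members of each pair share their Brownian increments, their clock
and the displacement at a birth. Then the order inside each pair persists, and when a pair branches
the two children are ordered too. If an unmatched particle of `z` branches, `c` only moves and stays
dominated. Selection truncates tail counts at the number of survivors (`countP_deleteLeftmost`),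
which makes it harmless: for the upper barrier, `c` is the true process, which has `N` particles, so
that trimming `z` to `N` costs nothing; for the lower barrier, `z` is the true process, and `c`
never grows beyond `N` by branching, so that the deletion of the leftmost particle of `z` costs
nothing, while cuts of `c` only help. `Compatible` and `BlockCompatible` record this;
`Compatible.dominated_evolve` runs the induction over rings and `RowsGood.dominated_blockPath` the
one over blocks.

The work lies in the laws. Each process is driven by its own i.i.d. steps, one from each of its
rings to the next, and the barriers also take fresh steps at each block. A ring of an unmatched
particle of `z` is not a ring of `c`, so one step of `c` has to be glued from several steps of `z`;
likewise a step of the true process may straddle the end of a block. A `Merger` performs such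
gluings. A single gluing preserves the law of a step, because exponential clocks have no memory and
Brownian motion is Markov, provided that the gluing time does not depend on the marks being renewed
(`map_joinStep`). Stopping the machine after `n` steps and copying the source from then on gives an
exactly i.i.d. output (`Merger.Lawful.map_approx`); if every glued step is almost surely completed,
this passes to the limit (`Merger.Lawful.map_output`). Completion holds because an unfinished step
would have an infinite clock (`Merger.Lawful.ae_productive`).

Three machines are used: `couplingMerger` turns the noise of `z` into noise for `c` inside a block,
`rowsMerger` applies it block by block, and `blockMerger` joins the blocks of the true process into
one sequence. Two almost sure facts support them: rings do not accumulate (`ae_nonExplosive`) and no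
two clocks are equal (`ae_tieFree`). Brownian motion itself is built from a Gaussian family on the
rationals by a fourth moment bound, which yields the Wiener measure on a space of continuous paths.
-/

namespace ParticleSystem

/-! ### Gaussian families with a prescribed Gram matrix -/

section GaussianFamily

open InnerProductSpace

variable {H : Type*} [NormedAddCommGroup H] [InnerProductSpace ℝ H]

theorem inner_gramSchmidtNormed_of_ne (v : ℕ → H) {i j : ℕ} (hij : i ≠ j) :
    inner ℝ (gramSchmidtNormed ℝ v i) (gramSchmidtNormed ℝ v j) = 0 := by
  simp [gramSchmidtNormed, inner_smul_left, inner_smul_right, gramSchmidt_orthogonal ℝ v hij]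

/-- Since `v n` lies in the span of the first `m + 1` orthonormalised vectors, its expansion is
finite and exact. Linear dependence among the `v i` is allowed: it produces zero vectors, which
contribute nothing. -/
theorem sum_inner_gramSchmidtNormed_smul (v : ℕ → H) {n m : ℕ} (hnm : n ≤ m) :
    ∑ k ∈ Finset.range (m + 1), inner ℝ (gramSchmidtNormed ℝ v k) (v n) •
      gramSchmidtNormed ℝ v k = v n := by
  have hmem : v n ∈ Submodule.span ℝ (gramSchmidtNormed ℝ v '' Set.Iic m) := by
    rw [span_gramSchmidtNormed, span_gramSchmidt_Iic]
    exact Submodule.subset_span ⟨n, hnm, rfl⟩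
  refine Submodule.span_induction (p := fun x _ => ∑ k ∈ Finset.range (m + 1),
    inner ℝ (gramSchmidtNormed ℝ v k) x • gramSchmidtNormed ℝ v k = x) ?_ ?_ ?_ ?_ hmem
  · rintro _ ⟨j, hj, rfl⟩
    rw [Finset.sum_eq_single j]
    · by_cases h : gramSchmidtNormed ℝ v j = 0
      · simp [h]
      · rw [real_inner_self_eq_norm_sq, gramSchmidtNormed_unit_length' h]; simp
    · intro k _ hk
      rw [inner_gramSchmidtNormed_of_ne v hk, zero_smul]
    · intro h
      exact absurd (Finset.mem_range.2 (Nat.lt_succ_of_le hj)) h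
  · simp
  · intro x y _ _ hx hy
    simp only [inner_add_right, add_smul, Finset.sum_add_distrib, hx, hy]
  · intro a x _ hx
    simp only [inner_smul_right, mul_smul, ← Finset.smul_sum, hx]

/-- Parseval's identity is already exact when one of the two vectors lies in the span, so no bound
on `m` is needed. -/
theorem sum_inner_mul_inner_gramSchmidtNormed (v : ℕ → H) {n m l : ℕ} (hn : n ≤ l) :
    ∑ k ∈ Finset.range (l + 1), inner ℝ (gramSchmidtNormed ℝ v k) (v n) *
      inner ℝ (gramSchmidtNormed ℝ v k) (v m) = inner ℝ (v n) (v m) := by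
  conv_rhs => rw [← sum_inner_gramSchmidtNormed_smul v hn, sum_inner]
  simp [inner_smul_left]

theorem inner_gramSchmidtNormed_eq_zero (v : ℕ → H) {n k : ℕ} (h : n < k) :
    inner ℝ (gramSchmidtNormed ℝ v k) (v n) = 0 := by
  simp [gramSchmidtNormed, inner_smul_left, gramSchmidt_inv_triangular ℝ v h]

/-- A countable centered Gaussian family whose covariance is the Gram matrix of given vectors. -/
theorem exists_isGaussianProcess_covariance_eq_inner {T : Type*} [Countable T] [Infinite T]
    (v : T → H) :
    ∃ X : T → (ℕ → ℝ) → ℝ, (∀ t, Measurable (X t)) ∧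
      IsGaussianProcess X (Measure.infinitePi fun _ : ℕ => gaussianReal 0 1) ∧
      (∀ t, ∫ ω, X t ω ∂(Measure.infinitePi fun _ : ℕ => gaussianReal 0 1) = 0) ∧
      ∀ s t, cov[X s, X t; Measure.infinitePi fun _ : ℕ => gaussianReal 0 1] =
        inner ℝ (v s) (v t) := by
  set P : Measure (ℕ → ℝ) := Measure.infinitePi fun _ : ℕ => gaussianReal 0 1 with hP
  have hlaw : ∀ k : ℕ, HasLaw (fun ω : ℕ → ℝ => ω k) (gaussianReal 0 1) P := fun k =>
    (measurePreserving_eval_infinitePi (fun _ : ℕ => gaussianReal 0 1) k).hasLaw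
  have hind : iIndepFun (fun (k : ℕ) (ω : ℕ → ℝ) => ω k) P :=
    iIndepFun_infinitePi (X := fun _ x => x) (fun _ => measurable_id)
  have hG : IsGaussianProcess (fun (k : ℕ) (ω : ℕ → ℝ) => ω k) P :=
    ⟨fun I => (hind.precomp (g := fun i : I => (i : ℕ)) Subtype.val_injective).hasGaussianLaw
      fun i => (hlaw i).hasGaussianLaw⟩
  have hL2 : ∀ k : ℕ, MemLp (fun ω : ℕ → ℝ => ω k) 2 P := fun k =>
    (hlaw k).hasGaussianLaw.memLp_two
  have hcov : ∀ j k : ℕ, cov[fun ω : ℕ → ℝ => ω j, fun ω => ω k; P] = if j = k then 1 else 0 := by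
    intro j k
    split_ifs with h
    · subst h
      rw [covariance_self (hL2 j).aemeasurable, (hlaw j).variance_eq, variance_id_gaussianReal]
      simp
    · exact (hind.indepFun h).covariance_eq_zero (hL2 j) (hL2 k)
  obtain ⟨_⟩ := nonempty_denumerable T
  let e : T ≃ ℕ := Denumerable.eqv T
  let u : ℕ → H := fun n => v (e.symm n)
  -- The process is `X t = ∑ c k * ω k` with independent standard Gaussian `ω k`; its covariance is
  -- then the Parseval sum of the coefficients.
  let c : ℕ → ℕ → ℝ := fun n k => inner ℝ (gramSchmidtNormed ℝ u k) (u n)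
  refine ⟨fun t ω => ∑ k ∈ Finset.range (e t + 1), c (e t) k * ω k, fun t => by fun_prop, ?_, ?_, ?_⟩
  · refine hG.of_isGaussianProcess fun t => ⟨Finset.range (e t + 1), ?_⟩
    refine ⟨∑ k : Finset.range (e t + 1), c (e t) k • ContinuousLinearMap.proj k, fun ω => ?_⟩
    simp only [_root_.sum_apply, _root_.smul_apply,
      ContinuousLinearMap.proj_apply, Finset.restrict, smul_eq_mul]
    exact (Finset.sum_coe_sort (Finset.range (e t + 1)) fun k => c (e t) k * ω k).symm
  · intro t
    rw [integral_finsetSum]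
    · refine Finset.sum_eq_zero fun k _ => ?_
      rw [integral_const_mul, (hlaw k).integral_eq, integral_id_gaussianReal, mul_zero]
    · exact fun k _ => ((hL2 k).integrable one_le_two).const_mul _
  -- Both sums are extended to a common length: the added coefficients vanish because Gram–Schmidt
  -- is triangular.
  · have key : ∀ m l, m ≤ l → (fun ω : ℕ → ℝ => ∑ k ∈ Finset.range (m + 1), c m k * ω k) =
        fun ω => ∑ k : Fin (l + 1), c m k * ω k := by
      intro m l hml
      funext ω
      rw [Fin.sum_univ_eq_sum_range (fun k => c m k * ω k)]
      refine Finset.sum_subset (Finset.range_mono (by omega)) fun k _ hk => ?_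
      simp only [Finset.mem_range, not_lt] at hk
      simp only [c, inner_gramSchmidtNormed_eq_zero u (show m < k by omega), zero_mul]
    intro s t
    beta_reduce
    rw [key _ (max (e s) (e t)) (le_max_left _ _), key _ (max (e s) (e t)) (le_max_right _ _),
      covariance_fun_sum_fun_sum
        (X := fun (k : Fin (max (e s) (e t) + 1)) (ω : ℕ → ℝ) => c (e s) k * ω k)
        (Y := fun (k : Fin (max (e s) (e t) + 1)) (ω : ℕ → ℝ) => c (e t) k * ω k)
        (fun k => (hL2 k).const_mul _) (fun k => (hL2 k).const_mul _)]
    have hR : inner ℝ (v s) (v t) =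
        ∑ k : Fin (max (e s) (e t) + 1), c (e s) k * c (e t) k := by
      have : ∀ x, v x = u (e x) := fun x => by simp [u]
      rw [this s, this t, Fin.sum_univ_eq_sum_range (fun k => c (e s) k * c (e t) k)]
      exact (sum_inner_mul_inner_gramSchmidtNormed u (le_max_left _ _)).symm
    rw [hR]
    refine Finset.sum_congr rfl fun j _ => ?_
    simp only [covariance_const_mul_left, covariance_const_mul_right, hcov, Fin.val_inj]
    rw [Finset.sum_eq_single j]
    · simp; ring
    · intro k _ hk; simp [hk.symm]
    · simp

end GaussianFamily

/-- There is a centered Gaussian process indexed by the nonnegative rationals with the covariance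
of Brownian motion. -/
theorem exists_rational_brownian :
    ∃ X : ℚ≥0 → (ℕ → ℝ) → ℝ, (∀ t, Measurable (X t)) ∧
      IsGaussianProcess X (Measure.infinitePi fun _ : ℕ => gaussianReal 0 1) ∧
      (∀ t, ∫ ω, X t ω ∂(Measure.infinitePi fun _ : ℕ => gaussianReal 0 1) = 0) ∧
      ∀ s t, cov[X s, X t; Measure.infinitePi fun _ : ℕ => gaussianReal 0 1] =
        min (s : ℝ) (t : ℝ) := by
  -- The vectors are the indicators of `[0, t]` in `L²(ℝ)`, whose inner products are the lengths
  -- `min s t` of the intersections.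
  obtain ⟨X, h1, h2, h3, h4⟩ := exists_isGaussianProcess_covariance_eq_inner (T := ℚ≥0)
    (fun t => indicatorConstLp (E := ℝ) (μ := (volume : Measure ℝ)) 2
      (measurableSet_Icc (a := (0 : ℝ)) (b := (t : ℝ))) (by simp) (1 : ℝ))
  refine ⟨X, h1, h2, h3, fun s t => ?_⟩
  rw [h4, L2.inner_indicatorConstLp_indicatorConstLp (𝕜 := ℝ) measurableSet_Icc measurableSet_Icc
    (by simp) (by simp), Set.Icc_inter_Icc]
  have h : ∀ x : ℚ≥0, (0 : ℝ) ≤ x := fun x => by exact_mod_cast x.2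
  simp [Measure.real, ENNReal.toReal_min, ENNReal.toReal_ofReal (h _)]

/-! ### Continuous extension of a function on the rationals with small increments on a grid -/

/-- The value of `x` at the last point of the grid of mesh `32⁻ⁿ` before `t`. -/
noncomputable def gridValue (x : ℚ≥0 → ℝ) (n : ℕ) (t : ℝ≥0) : ℝ := x (⌊32 ^ n * t⌋₊ / 32 ^ n)

/-- Passing to the next grid costs fewer than `32` increments of size `B / 2 ^ (n + 1)`, so the grid
values converge geometrically. Points closer than `32⁻ⁿ` have equal or adjacent grid points, and the
limit therefore inherits a modulus of continuity of order `2⁻ⁿ` at scale `32⁻ⁿ`. -/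
theorem exists_continuous_tendsto_gridValue (x : ℚ≥0 → ℝ)
    (hx : ∀ K : ℕ, ∃ B : ℝ, ∀ n j : ℕ, j < K * 32 ^ n →
      |x (((j + 1 : ℕ) : ℚ≥0) / 32 ^ n) - x ((j : ℚ≥0) / 32 ^ n)| ≤ B / 2 ^ n) :
    ∃ f : ℝ≥0 → ℝ, Continuous f ∧
      ∀ t, Filter.Tendsto (fun n => gridValue x n t) Filter.atTop (nhds (f t)) := by
  have hfl : ∀ (K n : ℕ) (t : ℝ≥0), t < K → ⌊32 ^ n * t⌋₊ < K * 32 ^ n := by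
    intro K n t ht
    rw [Nat.floor_lt zero_le]
    push_cast
    rw [mul_comm]
    exact mul_lt_mul_of_pos_right ht (by positivity)
  have hstep : ∀ K : ℕ, ∃ B : ℝ, 0 ≤ B ∧ (∀ n (t : ℝ≥0), t < K →
        dist (gridValue x n t) (gridValue x (n + 1) t) ≤ B / 2 / 2 ^ n) ∧
      ∀ n (s t : ℝ≥0), s ≤ t → t < K → t < s + (32 ^ n)⁻¹ →
        dist (gridValue x n s) (gridValue x n t) ≤ B / 2 ^ n := by
    intro K
    obtain ⟨B₀, hB₀⟩ := hx K
    set B := |B₀|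
    have hB : ∀ n j : ℕ, j < K * 32 ^ n →
      |x (((j + 1 : ℕ) : ℚ≥0) / 32 ^ n) - x ((j : ℚ≥0) / 32 ^ n)| ≤ B / 2 ^ n := fun n j hj =>
        (hB₀ n j hj).trans (by gcongr; exact le_abs_self _)
    have hB0 : 0 ≤ B := abs_nonneg _
    -- The last points `a` and `b` of two successive grids satisfy `32 a ≤ b < 32 a + 32`, and `32 *
    -- (B / 2 ^ (n + 1)) = (32 * B) / 2 / 2 ^ n` has the form required for geometric convergence.
    refine ⟨32 * B, by positivity, fun n t ht => ?_, fun n s t hst ht hts => ?_⟩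
    · set a := ⌊32 ^ n * t⌋₊
      set b := ⌊32 ^ (n + 1) * t⌋₊
      have hab : 32 * a ≤ b := by
        refine Nat.le_floor ?_
        have := Nat.floor_le (a := 32 ^ n * t) zero_le
        push_cast
        calc (32 : ℝ≥0) * a ≤ 32 * (32 ^ n * t) := by gcongr
          _ = 32 ^ (n + 1) * t := by ring
      have hba : b < 32 * a + 32 := by
        rw [Nat.floor_lt zero_le]
        have := Nat.lt_floor_add_one (32 ^ n * t)
        push_cast
        calc (32 : ℝ≥0) ^ (n + 1) * t = 32 * (32 ^ n * t) := by ring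
          _ < 32 * (a + 1) := by gcongr
          _ = 32 * a + 32 := by ring
      have hbK : b < K * 32 ^ (n + 1) := hfl K (n + 1) t ht
      have hi : ∀ i : ℕ, 32 * a + i ≤ b →
          |x (((32 * a + i : ℕ) : ℚ≥0) / 32 ^ (n + 1)) - x ((a : ℚ≥0) / 32 ^ n)| ≤
            i * (B / 2 ^ (n + 1)) := by
        intro i
        induction i with
        | zero =>
          intro _
          have : ((32 * a + 0 : ℕ) : ℚ≥0) / 32 ^ (n + 1) = (a : ℚ≥0) / 32 ^ n := by
            push_cast; rw [pow_succ]; field_simp; simp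
          rw [this]; simp
        | succ i ih =>
          intro h
          have h1 := ih (by omega)
          have h2 := hB (n + 1) (32 * a + i) (by omega)
          rw [← add_assoc]
          calc _ ≤ _ := abs_sub_le _ (x (((32 * a + i : ℕ) : ℚ≥0) / 32 ^ (n + 1))) _
            _ ≤ B / 2 ^ (n + 1) + i * (B / 2 ^ (n + 1)) := add_le_add h2 h1
            _ = _ := by push_cast; ring
      have h3 := hi (b - 32 * a) (by omega)
      rw [Nat.add_sub_cancel' hab] at h3
      rw [dist_comm, Real.dist_eq]
      refine h3.trans ?_
      have h4 : ((b - 32 * a : ℕ) : ℝ) ≤ 32 := by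
        have : b - 32 * a ≤ 32 := by omega
        exact_mod_cast this
      calc ((b - 32 * a : ℕ) : ℝ) * (B / 2 ^ (n + 1)) ≤ 32 * (B / 2 ^ (n + 1)) := by gcongr
        _ = 32 * B / 2 / 2 ^ n := by rw [pow_succ]; field_simp
    · have h1 : ⌊32 ^ n * s⌋₊ ≤ ⌊32 ^ n * t⌋₊ := Nat.floor_le_floor (by gcongr)
      have h2 : ⌊32 ^ n * t⌋₊ < ⌊32 ^ n * s⌋₊ + 2 := by
        rw [Nat.floor_lt zero_le]
        have := Nat.lt_floor_add_one (32 ^ n * s)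
        push_cast
        calc (32 : ℝ≥0) ^ n * t < 32 ^ n * (s + (32 ^ n)⁻¹) := by gcongr
          _ = 32 ^ n * s + 1 := by field_simp
          _ ≤ ⌊32 ^ n * s⌋₊ + 1 + 1 := by gcongr
          _ = _ := by ring
      have hK := hfl K n s (hst.trans_lt ht)
      have h32 : B / 2 ^ n ≤ 32 * B / 2 ^ n := by gcongr; linarith
      unfold gridValue
      obtain h | h : ⌊32 ^ n * t⌋₊ = ⌊32 ^ n * s⌋₊ ∨ ⌊32 ^ n * t⌋₊ = ⌊32 ^ n * s⌋₊ + 1 := by omega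
      · rw [h, dist_self]; positivity
      · rw [h, dist_comm, Real.dist_eq]
        exact (hB n _ hK).trans h32
  have hlim : ∀ t : ℝ≥0, ∃ y, Filter.Tendsto (fun n => gridValue x n t) Filter.atTop (nhds y) := by
    intro t
    obtain ⟨K, hK⟩ := exists_nat_gt t
    obtain ⟨B, -, hB, -⟩ := hstep K
    exact cauchySeq_tendsto_of_complete (cauchySeq_of_le_geometric_two fun n => hB n t hK)
  choose f hf using hlim
  refine ⟨f, ?_, hf⟩
  have hmod : ∀ K : ℕ, ∃ B : ℝ, ∀ n (s t : ℝ≥0), s ≤ t → t < K → t < s + (32 ^ n)⁻¹ →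
      dist (f s) (f t) ≤ B / 2 ^ n := by
    intro K
    obtain ⟨B, hB0, hB1, hB2⟩ := hstep K
    refine ⟨3 * B, fun n s t hst ht hts => ?_⟩
    have h1 := dist_le_of_le_geometric_two_of_tendsto (fun n => hB1 n s (hst.trans_lt ht)) (hf s) n
    have h2 := dist_le_of_le_geometric_two_of_tendsto (fun n => hB1 n t ht) (hf t) n
    have h3 := hB2 n s t hst ht hts
    calc dist (f s) (f t) ≤ dist (f s) (gridValue x n s) + dist (gridValue x n s) (gridValue x n t)
          + dist (gridValue x n t) (f t) := dist_triangle4 _ _ _ _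
      _ ≤ B / 2 ^ n + B / 2 ^ n + B / 2 ^ n := by rw [dist_comm (f s)]; gcongr
      _ = 3 * B / 2 ^ n := by ring
  rw [continuous_iff_continuousAt]
  intro t
  rw [Metric.continuousAt_iff]
  intro ε hε
  obtain ⟨K, hK⟩ := exists_nat_gt (t + 1)
  obtain ⟨B, hB⟩ := hmod K
  obtain ⟨n, hn⟩ : ∃ n : ℕ, B / 2 ^ n < ε := by
    have : Filter.Tendsto (fun n : ℕ => B / 2 ^ n) Filter.atTop (nhds 0) := by
      have h := (tendsto_pow_atTop_nhds_zero_of_lt_one (r := (1 / 2 : ℝ)) (by norm_num)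
        (by norm_num)).const_mul B
      simpa [div_eq_mul_inv] using h
    exact (this.eventually_lt_const hε).exists
  refine ⟨(32 ^ n)⁻¹, by positivity, fun {s} hs => lt_of_le_of_lt ?_ hn⟩
  have h1 : ((32 : ℝ) ^ n)⁻¹ ≤ 1 := inv_le_one_of_one_le₀ (one_le_pow₀ (by norm_num))
  rw [NNReal.dist_eq, abs_lt] at hs
  have hKr : (t : ℝ) + 1 < K := by exact_mod_cast hK
  rcases le_total s t with h | h
  · refine hB n s t h ?_ ?_
    · exact lt_of_le_of_lt (by simp) hK
    · rw [← NNReal.coe_lt_coe]; push_cast; linarith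
  · rw [dist_comm]
    refine hB n t s h ?_ ?_
    · rw [← NNReal.coe_lt_coe]; push_cast; linarith
    · rw [← NNReal.coe_lt_coe]; push_cast; linarith

/-! ### Construction of Brownian motion -/

theorem lintegral_enorm_pow_four_gaussianReal (v : ℝ≥0) :
    ∫⁻ r, ‖r‖ₑ ^ 4 ∂(gaussianReal 0 v) = (v : ENNReal) ^ 2 * ∫⁻ r, ‖r‖ₑ ^ 4 ∂(gaussianReal 0 1) := by
  have h : gaussianReal 0 v = (gaussianReal 0 1).map (fun r => √(v : ℝ) * r) := by
    rw [gaussianReal_map_const_mul]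
    congr 1
    · simp
    · ext; simp
  rw [h, lintegral_map (by fun_prop) (by fun_prop), ← lintegral_const_mul _ (by fun_prop)]
  refine lintegral_congr fun r => ?_
  have : ‖√(v : ℝ)‖ₑ ^ 4 = (v : ENNReal) ^ 2 := by
    rw [show 4 = 2 * 2 from rfl, pow_mul, ← enorm_pow, Real.sq_sqrt (NNReal.coe_nonneg v)]
    simp
  rw [enorm_mul, mul_pow, this]

theorem lintegral_enorm_pow_four_gaussianReal_ne_top :
    ∫⁻ r, ‖r‖ₑ ^ 4 ∂(gaussianReal 0 1) ≠ ⊤ := by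
  have h := (memLp_id_gaussianReal (μ := 0) (v := 1) 4).eLpNorm_lt_top
  rw [eLpNorm_lt_top_iff_lintegral_rpow_enorm_lt_top (by simp) (by simp)] at h
  have h4 : (((4 : ℝ≥0) : ENNReal)).toReal = ((4 : ℕ) : ℝ) := by simp
  simp only [h4, ENNReal.rpow_natCast, id] at h
  exact h.ne

/-- A linear combination is a one-dimensional centered Gaussian, so its characteristic function
depends only on the covariances. The formula is applied both to the approximations at grid times and
to the intended finite-dimensional laws of Brownian motion. -/
theorem integral_cexp_sum_of_isGaussianProcess {T Ω ι : Type*} [MeasurableSpace Ω] [Fintype ι]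
    {P : Measure Ω} {Z : T → Ω → ℝ} (hG : IsGaussianProcess Z P) (h0 : ∀ t, ∫ ω, Z t ω ∂P = 0)
    {c : T → T → ℝ} (hc : ∀ s t, cov[Z s, Z t; P] = c s t) (τ : ι → T) (a : ι → ℝ) :
    ∫ ω, Complex.exp (((∑ i, a i * Z (τ i) ω : ℝ) : ℂ) * Complex.I) ∂P =
      Complex.exp (-((∑ i, ∑ j, a i * a j * c (τ i) (τ j) : ℝ) : ℂ) / 2) := by
  have := hG.isProbabilityMeasure
  have hW : HasGaussianLaw (fun ω => ∑ i, a i * Z (τ i) ω) P :=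
    ((hG.comp_right τ).smul a).hasGaussianLaw_fun_sum (I := Finset.univ)
  have hL2 : ∀ i, MemLp (fun ω => a i * Z (τ i) ω) 2 P := fun i =>
    (hG.hasGaussianLaw_eval (τ i)).memLp_two.const_mul _
  have hm : ∫ ω, ∑ i, a i * Z (τ i) ω ∂P = 0 := by
    rw [integral_finsetSum _ fun i _ => (hL2 i).integrable one_le_two]
    simp [integral_const_mul, h0]
  have hv : Var[fun ω => ∑ i, a i * Z (τ i) ω; P] = ∑ i, ∑ j, a i * a j * c (τ i) (τ j) := by
    rw [variance_fun_sum hL2]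
    refine Finset.sum_congr rfl fun i _ => Finset.sum_congr rfl fun j _ => ?_
    rw [covariance_const_mul_left, covariance_const_mul_right, hc]; ring
  have h := charFun_gaussianReal (μ := ∫ ω, ∑ i, a i * Z (τ i) ω ∂P)
    (v := Var[fun ω => ∑ i, a i * Z (τ i) ω; P].toNNReal) 1
  rw [← hW.map_eq_gaussianReal, charFun_apply_real, integral_map hW.aemeasurable (by fun_prop), hm,
    Real.coe_toNNReal _ (variance_nonneg _ _), hv] at h
  simpa [neg_div] using h

section

variable {Ω : Type*} [MeasurableSpace Ω] {P : Measure Ω} {X : ℚ≥0 → Ω → ℝ}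

theorem hasLaw_sub_of_covariance_eq_min (hG : IsGaussianProcess X P) (h0 : ∀ t, ∫ ω, X t ω ∂P = 0)
    (hc : ∀ s t, cov[X s, X t; P] = min (s : ℝ) (t : ℝ)) (n j : ℕ) :
    HasLaw (fun ω => X (((j + 1 : ℕ) : ℚ≥0) / 32 ^ n) ω - X ((j : ℚ≥0) / 32 ^ n) ω)
      (gaussianReal 0 (32 ^ n)⁻¹) P := by
  have hL2 : ∀ t, MemLp (X t) 2 P := fun t => (hG.hasGaussianLaw_eval t).memLp_two
  have := hG.isProbabilityMeasure
  have hW := hG.hasGaussianLaw_fun_sub (s := ((j + 1 : ℕ) : ℚ≥0) / 32 ^ n)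
    (t := (j : ℚ≥0) / 32 ^ n)
  refine ⟨hW.aemeasurable, ?_⟩
  rw [hW.map_eq_gaussianReal, integral_sub ((hL2 _).integrable one_le_two)
    ((hL2 _).integrable one_le_two), h0, h0, sub_zero, variance_fun_sub (hL2 _) (hL2 _),
    ← covariance_self (hL2 _).aemeasurable, ← covariance_self (hL2 _).aemeasurable, hc, hc, hc]
  congr 1
  have : ((j : ℝ)) / 32 ^ n ≤ (j + 1 : ℝ) / 32 ^ n := by gcongr; linarith
  push_cast
  rw [min_self, min_self, min_eq_right this, ← NNReal.coe_inj, Real.coe_toNNReal]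
  · push_cast; field_simp; ring
  · rw [← sub_nonneg] at this
    linarith

/-- An increment over the mesh `32⁻ⁿ` has fourth moment `C * 32⁻²ⁿ`, and there are `K * 32 ^ n` of
them. Weighted by `16 ^ n` they contribute `K * C * 2⁻ⁿ` at level `n`, so the total weighted sum `S`
has finite mean and is almost surely finite. As `S` bounds each of its terms, it controls all
increments at once; the mesh ratio `32 > 16` makes the series converge. -/
theorem ae_exists_increment_le (hG : IsGaussianProcess X P) (hX : ∀ t, Measurable (X t))
    (h0 : ∀ t, ∫ ω, X t ω ∂P = 0)
    (hc : ∀ s t, cov[X s, X t; P] = min (s : ℝ) (t : ℝ)) (K : ℕ) :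
    ∀ᵐ ω ∂P, ∃ B : ℝ, ∀ n j : ℕ, j < K * 32 ^ n →
      |X (((j + 1 : ℕ) : ℚ≥0) / 32 ^ n) ω - X ((j : ℚ≥0) / 32 ^ n) ω| ≤ B / 2 ^ n := by
  set Δ : ℕ → ℕ → Ω → ℝ := fun n j ω =>
    X (((j + 1 : ℕ) : ℚ≥0) / 32 ^ n) ω - X ((j : ℚ≥0) / 32 ^ n) ω
  have hΔ : ∀ n j, Measurable (Δ n j) := fun n j => (hX _).sub (hX _)
  set C := ∫⁻ r, ‖r‖ₑ ^ 4 ∂(gaussianReal 0 1)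
  have hC : C ≠ ⊤ := lintegral_enorm_pow_four_gaussianReal_ne_top
  have h4 : ∀ n j, ∫⁻ ω, ‖Δ n j ω‖ₑ ^ 4 ∂P = ((32 ^ n)⁻¹ : ENNReal) ^ 2 * C := by
    intro n j
    have h := (hasLaw_sub_of_covariance_eq_min hG h0 hc n j).lintegral_comp (f := fun r => ‖r‖ₑ ^ 4)
      (by fun_prop)
    simp only [Δ]
    rw [h, lintegral_enorm_pow_four_gaussianReal]
    congr 2
    rw [ENNReal.coe_inv (by positivity)]
    simp
  have hfin : ∫⁻ ω, ∑' n : ℕ, ∑ j ∈ Finset.range (K * 32 ^ n), 16 ^ n * ‖Δ n j ω‖ₑ ^ 4 ∂P ≠ ⊤ := by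
    rw [lintegral_tsum fun n => by fun_prop]
    have : ∀ n : ℕ, ∫⁻ ω, ∑ j ∈ Finset.range (K * 32 ^ n), 16 ^ n * ‖Δ n j ω‖ₑ ^ 4 ∂P =
        K * C * (2⁻¹) ^ n := by
      intro n
      rw [lintegral_finsetSum _ fun j _ => by fun_prop]
      simp_rw [lintegral_const_mul _ ((hΔ n _).enorm.pow_const 4), h4]
      rw [Finset.sum_const, Finset.card_range, nsmul_eq_mul]
      have e : (32 : ENNReal) ^ n * 16 ^ n * ((32 ^ n)⁻¹ ^ 2) = 2⁻¹ ^ n := by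
        have h1 : (32 : ENNReal) ^ n * (32 ^ n)⁻¹ = 1 :=
          ENNReal.mul_inv_cancel (by positivity) (by finiteness)
        have h2 : (16 : ENNReal) ^ n * (16 ^ n)⁻¹ = 1 :=
          ENNReal.mul_inv_cancel (by positivity) (by finiteness)
        have h3 : ((32 : ENNReal) ^ n)⁻¹ = (16 ^ n)⁻¹ * 2⁻¹ ^ n := by
          rw [show (32 : ENNReal) = 16 * 2 by norm_num, mul_pow, ENNReal.mul_inv (by simp) (by simp),
            ENNReal.inv_pow, ENNReal.inv_pow]
        calc (32 : ENNReal) ^ n * 16 ^ n * ((32 ^ n)⁻¹ ^ 2)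
            = (32 ^ n * (32 ^ n)⁻¹) * (16 ^ n * (32 ^ n)⁻¹) := by ring
          _ = 16 ^ n * ((16 ^ n)⁻¹ * 2⁻¹ ^ n) := by rw [h1, one_mul, h3]
          _ = (16 ^ n * (16 ^ n)⁻¹) * 2⁻¹ ^ n := by ring
          _ = _ := by rw [h2, one_mul]
      rw [← e]
      push_cast
      ring
    simp_rw [this]
    rw [ENNReal.tsum_mul_left, ENNReal.tsum_geometric]
    refine ENNReal.mul_ne_top (ENNReal.mul_ne_top (by simp) hC) ?_
    simp
  have hae := ae_lt_top (by fun_prop) hfin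
  filter_upwards [hae] with ω hω
  set S := ∑' n : ℕ, ∑ j ∈ Finset.range (K * 32 ^ n), 16 ^ n * ‖Δ n j ω‖ₑ ^ 4
  refine ⟨1 + S.toReal, fun n j hj => ?_⟩
  have h1 : (16 : ENNReal) ^ n * ‖Δ n j ω‖ₑ ^ 4 ≤ S :=
    (Finset.single_le_sum (f := fun j => (16 : ENNReal) ^ n * ‖Δ n j ω‖ₑ ^ 4)
      (fun _ _ => zero_le) (Finset.mem_range.2 hj)).trans
      (ENNReal.le_tsum (f := fun n => ∑ j ∈ Finset.range (K * 32 ^ n),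
        (16 : ENNReal) ^ n * ‖Δ n j ω‖ₑ ^ 4) n)
  have h2 : (16 : ℝ) ^ n * |Δ n j ω| ^ 4 ≤ S.toReal := by
    have := ENNReal.toReal_mono hω.ne h1
    simpa using this
  change |Δ n j ω| ≤ _
  rw [le_div_iff₀ (by positivity)]
  have h3 : (|Δ n j ω| * 2 ^ n) ^ 4 ≤ S.toReal := by
    rw [mul_pow, ← pow_mul, mul_comm n 4, pow_mul]
    norm_num
    linarith
  set y := |Δ n j ω| * 2 ^ n
  have hy : 0 ≤ y := by positivity
  -- This is `y ≤ 1 + y ^ 4`, with `y ^ 4 ≤ S`.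
  nlinarith [sq_nonneg (y ^ 2 - 1), sq_nonneg (y - 1), sq_nonneg y]

theorem tendsto_floor_div_pow (t : ℝ≥0) :
    Filter.Tendsto (fun n : ℕ => (((⌊32 ^ n * t⌋₊ : ℚ≥0) / 32 ^ n : ℚ≥0) : ℝ)) Filter.atTop
      (nhds (t : ℝ)) := by
  have h := (tendsto_nat_floor_mul_div_atTop (R := ℝ) (a := t) t.2).comp
    (tendsto_pow_atTop_atTop_of_one_lt (r := (32 : ℝ)) (by norm_num))
  refine h.congr fun n => ?_
  simp only [Function.comp]
  push_cast
  congr 2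
  rw [mul_comm]
  refine eq_of_forall_le_iff fun m => ?_
  rw [Nat.le_floor_iff (by positivity), Nat.le_floor_iff zero_le, ← NNReal.coe_le_coe]
  push_cast
  rfl

end

/-- The existence of Brownian motion, as a measure on a space with continuous paths. -/
theorem exists_isBrownianReal_continuous :
    ∃ B : ℝ≥0 → (ℕ → ℝ) → ℝ, (∀ t, Measurable (B t)) ∧ (∀ ω, Continuous (B · ω)) ∧
      (∀ ω, B 0 ω = 0) ∧ IsBrownianReal B (Measure.infinitePi fun _ : ℕ => gaussianReal 0 1) := by
  obtain ⟨X, hX, hG, h0, hc⟩ := exists_rational_brownian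
  set P : Measure (ℕ → ℝ) := Measure.infinitePi fun _ : ℕ => gaussianReal 0 1
  have hinc : ∀ᵐ ω ∂P, ∀ K : ℕ, ∃ B : ℝ, ∀ n j : ℕ, j < K * 32 ^ n →
      |X (((j + 1 : ℕ) : ℚ≥0) / 32 ^ n) ω - X ((j : ℚ≥0) / 32 ^ n) ω| ≤ B / 2 ^ n :=
    ae_all_iff.2 fun K => ae_exists_increment_le hG hX h0 hc K
  have hzero : ∀ᵐ ω ∂P, X 0 ω = 0 := by
    have hW := hG.hasGaussianLaw_eval 0
    have hl : HasLaw (X 0) (Measure.dirac 0) P := by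
      refine ⟨hW.aemeasurable, ?_⟩
      rw [hW.map_eq_gaussianReal, ← covariance_self hW.aemeasurable, hc, h0]
      simp
    exact hl.ae_eq_of_dirac
  -- Shrinking the good event to a measurable set of full measure and setting `B` to zero outside it
  -- keeps `B t` measurable and makes continuity and `B 0 = 0` hold everywhere.
  obtain ⟨G, hGsub, hGm, hG1⟩ : ∃ G ⊆ {ω | (∀ K : ℕ, ∃ B : ℝ, ∀ n j : ℕ, j < K * 32 ^ n →
      |X (((j + 1 : ℕ) : ℚ≥0) / 32 ^ n) ω - X ((j : ℚ≥0) / 32 ^ n) ω| ≤ B / 2 ^ n) ∧ X 0 ω = 0},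
      MeasurableSet G ∧ G ∈ ae P := by
    obtain ⟨t, ht, htm, ht0⟩ := exists_measurable_superset_of_null
      (show P {ω | _}ᶜ = 0 from hinc.and hzero)
    refine ⟨tᶜ, Set.compl_subset_comm.1 ht, htm.compl, ?_⟩
    rw [mem_ae_iff, compl_compl, ht0]
  have hex : ∀ ω ∈ G, ∃ f : ℝ≥0 → ℝ, Continuous f ∧
      ∀ t, Filter.Tendsto (fun n => gridValue (X · ω) n t) Filter.atTop (nhds (f t)) :=
    fun ω hω => exists_continuous_tendsto_gridValue _ (hGsub hω).1
  classical
  let B : ℝ≥0 → (ℕ → ℝ) → ℝ := fun t ω => if h : ω ∈ G then (hex ω h).choose t else 0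
  have hBlim : ∀ ω ∈ G, ∀ t, Filter.Tendsto (fun n => gridValue (X · ω) n t) Filter.atTop
      (nhds (B t ω)) := by
    intro ω hω t
    simp only [B, dif_pos hω]
    exact (hex ω hω).choose_spec.2 t
  have hBm : ∀ t, Measurable (B t) := by
    intro t
    refine measurable_of_tendsto_metrizable
      (f := fun n => G.indicator fun ω => gridValue (X · ω) n t) (fun n => ?_) ?_
    · exact (hX _).indicator hGm
    · rw [tendsto_pi_nhds]
      intro ω
      by_cases hω : ω ∈ G
      · simpa [hω] using hBlim ω hω t
      · simp [hω, B]
  have hBc : ∀ ω, Continuous (B · ω) := by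
    intro ω
    by_cases hω : ω ∈ G
    · simp only [B, dif_pos hω]
      exact (hex ω hω).choose_spec.1
    · simp only [B, dif_neg hω]
      exact continuous_const
  have hIm : ∀ I : Finset ℝ≥0, Measurable fun ω => I.restrict (B · ω) := fun I =>
    measurable_pi_lambda _ fun i => hBm i
  refine ⟨B, hBm, hBc, ?_, ⟨⟨fun I => ⟨(hIm I).aemeasurable, ?_⟩⟩, ae_of_all _ hBc⟩⟩
  · intro ω
    by_cases hω : ω ∈ G
    · refine tendsto_nhds_unique (hBlim ω hω 0) ?_
      simp [gridValue, (hGsub hω).2]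
    · simp [B, hω]
  · have hpr : IsProbabilityMeasure (P.map fun ω => I.restrict (B · ω)) :=
      Measure.isProbabilityMeasure_map (hIm I).aemeasurable
    -- The characteristic function of the marginal of `B` is the limit, by dominated convergence, of
    -- those of `X` at grid times; these are explicit in the covariances, which converge to `min s
    -- t`.
    refine Measure.ext_of_charFunDual ?_
    funext L
    obtain ⟨a, hL⟩ : ∃ a : I → ℝ, ∀ x : I → ℝ, L x = ∑ i, a i * x i := by
      refine ⟨fun i => L (fun j => if i = j then 1 else 0), fun x => ?_⟩
      have := L.toLinearMap.pi_apply_eq_sum_univ x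
      simpa [mul_comm] using this
    rw [charFunDual_apply, charFunDual_apply, integral_map (hIm I).aemeasurable
      (by fun_prop)]
    simp_rw [hL]
    have hR := integral_cexp_sum_of_isGaussianProcess (T := I) (ι := I)
      (P := BrownianReal.projectiveFamily I) (Z := fun i x => x i)
      (c := fun i j => min (i.1 : ℝ) (j.1 : ℝ))
      ⟨fun J => (IsGaussian.hasGaussianLaw_id (μ := BrownianReal.projectiveFamily I)).map
        (ContinuousLinearMap.pi fun j : J => ContinuousLinearMap.proj (j : I))⟩
      (BrownianReal.integral_eval_projectiveFamily I)
      (fun s t => by rw [BrownianReal.covariance_eval_projectiveFamily]; simp) id a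
    simp only [id] at hR
    rw [hR]
    have hn : ∀ n : ℕ, ∫ ω, Complex.exp (((∑ i : I, a i * gridValue (X · ω) n i : ℝ) : ℂ) *
        Complex.I) ∂P = _ := fun n => integral_cexp_sum_of_isGaussianProcess hG h0 hc
          (fun i : I => (⌊32 ^ n * (i : ℝ≥0)⌋₊ / 32 ^ n : ℚ≥0)) a
    refine tendsto_nhds_unique (f := fun n : ℕ => ∫ ω, Complex.exp (((∑ i : I, a i *
        gridValue (X · ω) n i : ℝ) : ℂ) * Complex.I) ∂P) (l := Filter.atTop) ?_ ?_
    · refine tendsto_integral_of_dominated_convergence (fun _ => 1) ?_ (integrable_const _) ?_ ?_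
      · intro n
        have : ∀ i : I, Measurable fun ω => gridValue (X · ω) n i := fun i => hX _
        exact Measurable.aestronglyMeasurable (by fun_prop)
      · intro n
        filter_upwards with ω
        rw [Complex.norm_exp_ofReal_mul_I]
      · filter_upwards [hG1] with ω hω
        have h1 : Filter.Tendsto (fun n => ∑ i : I, a i * gridValue (X · ω) n i) Filter.atTop
            (nhds (∑ i : I, a i * B i ω)) :=
          tendsto_finsetSum _ fun i _ => (hBlim ω hω i).const_mul _
        have h2 : Continuous fun r : ℝ => Complex.exp ((r : ℂ) * Complex.I) := by fun_prop
        exact (h2.tendsto _).comp h1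
    · simp_rw [hn]
      have h1 : Filter.Tendsto (fun n : ℕ => ∑ i : I, ∑ j : I, a i * a j *
          min (((⌊32 ^ n * (i : ℝ≥0)⌋₊ : ℚ≥0) / 32 ^ n : ℚ≥0) : ℝ)
            (((⌊32 ^ n * (j : ℝ≥0)⌋₊ : ℚ≥0) / 32 ^ n : ℚ≥0) : ℝ)) Filter.atTop
          (nhds (∑ i : I, ∑ j : I, a i * a j * min (i.1 : ℝ) (j.1 : ℝ))) :=
        tendsto_finsetSum _ fun i _ => tendsto_finsetSum _ fun j _ =>
          ((tendsto_floor_div_pow i).min (tendsto_floor_div_pow j)).const_mul _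
      have h2 : Continuous fun r : ℝ => Complex.exp (-(r : ℂ) / 2) := by fun_prop
      exact (h2.tendsto _).comp h1

/-! ### The path space and the Wiener measure -/

/-- Continuous paths which start at `0`. -/
structure Path where
  /-- The position at each time. -/
  toFun : ℝ≥0 → ℝ
  continuous : Continuous toFun
  zero : toFun 0 = 0

namespace Path

instance : CoeFun Path fun _ => ℝ≥0 → ℝ := ⟨toFun⟩

attribute [simp] Path.zero

instance : MeasurableSpace Path := MeasurableSpace.comap (fun f t => f.toFun t) inferInstance

@[ext]
theorem ext {f g : Path} (h : ∀ t, f t = g t) : f = g := by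
  cases f; cases g; congr; exact funext h

theorem measurable_coe : Measurable (fun (f : Path) (t : ℝ≥0) => f t) :=
  comap_measurable _

theorem measurable_eval (t : ℝ≥0) : Measurable fun f : Path => f t :=
  (measurable_pi_apply t).comp measurable_coe

theorem measurable_iff {α : Type*} [MeasurableSpace α] {F : α → Path} :
    Measurable F ↔ ∀ t, Measurable fun x => F x t := by
  refine ⟨fun h t => (measurable_eval t).comp h, fun h => ?_⟩
  rw [measurable_comap_iff]
  exact measurable_pi_lambda _ h

theorem measurable_eval_uncurry : Measurable fun p : Path × ℝ≥0 => p.1 p.2 := by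
  have := measurable_uncurry_of_continuous_of_measurable (u := fun (t : ℝ≥0) (f : Path) => f t)
    (fun f => f.continuous) measurable_eval
  exact this.comp measurable_swap

theorem measurable_apply {α : Type*} [MeasurableSpace α] {F : α → Path} {s : α → ℝ≥0}
    (hF : Measurable F) (hs : Measurable s) : Measurable fun x => F x (s x) :=
  measurable_eval_uncurry.comp (hF.prodMk hs)

/-- Follow `f` until time `s`, and then the increments of `g`. -/
def concat (s : ℝ≥0) (f g : Path) : Path :=
  ⟨fun t => f (min t s) + g (t - s),
    by have := f.continuous; have := g.continuous; fun_prop, by simp⟩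

theorem concat_of_le {s t : ℝ≥0} (h : t ≤ s) (f g : Path) : concat s f g t = f t := by
  simp [concat, h, tsub_eq_zero_of_le]

theorem concat_add (s t : ℝ≥0) (f g : Path) : concat s f g (s + t) = f s + g t := by
  simp [concat]

theorem measurable_concat {α : Type*} [MeasurableSpace α] {F G : α → Path} {s : α → ℝ≥0}
    (hF : Measurable F) (hG : Measurable G) (hs : Measurable s) :
    Measurable fun x => concat (s x) (F x) (G x) := by
  rw [measurable_iff]
  intro t
  exact (measurable_apply hF (measurable_const.min hs)).add
    (measurable_apply hG (measurable_const.sub hs))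

/-- The increments of `f` after time `s`. -/
def shift (s : ℝ≥0) (f : Path) : Path :=
  ⟨fun t => f (s + t) - f s, by have := f.continuous; fun_prop, by simp⟩

theorem measurable_shift (s : ℝ≥0) : Measurable (shift s) :=
  measurable_iff.2 fun _ => (measurable_eval _).sub (measurable_eval _)

theorem concat_shift (s : ℝ≥0) (f : Path) : concat s f (shift s f) = f := by
  ext t
  rcases le_total t s with h | h
  · rw [concat_of_le h]
  · obtain ⟨u, rfl⟩ := exists_add_of_le h
    rw [concat_add]
    simp [shift]

/-- The path which is stopped at time `s`. -/
def freeze (s : ℝ≥0) (f : Path) : Path :=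
  ⟨fun t => f (min t s), by have := f.continuous; fun_prop, by simp⟩

theorem measurable_freeze (s : ℝ≥0) : Measurable (freeze s) :=
  measurable_iff.2 fun _ => measurable_eval _

theorem concat_freeze (s : ℝ≥0) (f g : Path) : concat s (freeze s f) g = concat s f g := by
  ext t; simp [concat, freeze]

/-- Path measures are determined by the laws of the coordinate processes. -/
theorem measure_ext {μ ν : Measure Path}
    (h : μ.map (fun (f : Path) (t : ℝ≥0) => f t) = ν.map (fun (f : Path) (t : ℝ≥0) => f t)) :
    μ = ν := by
  ext s hs
  obtain ⟨u, hu, rfl⟩ := hs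
  rw [← Measure.map_apply measurable_coe hu, h, Measure.map_apply measurable_coe hu]

/-- The σ-algebra on `Path` is generated by evaluations, so finite-dimensional laws determine a
probability measure on it. This is uniqueness of the Wiener measure. -/
theorem map_eq_of_isPreBrownianReal {Ω Ω' : Type*} [MeasurableSpace Ω] [MeasurableSpace Ω']
    {P : Measure Ω} {P' : Measure Ω'} {F : Ω → Path} {F' : Ω' → Path} (hF : Measurable F)
    (hF' : Measurable F') (hB : IsPreBrownianReal (fun t ω => F ω t) P)
    (hB' : IsPreBrownianReal (fun t ω => F' ω t) P') : P.map F = P'.map F' := by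
  have := hB.isGaussianProcess.isProbabilityMeasure
  have := hB'.isGaussianProcess.isProbabilityMeasure
  have h1 : IsProbabilityMeasure (P.map F) := Measure.isProbabilityMeasure_map hF.aemeasurable
  have h2 : IsProbabilityMeasure (P'.map F') := Measure.isProbabilityMeasure_map hF'.aemeasurable
  apply measure_ext
  have hp1 := isProjectiveLimit_map (P := P.map F) (X := fun (t : ℝ≥0) (f : Path) => f t)
    measurable_coe.aemeasurable
  have hp2 := isProjectiveLimit_map (P := P'.map F') (X := fun (t : ℝ≥0) (f : Path) => f t)
    measurable_coe.aemeasurable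
  refine hp1.unique (P := fun I => (P.map F).map fun ω => I.restrict (fun t => ω t)) ?_
  intro I
  refine (hp2 I).trans ?_
  have hr : Measurable fun f : Path => I.restrict (fun t => f t) :=
    measurable_pi_lambda _ fun i => measurable_eval _
  beta_reduce
  rw [Measure.map_map hr hF', Measure.map_map hr hF]
  exact ((hB'.hasLaw I).map_eq).trans ((hB.hasLaw I).map_eq).symm

end Path

/-- The Wiener measure. -/
noncomputable def wiener : Measure Path :=
  (Measure.infinitePi fun _ : ℕ => gaussianReal 0 1).map fun ω =>
    ⟨fun t => exists_isBrownianReal_continuous.choose t ω,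
      exists_isBrownianReal_continuous.choose_spec.2.1 ω,
      exists_isBrownianReal_continuous.choose_spec.2.2.1 ω⟩

theorem isBrownianReal_wiener : IsBrownianReal (fun t (f : Path) => f t) wiener := by
  obtain ⟨h1, -, -, h4⟩ := exists_isBrownianReal_continuous.choose_spec
  refine ⟨⟨fun I => ?_⟩, ae_of_all _ fun f => f.continuous⟩
  have hr : Measurable fun f : Path => I.restrict (fun t => f t) :=
    measurable_pi_lambda _ fun i => Path.measurable_eval _
  refine ⟨hr.aemeasurable, ?_⟩
  rw [wiener, Measure.map_map hr (Path.measurable_iff.2 h1)]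
  exact (h4.hasLaw I).map_eq

instance : IsProbabilityMeasure wiener :=
  isBrownianReal_wiener.isGaussianProcess.isProbabilityMeasure

theorem map_shift_wiener (s : ℝ≥0) : wiener.map (Path.shift s) = wiener := by
  have h := Path.map_eq_of_isPreBrownianReal (Path.measurable_shift s) measurable_id
    (isBrownianReal_wiener.toIsPreBrownianReal.shift s) isBrownianReal_wiener.toIsPreBrownianReal
  rwa [Measure.map_id] at h

/-- The Markov property of Brownian motion at a deterministic time. -/
theorem map_concat_wiener (s : ℝ≥0) :
    (wiener.prod wiener).map (fun p => Path.concat s p.1 p.2) = wiener := by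
  have hc : Measurable fun p : Path × Path => Path.concat s p.1 p.2 :=
    Path.measurable_concat measurable_fst measurable_snd measurable_const
  -- Concatenation at `s` reads its first path only up to `s`. It thus suffices that the frozen
  -- path, which is a function of the past, is independent of the increments after `s`.
  have hind : IndepFun (Path.freeze s) (Path.shift s) wiener := by
    have h := (isBrownianReal_wiener.toIsPreBrownianReal.indepFun_shift s).symm
    rw [IndepFun_iff_Indep] at h ⊢
    refine indep_of_indep_of_le_left (indep_of_indep_of_le_right h ?_) ?_
    · rw [← measurable_iff_comap_le]
      refine (@Path.measurable_iff _ (MeasurableSpace.comap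
        (fun (f : Path) t => f (s + t) - f s) MeasurableSpace.pi) _).2 fun t => ?_
      exact (measurable_pi_apply t).comp (comap_measurable _)
    · rw [← measurable_iff_comap_le]
      refine (@Path.measurable_iff _ (MeasurableSpace.comap
        (fun (f : Path) (t : Set.Iic s) => f t) MeasurableSpace.pi) _).2 fun t => ?_
      have hm : Measurable fun y : Set.Iic s → ℝ => y ⟨min t s, Set.mem_Iic.2 (min_le_right _ _)⟩ :=
        measurable_pi_apply _
      exact hm.comp (comap_measurable _)
  have hlaw := hind.map_prod_eq_prod_map_map (Path.measurable_freeze s).aemeasurable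
    (Path.measurable_shift s).aemeasurable
  rw [map_shift_wiener] at hlaw
  have h1 : ((wiener.map (Path.freeze s)).prod wiener).map (fun p => Path.concat s p.1 p.2) =
      (wiener.prod wiener).map (fun p => Path.concat s p.1 p.2) := by
    have : (wiener.map (Path.freeze s)).prod wiener =
        (wiener.prod wiener).map (Prod.map (Path.freeze s) id) := by
      rw [← Measure.map_prod_map _ _ (Path.measurable_freeze s) measurable_id, Measure.map_id]
    rw [this, Measure.map_map hc ((Path.measurable_freeze s).prodMap measurable_id)]
    congr 1
    funext p
    simp [Path.concat_freeze]
  rw [← h1, ← hlaw, Measure.map_map hc ((Path.measurable_freeze s).prodMk (Path.measurable_shift s))]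
  have : ((fun p : Path × Path => Path.concat s p.1 p.2) ∘ fun ω =>
      (Path.freeze s ω, Path.shift s ω)) = id := by
    funext f
    simp [Path.concat_freeze, Path.concat_shift]
  rw [this, Measure.map_id]

/-! ### Sequences -/

/-- The sequence which starts with `a` and continues with `v`. -/
def consSeq {K : Type*} (a : K) (v : ℕ → K) : ℕ → K
  | 0 => a
  | n + 1 => v n

/-- The sequence without its first term. -/
def tailSeq {K : Type*} (v : ℕ → K) : ℕ → K := fun n => v (n + 1)

section Seq

variable {K : Type*}

@[simp] theorem consSeq_zero (a : K) (v : ℕ → K) : consSeq a v 0 = a := rfl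
@[simp] theorem consSeq_succ (a : K) (v : ℕ → K) (n : ℕ) : consSeq a v (n + 1) = v n := rfl
@[simp] theorem tailSeq_consSeq (a : K) (v : ℕ → K) : tailSeq (consSeq a v) = v := rfl
@[simp] theorem tailSeq_apply (v : ℕ → K) (n : ℕ) : tailSeq v n = v (n + 1) := rfl

variable [MeasurableSpace K]

@[fun_prop]
theorem measurable_tailSeq : Measurable (tailSeq : (ℕ → K) → ℕ → K) :=
  measurable_pi_lambda _ fun _ => measurable_pi_apply _

theorem _root_.Measurable.consSeq {α : Type*} [MeasurableSpace α] {f : α → K} {g : α → ℕ → K}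
    (hf : Measurable f) (hg : Measurable g) : Measurable fun x => consSeq (f x) (g x) := by
  refine measurable_pi_lambda _ fun n => ?_
  cases n with
  | zero => exact hf
  | succ n => exact (measurable_pi_apply n).comp hg

/-- Any finite set of coordinates lies in an initial segment, where the missing coordinates receive
the trivial constraint. -/
theorem eq_infinitePi_of_range (κ : Measure K) [IsProbabilityMeasure κ] {ν : Measure (ℕ → K)}
    (h : ∀ (n : ℕ) (t : ℕ → Set K), (∀ i, MeasurableSet (t i)) →
      ν {v | ∀ i < n, v i ∈ t i} = ∏ i ∈ Finset.range n, κ (t i)) :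
    ν = Measure.infinitePi fun _ => κ := by
  classical
  refine Measure.eq_infinitePi _ fun s t ht => ?_
  obtain ⟨n, hn⟩ : ∃ n, s ⊆ Finset.range n := s.exists_nat_subset_range
  have h1 := h n (fun i => if i ∈ s then t i else Set.univ) fun i => by
    split_ifs
    exacts [ht i, .univ]
  have h2 : {v : ℕ → K | ∀ i < n, v i ∈ if i ∈ s then t i else Set.univ} = (s : Set ℕ).pi t := by
    ext v
    simp only [Set.mem_ofPred_eq, Set.mem_pi, Finset.mem_coe]
    refine ⟨fun h i hi => by simpa [hi] using h i (Finset.mem_range.1 (hn hi)), fun h i _ => ?_⟩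
    split_ifs with hi
    exacts [h i hi, trivial]
  rw [h2] at h1
  rw [h1, ← Finset.prod_subset hn]
  · exact Finset.prod_congr rfl fun i hi => by simp [hi]
  · intro i _ hi; simp [hi]

theorem infinitePi_range (κ : Measure K) [IsProbabilityMeasure κ] (n : ℕ) (t : ℕ → Set K)
    (ht : ∀ i, MeasurableSet (t i)) :
    (Measure.infinitePi fun _ : ℕ => κ) {v | ∀ i < n, v i ∈ t i} =
      ∏ i ∈ Finset.range n, κ (t i) := by
  rw [← Measure.infinitePi_pi (fun _ : ℕ => κ) (fun i _ => ht i)]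
  congr 1
  ext v
  simp [Set.mem_pi]

theorem map_consSeq (κ : Measure K) [IsProbabilityMeasure κ] :
    (κ.prod (Measure.infinitePi fun _ : ℕ => κ)).map (fun p => consSeq p.1 p.2) =
      Measure.infinitePi fun _ : ℕ => κ := by
  have hm : Measurable fun p : K × (ℕ → K) => consSeq p.1 p.2 :=
    measurable_fst.consSeq measurable_snd
  refine eq_infinitePi_of_range κ fun n t ht => ?_
  rw [Measure.map_apply hm (by measurability)]
  cases n with
  | zero => simp
  | succ n =>
    have : (fun p : K × (ℕ → K) => consSeq p.1 p.2) ⁻¹' {v | ∀ i < n + 1, v i ∈ t i} =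
        t 0 ×ˢ {v | ∀ i < n, v i ∈ t (i + 1)} := by
      ext ⟨a, v⟩
      simp only [Set.mem_preimage, Set.mem_ofPred_eq, Set.mem_prod]
      refine ⟨fun h => ⟨h 0 (by omega), fun i hi => h (i + 1) (by omega)⟩, fun h i hi => ?_⟩
      cases i with
      | zero => exact h.1
      | succ i => exact h.2 i (by omega)
    rw [this, Measure.prod_prod, infinitePi_range κ n (fun i => t (i + 1)) fun i => ht _,
      Finset.prod_range_succ', mul_comm]

theorem map_head_tailSeq (κ : Measure K) [IsProbabilityMeasure κ] :
    (Measure.infinitePi fun _ : ℕ => κ).map (fun v => (v 0, tailSeq v)) =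
      κ.prod (Measure.infinitePi fun _ : ℕ => κ) := by
  have hm : Measurable fun v : ℕ → K => (v 0, tailSeq v) := by fun_prop
  have hm' : Measurable fun p : K × (ℕ → K) => consSeq p.1 p.2 :=
    measurable_fst.consSeq measurable_snd
  conv_lhs => rw [← map_consSeq, Measure.map_map hm hm']
  exact Measure.map_id

end Seq

/-! ### Merging the steps of a sequence of samples

A machine reads samples from a source. While it is pending, the sample read is joined with the
next sample of the sequence which it will produce from then on; otherwise it produces the sample
read. -/

/-- A machine with states in `S` which reads a source in `α` and produces a sequence in `K`. -/
structure Merger (α K S : Type*) where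
  /-- The next sample of the source. -/
  head : α → K
  /-- The remaining source. -/
  rest : S → α → α
  /-- Whether the sample read will be joined with the next sample. -/
  pend : S → K → Prop
  /-- How to join two samples. -/
  join : S → K → K → K
  /-- The sample produced from the sample read. -/
  out : S → K → K
  /-- The new state. -/
  step : S → K → S
  /-- A sequence which is used to replace the output. -/
  base : α → ℕ → K

namespace Merger

variable {α K S : Type*} (A : Merger α K S)

open scoped Classical in
/-- How the output is obtained from the sample read and from the output of the rest. -/
noncomputable def combine (s : S) (w : K) (v : ℕ → K) : ℕ → K :=
  if A.pend s w then consSeq (A.join s w (v 0)) (tailSeq v) else consSeq (A.out s w) v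

/-- The output when the machine is switched off after `n` steps. -/
noncomputable def approx : ℕ → S → α → ℕ → K
  | 0, _, x => A.base x
  | n + 1, s, x => A.combine s (A.head x) (approx n (A.step s (A.head x)) (A.rest s x))

open scoped Classical in
/-- The number of completed samples after `n` steps. -/
noncomputable def count : ℕ → S → α → ℕ
  | 0, _, _ => 0
  | n + 1, s, x =>
    count n (A.step s (A.head x)) (A.rest s x) + if A.pend s (A.head x) then 0 else 1

/-- The state and the source after `n` steps. -/
def orbit : ℕ → S × α → S × α
  | 0, p => p
  | n + 1, p => orbit n (A.step p.1 (A.head p.2), A.rest p.1 p.2)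

open scoped Classical in
/-- The number of steps until sample number `m` is completed. -/
noncomputable def stepsUntil (m : ℕ) (s : S) (x : α) : ℕ :=
  if h : ∃ n, m < A.count n s x then Nat.find h else 0

/-- The output of the machine. -/
noncomputable def output (s : S) (x : α) : ℕ → K := fun m => A.approx (A.stepsUntil m s x) s x m

/-- All samples are eventually completed. -/
def Productive (s : S) (x : α) : Prop := ∀ m, ∃ n, m < A.count n s x

theorem count_add (k n : ℕ) (s : S) (x : α) : A.count (k + n) s x =
    A.count k s x + A.count n (A.orbit k (s, x)).1 (A.orbit k (s, x)).2 := by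
  induction k generalizing s x with
  | zero => simp [count, orbit]
  | succ k ih =>
    rw [show k + 1 + n = (k + n) + 1 by omega, count, ih, count, orbit]
    ring

/-- A completed sample is never revised: running the machine longer changes only samples that are
still incomplete. -/
theorem approx_eq_of_lt_count {n m : ℕ} {s : S} {x : α} (h : m < A.count n s x) {k : ℕ}
    (hk : n ≤ k) : A.approx k s x m = A.approx n s x m := by
  induction n generalizing m s x k with
  | zero => simp [count] at h
  | succ n ih =>
    obtain ⟨k, rfl⟩ : ∃ k', k = k' + 1 := ⟨k - 1, by omega⟩
    have hk' : n ≤ k := by omega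
    rw [count] at h
    rw [approx, approx, combine, combine]
    split_ifs at h ⊢ with hp
    · cases m with
      | zero => simp only [consSeq_zero]; rw [ih (by omega) hk']
      | succ m => simp only [consSeq_succ, tailSeq_apply]; rw [ih (by omega) hk']
    · cases m with
      | zero => rfl
      | succ m => simp only [consSeq_succ]; rw [ih (by omega) hk']

theorem output_eq_approx {n m : ℕ} {s : S} {x : α} (h : m < A.count n s x) :
    A.output s x m = A.approx n s x m := by
  classical
  have hex : ∃ n, m < A.count n s x := ⟨n, h⟩
  rw [output, stepsUntil, dif_pos hex]
  exact (A.approx_eq_of_lt_count (Nat.find_spec hex) (Nat.find_min' hex h)).symm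

theorem Productive.next {A : Merger α K S} {s : S} {x : α} (h : A.Productive s x) :
    A.Productive (A.step s (A.head x)) (A.rest s x) := by
  intro m
  obtain ⟨n, hn⟩ := h (m + 1)
  cases n with
  | zero => simp [count] at hn
  | succ n =>
    refine ⟨n, ?_⟩
    rw [count] at hn
    split_ifs at hn <;> omega

/-- Entries of the approximations stabilise once completed, so the one-step recursion of `approx`
survives in the limit. Trajectories driven by the output are analysed through this equation. -/
theorem Productive.output_eq {A : Merger α K S} {s : S} {x : α} (h : A.Productive s x) :
    A.output s x = A.combine s (A.head x) (A.output (A.step s (A.head x)) (A.rest s x)) := by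
  funext m
  -- One completed sample more than needed is requested, since the step that is peeled off may
  -- itself account for one.
  obtain ⟨n, hn⟩ := h (m + 1)
  cases n with
  | zero => simp [count] at hn
  | succ n =>
    rw [A.output_eq_approx (show m < A.count (n + 1) s x by omega), approx]
    rw [count] at hn
    have h0 : ∀ j ≤ m, A.output (A.step s (A.head x)) (A.rest s x) j =
        A.approx n (A.step s (A.head x)) (A.rest s x) j := fun j hj =>
      A.output_eq_approx (by split_ifs at hn <;> omega)
    rw [combine, combine]
    split_ifs with hp
    · rw [if_pos hp] at hn
      have h1 : A.output (A.step s (A.head x)) (A.rest s x) m =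
        A.approx n (A.step s (A.head x)) (A.rest s x) m := h0 m le_rfl
      cases m with
      | zero => simp [h0]
      | succ m => simp [h1]
    · cases m with
      | zero => rfl
      | succ m => simp [h0]

theorem productive_of_orbit {s : S} {x : α}
    (h : ∀ k, ∃ n, 0 < A.count n (A.orbit k (s, x)).1 (A.orbit k (s, x)).2) :
    A.Productive s x := by
  intro m
  induction m with
  | zero => exact h 0
  | succ m ih =>
    obtain ⟨k, hk⟩ := ih
    obtain ⟨n, hn⟩ := h k
    exact ⟨k + n, by rw [count_add]; omega⟩

/-- While the first sample is incomplete every step read is pending, and each join adds its waiting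
time to the clock of that sample. -/
theorem sum_le_approx (clock : K → ENNReal) (T : S → K → ENNReal)
    (hT : ∀ s w v, A.pend s w → T s w + clock v ≤ clock (A.join s w v)) (n : ℕ) (s : S) (x : α)
    (h : A.count n s x = 0) :
    ∑ k ∈ Finset.range n, T (A.orbit k (s, x)).1 (A.head (A.orbit k (s, x)).2) ≤
      clock (A.approx n s x 0) := by
  induction n generalizing s x with
  | zero => simp
  | succ n ih =>
    rw [count] at h
    have hp : A.pend s (A.head x) := by
      by_contra hp
      simp [hp] at h
    rw [if_pos hp, add_zero] at h
    rw [approx, combine, if_pos hp, Finset.sum_range_succ', add_comm, consSeq_zero]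
    refine le_trans ?_ (hT s _ _ hp)
    exact add_le_add le_rfl (ih _ _ h)

/-! #### The law of the output -/

variable [MeasurableSpace α] [MeasurableSpace K] [MeasurableSpace S]

open scoped Classical in
/-- The machine is measurable, the source has law `μ` and consists of independent samples with law
`κ`, and a single merging step preserves `κ`. -/
structure Lawful (μ : Measure α) (κ : Measure K) : Prop where
  measurable_head : Measurable A.head
  measurable_rest : Measurable fun p : S × α => A.rest p.1 p.2
  measurableSet_pend : MeasurableSet {p : S × K | A.pend p.1 p.2}
  measurable_join : Measurable fun p : (S × K) × K => A.join p.1.1 p.1.2 p.2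
  measurable_out : Measurable fun p : S × K => A.out p.1 p.2
  measurable_step : Measurable fun p : S × K => A.step p.1 p.2
  measurable_base : Measurable A.base
  map_rest : ∀ s, μ.map (fun x => (A.head x, A.rest s x)) = κ.prod μ
  map_base : μ.map A.base = Measure.infinitePi fun _ => κ
  map_single : ∀ s, (κ.prod κ).map
    (fun p => if A.pend s p.1 then A.join s p.1 p.2 else A.out s p.1) = κ

variable {A} {μ : Measure α} {κ : Measure K}

namespace Lawful

theorem measurable_combine (hA : A.Lawful μ κ) :
    Measurable fun p : (S × K) × (ℕ → K) => A.combine p.1.1 p.1.2 p.2 := by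
  refine Measurable.ite (measurable_fst hA.measurableSet_pend) ?_ ?_
  · exact (hA.measurable_join.comp (measurable_fst.prodMk
      ((measurable_pi_apply 0).comp measurable_snd))).consSeq
        (measurable_tailSeq.comp measurable_snd)
  · exact (hA.measurable_out.comp measurable_fst).consSeq measurable_snd

theorem measurable_next (hA : A.Lawful μ κ) :
    Measurable fun p : S × α => (A.step p.1 (A.head p.2), A.rest p.1 p.2) :=
  (hA.measurable_step.comp (measurable_fst.prodMk (hA.measurable_head.comp measurable_snd))).prodMk
    hA.measurable_rest

theorem measurable_approx (hA : A.Lawful μ κ) (n : ℕ) :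
    Measurable fun p : S × α => A.approx n p.1 p.2 := by
  induction n with
  | zero => exact hA.measurable_base.comp measurable_snd
  | succ n ih =>
    exact hA.measurable_combine.comp ((measurable_fst.prodMk
      (hA.measurable_head.comp measurable_snd)).prodMk (ih.comp hA.measurable_next))

theorem measurable_count (hA : A.Lawful μ κ) (n : ℕ) :
    Measurable fun p : S × α => A.count n p.1 p.2 := by
  induction n with
  | zero => exact measurable_const
  | succ n ih =>
    refine (ih.comp hA.measurable_next).add (Measurable.ite ?_ measurable_const measurable_const)
    exact (measurable_fst.prodMk (hA.measurable_head.comp measurable_snd)) hA.measurableSet_pend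

theorem measurable_orbit (hA : A.Lawful μ κ) (n : ℕ) : Measurable (A.orbit n) := by
  induction n with
  | zero => exact measurable_id
  | succ n ih => exact ih.comp hA.measurable_next

theorem measurableSet_productive (hA : A.Lawful μ κ) :
    MeasurableSet {p : S × α | A.Productive p.1 p.2} := by
  have : {p : S × α | A.Productive p.1 p.2} = ⋂ m, ⋃ n, {p | m < A.count n p.1 p.2} := by
    ext p; simp [Productive]
  rw [this]
  exact MeasurableSet.iInter fun m => MeasurableSet.iUnion fun n =>
    measurableSet_lt measurable_const (hA.measurable_count n)

theorem measurable_stepsUntil (hA : A.Lawful μ κ) (m : ℕ) :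
    Measurable fun p : S × α => A.stepsUntil m p.1 p.2 := by
  classical
  refine measurable_to_countable' fun n => ?_
  have h : ∀ n, MeasurableSet {p : S × α | m < A.count n p.1 p.2} := fun n =>
    measurableSet_lt measurable_const (hA.measurable_count n)
  have : (fun p : S × α => A.stepsUntil m p.1 p.2) ⁻¹' {n} =
      ({p | m < A.count n p.1 p.2} ∩ ⋂ k, {p | k < n → ¬ m < A.count k p.1 p.2}) ∪
      {p | n = 0 ∧ ∀ k, ¬ m < A.count k p.1 p.2} := by
    ext p
    simp only [Set.mem_preimage, Set.mem_singleton_iff, stepsUntil, Set.mem_union, Set.mem_inter_iff,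
      Set.mem_iInter, Set.mem_ofPred_eq]
    by_cases hex : ∃ n, m < A.count n p.1 p.2
    · rw [dif_pos hex, Nat.find_eq_iff]
      refine ⟨Or.inl, fun hh => hh.resolve_right fun h => ?_⟩
      obtain ⟨k, hk⟩ := hex
      exact h.2 k hk
    · rw [dif_neg hex]
      push Not at hex
      refine ⟨fun h0 => Or.inr ⟨h0.symm, fun k => not_lt.2 (hex k)⟩, fun h => ?_⟩
      rcases h with h | h
      · exact absurd h.1 (not_lt.2 (hex n))
      · exact h.1.symm
  rw [this]
  refine ((h n).inter (MeasurableSet.iInter fun k => ?_)).union ?_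
  · by_cases hk : k < n
    · have : {p : S × α | k < n → ¬ m < A.count k p.1 p.2} =
          {p : S × α | m < A.count k p.1 p.2}ᶜ := by ext p; simp [hk]
      rw [this]
      exact (h k).compl
    · simp [hk]
  · by_cases hn : n = 0
    · have : {p : S × α | n = 0 ∧ ∀ k, ¬ m < A.count k p.1 p.2} =
        ⋂ k, {p : S × α | m < A.count k p.1 p.2}ᶜ := by ext p; simp [hn]
      rw [this]
      exact MeasurableSet.iInter fun k => (h k).compl
    · simp [hn]

theorem measurable_output (hA : A.Lawful μ κ) :
    Measurable fun p : S × α => A.output p.1 p.2 := by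
  refine measurable_pi_lambda _ fun m => ?_
  have h : Measurable fun q : ℕ × (S × α) => A.approx q.1 q.2.1 q.2.2 m :=
    measurable_from_prod_countable_right fun n =>
      (measurable_pi_apply m).comp (hA.measurable_approx n)
  exact h.comp ((hA.measurable_stepsUntil m).prodMk measurable_id)

end Lawful

/-- Given the sample read, `v 0` and the tail of `v` are independent. The first output entry thus
comes from a single merging step, which preserves `κ`, and what follows is an independent i.i.d.
sequence. -/
theorem Lawful.map_combine [IsProbabilityMeasure κ] (hA : A.Lawful μ κ) (s : S) :
    (κ.prod (Measure.infinitePi fun _ : ℕ => κ)).map (fun p => A.combine s p.1 p.2) =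
      Measure.infinitePi fun _ : ℕ => κ := by
  classical
  set κ' := Measure.infinitePi fun _ : ℕ => κ
  have hm : Measurable fun p : K × (ℕ → K) => A.combine s p.1 p.2 :=
    hA.measurable_combine.comp ((measurable_const.prodMk measurable_fst).prodMk measurable_snd)
  have hmc : Measurable fun p : K × (ℕ → K) => consSeq p.1 p.2 :=
    measurable_fst.consSeq measurable_snd
  ext C hC
  have hcons : ∀ b : K, Measurable fun u : ℕ → K => consSeq b u := fun b =>
    measurable_const.consSeq measurable_id
  set h : K → ENNReal := fun b => κ' {u | consSeq b u ∈ C}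
  have hh : Measurable h := measurable_measure_prodMk_left (hmc hC)
  have hpend : MeasurableSet {w | A.pend s w} := measurable_prodMk_left hA.measurableSet_pend
  have hjoin : Measurable fun p : K × K => A.join s p.1 p.2 :=
    hA.measurable_join.comp ((measurable_const.prodMk measurable_fst).prodMk measurable_snd)
  have hout : Measurable fun w : K => A.out s w :=
    hA.measurable_out.comp (measurable_const.prodMk measurable_id)
  have hs : Measurable fun p : K × K => if A.pend s p.1 then A.join s p.1 p.2 else A.out s p.1 :=
    Measurable.ite (measurable_fst hpend) hjoin (hout.comp measurable_fst)
  -- Both cases are written as an average over one further sample `a`; it plays the role of `v 0`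
  -- when a join is pending and is a dummy otherwise, in which case all of `v` remains as the tail.
  have hw : ∀ w, κ' {v | A.combine s w v ∈ C} =
      ∫⁻ a, h (if A.pend s w then A.join s w a else A.out s w) ∂κ := by
    intro w
    by_cases hp : A.pend s w
    · simp only [combine, if_pos hp]
      have e : {v : ℕ → K | consSeq (A.join s w (v 0)) (tailSeq v) ∈ C} =
        (fun v : ℕ → K => (v 0, tailSeq v)) ⁻¹' {p | consSeq (A.join s w p.1) p.2 ∈ C} := rfl
      have hj : Measurable fun a : K => A.join s w a :=
        hjoin.comp (measurable_const.prodMk measurable_id)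
      have hmeas : MeasurableSet {p : K × (ℕ → K) | consSeq (A.join s w p.1) p.2 ∈ C} :=
        ((hj.comp measurable_fst).consSeq measurable_snd) hC
      rw [e, ← Measure.map_apply (by fun_prop) hmeas, map_head_tailSeq, Measure.prod_apply hmeas]
      rfl
    · simp only [combine, if_neg hp, lintegral_const, measure_univ, mul_one]
      rfl
  rw [Measure.map_apply hm hC, Measure.prod_apply (hm hC)]
  calc ∫⁻ w, κ' {v | A.combine s w v ∈ C} ∂κ
      = ∫⁻ w, ∫⁻ a, h (if A.pend s w then A.join s w a else A.out s w) ∂κ ∂κ := by simp_rw [hw]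
    _ = ∫⁻ p, h (if A.pend s p.1 then A.join s p.1 p.2 else A.out s p.1) ∂(κ.prod κ) :=
      (lintegral_prod _ (hh.comp hs).aemeasurable).symm
    _ = ∫⁻ b, h b ∂κ := by rw [← lintegral_map hh hs, hA.map_single s]
    _ = κ' C := by
      have e : κ' C = ((κ.prod κ').map fun p => consSeq p.1 p.2) C := by rw [map_consSeq]
      rw [e, Measure.map_apply hmc hC, Measure.prod_apply (hmc hC)]
      rfl

theorem Lawful.map_next (hA : A.Lawful μ κ) {γ : Type*} [MeasurableSpace γ] {F : K × α → γ}
    (hF : Measurable F) (s : S) :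
    μ.map (fun x => F (A.head x, A.rest s x)) = (κ.prod μ).map F := by
  rw [← hA.map_rest s, Measure.map_map hF]
  · rfl
  · exact hA.measurable_head.prodMk (hA.measurable_rest.comp (measurable_const.prodMk measurable_id))

/-- The sample read is independent of the remaining source. Once it is fixed, the next state is
deterministic, so the induction hypothesis applies to the rest and a single `combine` finishes. -/
theorem Lawful.map_approx [IsProbabilityMeasure μ] [IsProbabilityMeasure κ]
    (hA : A.Lawful μ κ) (n : ℕ) (s : S) :
    μ.map (A.approx n s) = Measure.infinitePi fun _ : ℕ => κ := by
  induction n generalizing s with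
  | zero => exact hA.map_base
  | succ n ih =>
    have hG : Measurable fun p : K × α => A.approx n (A.step s p.1) p.2 :=
      (hA.measurable_approx n).comp ((hA.measurable_step.comp
        (measurable_const.prodMk measurable_fst)).prodMk measurable_snd)
    have hc : Measurable fun p : K × (ℕ → K) => A.combine s p.1 p.2 :=
      hA.measurable_combine.comp ((measurable_const.prodMk measurable_fst).prodMk measurable_snd)
    have h1 := hA.map_next (F := fun p => A.combine s p.1 (A.approx n (A.step s p.1) p.2))
      (hc.comp (measurable_fst.prodMk hG)) s
    have h2 : MeasurePreserving (fun p : K × α => (p.1, A.approx n (A.step s p.1) p.2))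
        (κ.prod μ) (κ.prod (Measure.infinitePi fun _ : ℕ => κ)) :=
      (MeasurePreserving.id κ).skew_product (g := fun w x => A.approx n (A.step s w) x) hG
        (ae_of_all _ fun w => ih _)
    have h3 : (κ.prod μ).map (fun p => A.combine s p.1 (A.approx n (A.step s p.1) p.2)) =
        ((κ.prod μ).map fun p : K × α => (p.1, A.approx n (A.step s p.1) p.2)).map
          fun p : K × (ℕ → K) => A.combine s p.1 p.2 := by
      rw [Measure.map_map hc h2.measurable]; rfl
    rw [h2.map_eq, hA.map_combine] at h3
    exact h1.trans h3

/-- The next state depends only on the sample read, which is independent of the remaining source; a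
property that is almost sure for each fixed state is therefore almost sure at this random state. -/
theorem Lawful.ae_next [IsProbabilityMeasure μ] (hA : A.Lawful μ κ) {Q : S × α → Prop} (hQ : MeasurableSet {p | Q p})
    (h : ∀ s, ∀ᵐ x ∂μ, Q (s, x)) (s : S) : ∀ᵐ x ∂μ, Q (A.step s (A.head x), A.rest s x) := by
  have hm : Measurable fun p : K × α => (A.step s p.1, p.2) :=
    (hA.measurable_step.comp (measurable_const.prodMk measurable_fst)).prodMk measurable_snd
  have h1 : ∀ᵐ p ∂(κ.prod μ), Q (A.step s p.1, p.2) :=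
    (Measure.ae_prod_iff_ae_ae (hm hQ)).2 (ae_of_all _ fun w => h (A.step s w))
  rw [← hA.map_rest s] at h1
  refine ae_of_ae_map (f := fun x => (A.head x, A.rest s x))
    (p := fun p => Q (A.step s p.1, p.2)) ?_ h1
  exact (hA.measurable_head.prodMk
    (hA.measurable_rest.comp (measurable_const.prodMk measurable_id))).aemeasurable

theorem Lawful.ae_orbit [IsProbabilityMeasure μ] [IsProbabilityMeasure κ]
    (hA : A.Lawful μ κ) {Q : S × α → Prop} (hQ : MeasurableSet {p | Q p})
    (h : ∀ s, ∀ᵐ x ∂μ, Q (s, x)) (n : ℕ) (s : S) : ∀ᵐ x ∂μ, Q (A.orbit n (s, x)) := by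
  induction n generalizing s with
  | zero => exact h s
  | succ n ih => exact hA.ae_next (Q := fun p => Q (A.orbit n p)) (hA.measurable_orbit n hQ) ih s

/-- Every approximation has exactly the i.i.d. law, and on a productive source its first `n` entries
eventually agree with the output; probabilities of cylinders pass to the limit. -/
theorem Lawful.map_output [IsProbabilityMeasure μ] [IsProbabilityMeasure κ]
    (hA : A.Lawful μ κ) {s : S} (hs : ∀ᵐ x ∂μ, A.Productive s x) :
    μ.map (A.output s) = Measure.infinitePi fun _ : ℕ => κ := by
  have hm : Measurable (A.output s) :=
    hA.measurable_output.comp (measurable_const.prodMk measurable_id)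
  have hma : ∀ n, Measurable (A.approx n s) := fun n =>
    (hA.measurable_approx n).comp (measurable_const.prodMk measurable_id)
  refine eq_infinitePi_of_range κ fun n t ht => ?_
  have hC : MeasurableSet {v : ℕ → K | ∀ i < n, v i ∈ t i} := by measurability
  rw [Measure.map_apply hm hC]
  have hlim := tendsto_measure_of_ae_tendsto_indicator_of_isFiniteMeasure Filter.atTop (μ := μ)
    (As := fun k => A.approx k s ⁻¹' {v | ∀ i < n, v i ∈ t i}) (hm hC) (fun k => hma k hC) ?_
  · refine tendsto_nhds_unique hlim (tendsto_const_nhds.congr fun k => ?_)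
    rw [← Measure.map_apply (hma k) hC, hA.map_approx, infinitePi_range κ n t ht]
  · filter_upwards [hs] with x hx
    obtain ⟨N, hN⟩ := hx n
    filter_upwards [Filter.eventually_ge_atTop N] with k hk
    have : ∀ i < n, A.approx k s x i = A.output s x i := fun i hi => by
      rw [A.output_eq_approx (show i < A.count N s x by omega),
        A.approx_eq_of_lt_count (show i < A.count N s x by omega) hk]
    simp only [Set.mem_preimage, Set.mem_ofPred_eq]
    exact forall₂_congr fun i hi => by rw [this i hi]

theorem Lawful.ae_productive_of_exists [IsProbabilityMeasure μ] [IsProbabilityMeasure κ]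
    (hA : A.Lawful μ κ)
    (h : ∀ s, ∀ᵐ x ∂μ, ∃ n, 0 < A.count n s x) (s : S) : ∀ᵐ x ∂μ, A.Productive s x := by
  have hQ : MeasurableSet {p : S × α | ∃ n, 0 < A.count n p.1 p.2} := by
    rw [show {p : S × α | ∃ n, 0 < A.count n p.1 p.2} = ⋃ n, {p | 0 < A.count n p.1 p.2} by
      ext; simp]
    exact MeasurableSet.iUnion fun n => measurableSet_lt measurable_const (hA.measurable_count n)
  filter_upwards [ae_all_iff.2 fun k => hA.ae_orbit hQ h k s] with x hx
  exact A.productive_of_orbit hx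

/-- If the pending steps last for an infinite total time, then all samples are completed. -/
theorem Lawful.ae_productive [IsProbabilityMeasure μ] [IsProbabilityMeasure κ]
    (hA : A.Lawful μ κ) {clock : K → ENNReal} (hc : Measurable clock)
    (hfin : ∀ᵐ w ∂κ, clock w < ⊤) (T : S → K → ENNReal)
    (hT : ∀ s w v, A.pend s w → T s w + clock v ≤ clock (A.join s w v))
    (hsum : ∀ s, ∀ᵐ x ∂μ, (∀ n, A.count n s x = 0) →
      ∑' k, T (A.orbit k (s, x)).1 (A.head (A.orbit k (s, x)).2) = ⊤) (s : S) :
    ∀ᵐ x ∂μ, A.Productive s x := by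
  refine hA.ae_productive_of_exists (fun s => ?_) s
  set D : ℕ → α → ENNReal := fun n x =>
    ∑ k ∈ Finset.range n, T (A.orbit k (s, x)).1 (A.head (A.orbit k (s, x)).2)
  -- If no sample is ever completed, the accumulated waiting time exceeds `R` at some stage `n`, and
  -- so does the clock of the first sample of `approx n`. That sample has law `κ` for every `n`,
  -- which gives a bound independent of the stage.
  have hbound : ∀ R : ℕ, μ {x | ∀ n, A.count n s x = 0} ≤ κ {w | (R : ENNReal) ≤ clock w} := by
    intro R
    have h1 : μ {x | ∀ n, A.count n s x = 0} ≤
        μ (⋃ n, {x | (∀ n, A.count n s x = 0) ∧ (R : ENNReal) ≤ D n x}) := by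
      refine measure_mono_ae ?_
      filter_upwards [hsum s] with x hx
      intro h0
      have h2 := hx h0
      have h3 : (R : ENNReal) < ∑' k, T (A.orbit k (s, x)).1 (A.head (A.orbit k (s, x)).2) := by
        rw [h2]; exact ENNReal.natCast_lt_top R
      rw [ENNReal.tsum_eq_iSup_nat, lt_iSup_iff] at h3
      obtain ⟨n, hn⟩ := h3
      exact Set.mem_iUnion.2 ⟨n, h0, hn.le⟩
    refine h1.trans ?_
    rw [Monotone.measure_iUnion]
    · refine iSup_le fun n => ?_
      have hC : MeasurableSet {w | (R : ENNReal) ≤ clock w} := measurableSet_le measurable_const hc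
      have hm0 : Measurable fun x => A.approx n s x 0 := (measurable_pi_apply 0).comp
        ((hA.measurable_approx n).comp (measurable_const.prodMk measurable_id))
      calc μ {x | (∀ n, A.count n s x = 0) ∧ (R : ENNReal) ≤ D n x}
          ≤ μ ((fun x => A.approx n s x 0) ⁻¹' {w | (R : ENNReal) ≤ clock w}) :=
            measure_mono fun x hx => hx.2.trans (A.sum_le_approx clock T hT n s x (hx.1 n))
        _ = κ {w | (R : ENNReal) ≤ clock w} := by
            rw [← Measure.map_apply hm0 hC]
            congr 1
            have : (fun x => A.approx n s x 0) = (fun v : ℕ → K => v 0) ∘ A.approx n s := rfl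
            have hma : Measurable (A.approx n s) :=
              (hA.measurable_approx n).comp (measurable_const.prodMk measurable_id)
            rw [this, ← Measure.map_map (measurable_pi_apply 0) hma, hA.map_approx,
              Measure.infinitePi_map_eval (fun _ : ℕ => κ)]
    · intro a b hab x hx
      exact ⟨hx.1, hx.2.trans (Finset.sum_le_sum_of_subset (Finset.range_mono hab))⟩
  have hzero : Filter.Tendsto (fun R : ℕ => κ {w | (R : ENNReal) ≤ clock w}) Filter.atTop
      (nhds 0) := by
    have h1 : ⋂ R : ℕ, {w | (R : ENNReal) ≤ clock w} = {w | ¬ clock w < ⊤} := by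
      ext w
      simp only [Set.mem_iInter, Set.mem_ofPred_eq, not_lt, top_le_iff]
      exact ⟨fun h => ENNReal.eq_top_of_forall_nnreal_le fun r => by
        obtain ⟨n, hn⟩ := exists_nat_ge r
        exact le_trans (by exact_mod_cast hn) (h n), fun h R => by rw [h]; exact le_top⟩
    have h2 := tendsto_measure_iInter_atTop (μ := κ) (s := fun R : ℕ => {w | (R : ENNReal) ≤ clock w})
      (fun R => (measurableSet_le measurable_const hc).nullMeasurableSet)
      (fun a b hab w hw =>
        (by exact_mod_cast hab : (a : ENNReal) ≤ (b : ENNReal)).trans hw) ⟨0, measure_ne_top _ _⟩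
    rw [h1, show κ {w | ¬ clock w < ⊤} = 0 from hfin] at h2
    exact h2
  have h0 : μ {x | ∀ n, A.count n s x = 0} = 0 :=
    le_antisymm (ge_of_tendsto' hzero hbound) zero_le
  have : {x | ∀ n, A.count n s x = 0} = {x | ¬ ∃ n, 0 < A.count n s x} := by
    ext x; simp
  rw [this] at h0
  exact h0

end Merger

/-! ### The law of the noise of a single step -/

/-- The clock and the path of one label. -/
abbrev Mark := ℝ≥0 × Path

/-- The noise of one step: the marks of all labels and a displacement. -/
abbrev Step := (ℕ → Mark) × ℝ

/-- The law of an exponential clock. -/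
noncomputable def clockLaw : Measure ℝ≥0 := (expMeasure 1).map Real.toNNReal

/-- The law of the mark of one label. -/
noncomputable def markLaw : Measure Mark := clockLaw.prod wiener

/-- The law of the noise of one step when the displacements have law `J`. -/
noncomputable def stepLaw (J : Measure ℝ) : Measure Step :=
  (Measure.infinitePi fun _ : ℕ => markLaw).prod J

instance : IsProbabilityMeasure (expMeasure 1) := isProbabilityMeasure_expMeasure one_pos

instance : IsProbabilityMeasure clockLaw :=
  Measure.isProbabilityMeasure_map measurable_real_toNNReal.aemeasurable

instance : IsProbabilityMeasure markLaw := by unfold markLaw; infer_instance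

instance (J : Measure ℝ) [IsProbabilityMeasure J] : IsProbabilityMeasure (stepLaw J) := by
  unfold stepLaw; infer_instance

theorem clockLaw_Iic (s : ℝ≥0) :
    clockLaw (Set.Iic s) = ENNReal.ofReal (1 - Real.exp (-s)) := by
  rw [clockLaw, Measure.map_apply measurable_real_toNNReal measurableSet_Iic]
  have : Real.toNNReal ⁻¹' Set.Iic s = Set.Iic (s : ℝ) := by
    ext x; simp [Real.toNNReal_le_iff_le_coe]
  rw [this, ← ofReal_cdf, cdf_expMeasure_eq one_pos]
  simp

theorem clockLaw_Ioi (s : ℝ≥0) : clockLaw (Set.Ioi s) = ENNReal.ofReal (Real.exp (-s)) := by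
  have h : Set.Ioi s = (Set.Iic s)ᶜ := by ext; simp
  rw [h, prob_compl_eq_one_sub measurableSet_Iic, clockLaw_Iic, ← ENNReal.ofReal_one,
    ← ENNReal.ofReal_sub _ (by simp)]
  simp

theorem clockLaw_singleton (s : ℝ≥0) : clockLaw {s} = 0 := by
  by_contra h
  have hle : ∀ r : ℝ≥0, r < s → clockLaw {s} ≤
      ENNReal.ofReal (Real.exp (-r)) - ENNReal.ofReal (Real.exp (-s)) := by
    intro r hr
    have h1 : clockLaw {s} + clockLaw (Set.Ioi s) ≤ clockLaw (Set.Ioi r) := by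
      rw [← measure_union (by simp) measurableSet_Ioi]
      exact measure_mono (by
        rintro x (rfl | hx)
        exacts [hr, hr.trans hx])
    rw [clockLaw_Ioi, clockLaw_Ioi] at h1
    exact ENNReal.le_sub_of_add_le_right ENNReal.ofReal_ne_top h1
  rcases eq_or_ne s 0 with rfl | hs
  · apply h
    have : ({0} : Set ℝ≥0) = Set.Iic 0 := by ext; simp
    rw [this, clockLaw_Iic]
    simp
  · have hlim : Filter.Tendsto (fun r : ℝ≥0 => ENNReal.ofReal (Real.exp (-r)) -
        ENNReal.ofReal (Real.exp (-s))) (nhdsWithin s (Set.Iio s)) (nhds 0) := by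
      have : Filter.Tendsto (fun r : ℝ≥0 => ENNReal.ofReal (Real.exp (-r) - Real.exp (-s)))
          (nhds s) (nhds (ENNReal.ofReal (Real.exp (-s) - Real.exp (-s)))) := by
        refine (ENNReal.continuous_ofReal.comp ?_).continuousAt.tendsto
        fun_prop
      rw [sub_self, ENNReal.ofReal_zero] at this
      refine (this.mono_left nhdsWithin_le_nhds).congr fun r => ?_
      rw [ENNReal.ofReal_sub _ (Real.exp_pos _).le]
    have hne : (nhdsWithin s (Set.Iio s)).NeBot :=
      nhdsLT_neBot_of_exists_lt ⟨0, pos_iff_ne_zero.2 hs⟩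
    exact h (le_antisymm (ge_of_tendsto hlim (eventually_mem_nhdsWithin.mono hle)) zero_le)

/-- Exponential clocks have no memory. -/
theorem map_clockLaw_add (t : ℝ≥0) :
    (clockLaw.prod clockLaw).map (fun p => if t < p.1 then t + p.2 else p.1) = clockLaw := by
  have hm : Measurable fun p : ℝ≥0 × ℝ≥0 => if t < p.1 then t + p.2 else p.1 :=
    Measurable.ite (measurableSet_lt measurable_const measurable_fst)
      (measurable_const.add measurable_snd) measurable_fst
  have : IsProbabilityMeasure ((clockLaw.prod clockLaw).map
    fun p => if t < p.1 then t + p.2 else p.1) := Measure.isProbabilityMeasure_map hm.aemeasurable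
  refine Measure.ext_of_Iic _ _ fun s => ?_
  have h : Set.Iic s = (Set.Ioi s)ᶜ := by ext; simp
  rw [h, prob_compl_eq_one_sub measurableSet_Ioi, prob_compl_eq_one_sub measurableSet_Ioi]
  congr 1
  rw [Measure.map_apply hm measurableSet_Ioi]
  rcases lt_or_ge s t with hst | hst
  · have : (fun p : ℝ≥0 × ℝ≥0 => if t < p.1 then t + p.2 else p.1) ⁻¹' Set.Ioi s =
        Set.Ioi s ×ˢ Set.univ := by
      ext ⟨a, b⟩
      simp only [Set.mem_preimage, Set.mem_Ioi, Set.mem_prod, Set.mem_univ, and_true]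
      split_ifs with ha
      · exact ⟨fun _ => hst.trans ha, fun _ => hst.trans_le le_self_add⟩
      · rfl
    rw [this, Measure.prod_prod, measure_univ, mul_one]
  · have : (fun p : ℝ≥0 × ℝ≥0 => if t < p.1 then t + p.2 else p.1) ⁻¹' Set.Ioi s =
        Set.Ioi t ×ˢ Set.Ioi (s - t) := by
      ext ⟨a, b⟩
      simp only [Set.mem_preimage, Set.mem_Ioi, Set.mem_prod]
      split_ifs with ha
      · simp [ha, tsub_lt_iff_left hst]
      · simp [ha, (not_lt.1 ha).trans hst]
    rw [this, Measure.prod_prod, clockLaw_Ioi, clockLaw_Ioi, clockLaw_Ioi,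
      ← ENNReal.ofReal_mul (Real.exp_pos _).le, ← Real.exp_add, NNReal.coe_sub hst]
    congr 2; ring

theorem measurePreserving_prodProdProdComm {α β γ δ : Type*} [MeasurableSpace α]
    [MeasurableSpace β] [MeasurableSpace γ] [MeasurableSpace δ] (a : Measure α) (b : Measure β)
    (c : Measure γ) (d : Measure δ) [SFinite a] [SFinite b] [SFinite c] [SFinite d] :
    MeasurePreserving (fun p : (α × β) × γ × δ => ((p.1.1, p.2.1), (p.1.2, p.2.2)))
      ((a.prod b).prod (c.prod d)) ((a.prod c).prod (b.prod d)) := by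
  have h1 := measurePreserving_prodAssoc a b (c.prod d)
  have h2 := (measurePreserving_prodAssoc b c d).symm
  have h3 := (Measure.measurePreserving_swap (μ := b) (ν := c)).prod (MeasurePreserving.id d)
  have h4 := measurePreserving_prodAssoc c b d
  have h5 := (measurePreserving_prodAssoc a c (b.prod d)).symm
  exact h5.comp (((MeasurePreserving.id a).prod (h4.comp (h3.comp h2))).comp h1)

/-- The mark which has the clock and the path of `p` until time `t` and continues with `q`. -/
def Mark.join (t : ℝ≥0) (p q : Mark) : Mark := (t + q.1, Path.concat t p.2 q.2)

theorem Mark.measurable_join {α : Type*} [MeasurableSpace α] {t : α → ℝ≥0} {p q : α → Mark}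
    (ht : Measurable t) (hp : Measurable p) (hq : Measurable q) :
    Measurable fun x => Mark.join (t x) (p x) (q x) :=
  (ht.add (measurable_fst.comp hq)).prodMk
    (Path.measurable_concat (measurable_snd.comp hp) (measurable_snd.comp hq) ht)

/-- The clock is preserved by lack of memory. Given the clock, the path is either left alone or
renewed at the fixed time `t`, which is the Markov property. -/
theorem map_join_markLaw (t : ℝ≥0) :
    (markLaw.prod markLaw).map (fun p => if t < p.1.1 then Mark.join t p.1 p.2 else p.1) =
      markLaw := by
  have hlt : MeasurableSet {q : (ℝ≥0 × ℝ≥0) × Path × Path | t < q.1.1} :=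
    measurableSet_lt measurable_const (by fun_prop)
  have h1 := measurePreserving_prodProdProdComm clockLaw wiener clockLaw wiener
  have h2 : MeasurePreserving (fun p : ℝ≥0 × ℝ≥0 => if t < p.1 then t + p.2 else p.1)
      (clockLaw.prod clockLaw) clockLaw :=
    ⟨Measurable.ite (measurableSet_lt measurable_const measurable_fst)
      (measurable_const.add measurable_snd) measurable_fst, map_clockLaw_add t⟩
  have h3 := h2.skew_product (μc := wiener.prod wiener) (μd := wiener)
    (g := fun p q => if t < p.1 then Path.concat t q.1 q.2 else q.1)
    (Measurable.ite hlt (Path.measurable_concat (by fun_prop) (by fun_prop) measurable_const)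
      (by fun_prop))
    (ae_of_all _ fun p => by
      by_cases hp : t < p.1
      · simp only [hp, if_true]; exact map_concat_wiener t
      · simp only [hp, if_false]; exact Measure.map_fst_prod.trans (by simp))
  refine Eq.trans ?_ (h3.comp h1).map_eq
  unfold markLaw
  congr 1
  funext p
  by_cases hp : t < p.1.1 <;> simp [hp, Mark.join]

/-! ### Coordinatewise operations on infinite products -/

section Coordinates

variable {K : Type*} [MeasurableSpace K] (m : Measure K) [IsProbabilityMeasure m]

theorem prod_infinitePi_range (n : ℕ) (D : ℕ → Set (K × K)) (hD : ∀ i, MeasurableSet (D i)) :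
    ((Measure.infinitePi fun _ : ℕ => m).prod (Measure.infinitePi fun _ : ℕ => m))
      {p | ∀ i < n, (p.1 i, p.2 i) ∈ D i} = ∏ i ∈ Finset.range n, (m.prod m) (D i) := by
  set M := Measure.infinitePi fun _ : ℕ => m
  induction n generalizing D with
  | zero => simp
  | succ n ih =>
    have h1 : MeasurePreserving (fun v : ℕ → K => (v 0, tailSeq v)) M (m.prod M) :=
      ⟨by fun_prop, map_head_tailSeq m⟩
    have h2 := (measurePreserving_prodProdProdComm m M m M).comp (h1.prod h1)
    have hS : MeasurableSet {p : (ℕ → K) × (ℕ → K) | ∀ i < n, (p.1 i, p.2 i) ∈ D (i + 1)} := by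
      simp only [Set.ofPred_forall]
      refine MeasurableSet.iInter fun i => MeasurableSet.iInter fun _ => ?_
      have : Measurable fun p : (ℕ → K) × (ℕ → K) => (p.1 i, p.2 i) := by fun_prop
      exact this (hD _)
    have h3 := h2.measure_preimage ((hD 0).prod hS).nullMeasurableSet
    rw [Measure.prod_prod, ih _ fun i => hD _] at h3
    rw [Finset.prod_range_succ', mul_comm, ← h3]
    congr 1
    ext p
    simp only [Set.mem_ofPred_eq, Set.mem_preimage, Set.mem_prod, Function.comp, Prod.map]
    refine ⟨fun h => ⟨h 0 (by omega), fun i hi => h (i + 1) (by omega)⟩, fun h i hi => ?_⟩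
    cases i with
    | zero => exact h.1
    | succ i => exact h.2 i (by omega)

theorem map_coordinatewise {g : ℕ → K × K → K} (hg : ∀ i, Measurable (g i))
    (h : ∀ i, (m.prod m).map (g i) = m) :
    MeasurePreserving (fun (p : (ℕ → K) × (ℕ → K)) i => g i (p.1 i, p.2 i))
      ((Measure.infinitePi fun _ : ℕ => m).prod (Measure.infinitePi fun _ : ℕ => m))
      (Measure.infinitePi fun _ : ℕ => m) := by
  have hm : Measurable fun (p : (ℕ → K) × (ℕ → K)) i => g i (p.1 i, p.2 i) :=
    measurable_pi_lambda _ fun i => (hg i).comp (by fun_prop)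
  refine ⟨hm, eq_infinitePi_of_range m fun n t ht => ?_⟩
  rw [Measure.map_apply hm (by measurability)]
  refine (prod_infinitePi_range m n (fun i => g i ⁻¹' t i) fun i => hg i (ht i)).trans ?_
  exact Finset.prod_congr rfl fun i _ => by rw [← Measure.map_apply (hg i) (ht i), h]

theorem map_comp_perm (σ : Equiv.Perm ℕ) :
    MeasurePreserving (fun (v : ℕ → K) i => v (σ i)) (Measure.infinitePi fun _ : ℕ => m)
      (Measure.infinitePi fun _ : ℕ => m) := by
  have hm : Measurable fun (v : ℕ → K) i => v (σ i) :=
    measurable_pi_lambda _ fun i => measurable_pi_apply _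
  refine ⟨hm, Measure.eq_infinitePi _ fun s t ht => ?_⟩
  classical
  rw [Measure.map_apply hm (.pi s.countable_toSet fun _ _ => ht _)]
  have : (fun (v : ℕ → K) i => v (σ i)) ⁻¹' (s : Set ℕ).pi t =
      ((s.map σ.toEmbedding : Finset ℕ) : Set ℕ).pi fun i => t (σ.symm i) := by
    ext v
    simp only [Set.mem_preimage, Set.mem_pi, Finset.mem_coe, Finset.mem_map_equiv]
    exact ⟨fun h i hi => by simpa using h _ hi, fun h i hi => by simpa using h (σ i) (by simpa)⟩
  rw [this, Measure.infinitePi_pi _ fun i _ => ht _]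
  simp

end Coordinates

/-- The first `a` marks of `x` followed by the remaining marks of `z`. -/
def splice {K : Type*} (a : ℕ) (x z : ℕ → K) : ℕ → K := fun i => if i < a then x i else z i

/-- The labels `< a` continue with the marks of `y` after time `t`. -/
def joinMarks (a : ℕ) (t : ℝ≥0) (x y : ℕ → Mark) : ℕ → Mark :=
  fun i => if i < a then Mark.join t (x i) (y i) else x i

theorem measurable_joinMarks {α : Type*} [MeasurableSpace α] {a : α → ℕ} {t : α → ℝ≥0}
    {x y : α → ℕ → Mark} (ha : Measurable a) (ht : Measurable t) (hx : Measurable x)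
    (hy : Measurable y) : Measurable fun p => joinMarks (a p) (t p) (x p) (y p) := by
  refine measurable_pi_lambda _ fun i => Measurable.ite (measurableSet_lt measurable_const ha) ?_ ?_
  · exact Mark.measurable_join ht ((measurable_pi_apply i).comp hx) ((measurable_pi_apply i).comp hy)
  · exact (measurable_pi_apply i).comp hx

/-- No clock with label `< a` rings until time `t`, and there is such a clock. -/
def NoRing (a : ℕ) (t : ENNReal) (x : ℕ → Mark) : Prop := 0 < a ∧ ∀ i < a, t < (x i).1

theorem measurableSet_noRing {α : Type*} [MeasurableSpace α] {a : α → ℕ} {t : α → ENNReal}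
    {x : α → ℕ → Mark} (ha : Measurable a) (ht : Measurable t) (hx : Measurable x) :
    MeasurableSet {p | NoRing (a p) (t p) (x p)} := by
  refine (measurableSet_lt measurable_const ha).inter ?_
  show MeasurableSet {p | ∀ i < a p, t p < ((x p i).1 : ENNReal)}
  rw [Set.ofPred_forall]
  refine MeasurableSet.iInter fun i => ?_
  have : {p | i < a p → t p < ((x p i).1 : ENNReal)} =
      {p | i < a p}ᶜ ∪ {p | t p < ((x p i).1 : ENNReal)} := by
    ext p; simp [imp_iff_not_or]
  rw [this]
  refine (measurableSet_lt measurable_const ha).compl.union (measurableSet_lt ht ?_)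
  exact measurable_coe_nnreal_ennreal.comp
    (measurable_fst.comp ((measurable_pi_apply i).comp hx))

-- Renewing each label `< a` separately when its own clock exceeds `t` is a coordinatewise map `Φ`,
-- which preserves the law. On `NoRing` it coincides with the joint renewal; outside `NoRing`
-- nothing is changed. Since `Φ` almost surely preserves the event `NoRing`, the law may be compared
-- on the event and on its complement.
open scoped Classical in
theorem map_joinMarks_const (a : ℕ) (t : ENNReal) :
    ((Measure.infinitePi fun _ : ℕ => markLaw).prod (Measure.infinitePi fun _ : ℕ => markLaw)).map
      (fun p => if NoRing a t p.1 then joinMarks a t.toNNReal p.1 p.2 else p.1) =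
      Measure.infinitePi fun _ : ℕ => markLaw := by
  set M := Measure.infinitePi fun _ : ℕ => markLaw
  have hfst : (M.prod M).map Prod.fst = M := by simp
  rcases eq_or_ne t ⊤ with rfl | ht
  · have : ∀ x, ¬ NoRing a ⊤ x := fun x h => absurd (h.2 0 h.1) (by simp)
    simp [this]
  lift t to ℝ≥0 using ht
  simp only [ENNReal.toNNReal_coe]
  let g : ℕ → Mark × Mark → Mark := fun i p =>
    if i < a then (if t < p.1.1 then Mark.join t p.1 p.2 else p.1) else p.1
  have hj : Measurable fun p : Mark × Mark => if t < p.1.1 then Mark.join t p.1 p.2 else p.1 :=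
    Measurable.ite (measurableSet_lt measurable_const (by fun_prop))
      (Mark.measurable_join measurable_const measurable_fst measurable_snd) measurable_fst
  have hg : ∀ i, Measurable (g i) := fun i => by
    by_cases hi : i < a
    · simpa [g, hi] using hj
    · simpa [g, hi] using measurable_fst
  have hΦ := map_coordinatewise markLaw hg fun i => by
    by_cases hi : i < a
    · simpa [g, hi] using map_join_markLaw t
    · simp [g, hi]
  set Φ := fun (p : (ℕ → Mark) × (ℕ → Mark)) i => g i (p.1 i, p.2 i)
  have hE : MeasurableSet {x : ℕ → Mark | NoRing a t x} :=
    measurableSet_noRing measurable_const measurable_const measurable_id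
  have hm : Measurable fun p : (ℕ → Mark) × (ℕ → Mark) =>
      if NoRing a t p.1 then joinMarks a t p.1 p.2 else p.1 :=
    Measurable.ite (measurable_fst hE)
      (measurable_joinMarks measurable_const measurable_const measurable_fst measurable_snd)
      measurable_fst
  -- A renewed clock is `t` plus a fresh clock; positivity of the latter makes it exceed `t`
  -- strictly, so that `NoRing` can be recognised after the renewal.
  have hpos : ∀ᵐ p ∂(M.prod M), ∀ i, 0 < (p.2 i).1 := by
    rw [ae_all_iff]
    intro i
    have h1 : MeasurePreserving (fun p : (ℕ → Mark) × (ℕ → Mark) => (p.2 i).1) (M.prod M)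
        clockLaw :=
      measurePreserving_fst.comp ((measurePreserving_eval_infinitePi (fun _ : ℕ => markLaw) i).comp
        measurePreserving_snd)
    have h2 : ∀ᵐ s ∂clockLaw, s ∉ ({0} : Set ℝ≥0) := measure_eq_zero_iff_ae_notMem.1
      (clockLaw_singleton 0)
    filter_upwards [h1.quasiMeasurePreserving.ae h2] with p hp
    exact pos_iff_ne_zero.2 hp
  have heq : ∀ p : (ℕ → Mark) × (ℕ → Mark), NoRing a t p.1 → joinMarks a t p.1 p.2 = Φ p := by
    intro p hp
    funext i
    by_cases hi : i < a
    · have : t < (p.1 i).1 := by exact_mod_cast hp.2 i hi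
      simp [joinMarks, Φ, g, hi, this]
    · simp [joinMarks, Φ, g, hi]
  have hiff : ∀ᵐ p ∂(M.prod M), (NoRing a t (Φ p) ↔ NoRing a t p.1) := by
    filter_upwards [hpos] with p hp
    refine and_congr_right fun _ => forall₂_congr fun i hi => ?_
    by_cases h : t < (p.1 i).1
    · have h' : t < (Φ p i).1 := by
        simp only [Φ, g, hi, h, if_true, Mark.join]
        exact lt_add_of_pos_right _ (hp i)
      exact iff_of_true (by exact_mod_cast h') (by exact_mod_cast h)
    · simp [Φ, g, hi, h]
  ext B hB
  rw [Measure.map_apply hm hB]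
  set E := {x : ℕ → Mark | NoRing a t x}
  have hfE : MeasurableSet (Prod.fst ⁻¹' E : Set ((ℕ → Mark) × (ℕ → Mark))) := measurable_fst hE
  rw [← measure_inter_add_sdiff _ hfE, ← measure_inter_add_sdiff B hE]
  congr 1
  · rw [← hΦ.measure_preimage (hB.inter hE).nullMeasurableSet]
    refine measure_congr ?_
    filter_upwards [hiff] with p hp
    refine propext ?_
    show _ ∧ NoRing a t p.1 ↔ _ ∧ NoRing a t (Φ p)
    rw [hp]
    refine and_congr_left fun h => ?_
    show (if NoRing a t p.1 then joinMarks a t p.1 p.2 else p.1) ∈ B ↔ Φ p ∈ B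
    rw [if_pos h, heq p h]
  · rw [← (measurePreserving_fst (μ := M) (ν := M)).measure_preimage (hB.diff hE).nullMeasurableSet]
    congr 1
    ext p
    show _ ∧ ¬ NoRing a t p.1 ↔ _ ∧ ¬ NoRing a t p.1
    refine and_congr_left fun h => ?_
    show (if NoRing a t p.1 then joinMarks a t p.1 p.2 else p.1) ∈ B ↔ p.1 ∈ B
    rw [if_neg h]

open scoped Classical in
/-- If `T` is determined by the labels `≥ a`, then the noise does not change its law when the
labels `< a` are renewed at time `T`, provided that none of their clocks rings before. -/
theorem map_joinMarks (a : ℕ) {T : (ℕ → Mark) → ENNReal} (hT : Measurable T)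
    (hTa : ∀ x z, T (splice a x z) = T z) :
    ((Measure.infinitePi fun _ : ℕ => markLaw).prod (Measure.infinitePi fun _ : ℕ => markLaw)).map
      (fun p => if NoRing a (T p.1) p.1 then joinMarks a (T p.1).toNNReal p.1 p.2 else p.1) =
      Measure.infinitePi fun _ : ℕ => markLaw := by
  set M := Measure.infinitePi fun _ : ℕ => markLaw
  let g : ℕ → Mark × Mark → Mark := fun i p => if i < a then p.2 else p.1
  have hg : ∀ i, Measurable (g i) := fun i => by
    by_cases hi : i < a
    · simpa [g, hi] using measurable_snd
    · simpa [g, hi] using measurable_fst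
  -- The labels `< a` and `≥ a` are taken from independent copies. Given the second copy, `T` is
  -- constant, and the case of a deterministic time applies to the first.
  have hsp : MeasurePreserving (fun p : (ℕ → Mark) × (ℕ → Mark) => splice a p.2 p.1)
      (M.prod M) M := map_coordinatewise markLaw hg fun i => by
    by_cases hi : i < a <;> simp [g, hi]
  have hin : MeasurePreserving (fun q : (ℕ → Mark) × ((ℕ → Mark) × (ℕ → Mark)) =>
      (splice a q.2.1 q.1, q.2.2)) (M.prod (M.prod M)) (M.prod M) :=
    (hsp.prod (MeasurePreserving.id M)).comp (measurePreserving_prodAssoc M M M).symm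
  have hmF : ∀ {α : Type} [MeasurableSpace α] {t : α → ENNReal} {x y : α → ℕ → Mark},
      Measurable t → Measurable x → Measurable y → Measurable fun q =>
        if NoRing a (t q) (x q) then joinMarks a (t q).toNNReal (x q) (y q) else x q :=
    fun ht hx hy => Measurable.ite (measurableSet_noRing measurable_const ht hx)
      (measurable_joinMarks measurable_const ht.ennreal_toNNReal hx hy) hx
  have hsk : MeasurePreserving (fun q : (ℕ → Mark) × ((ℕ → Mark) × (ℕ → Mark)) =>
      (q.1, if NoRing a (T q.1) q.2.1 then joinMarks a (T q.1).toNNReal q.2.1 q.2.2 else q.2.1))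
      (M.prod (M.prod M)) (M.prod M) :=
    (MeasurePreserving.id M).skew_product
      (g := fun z (p : (ℕ → Mark) × (ℕ → Mark)) => if NoRing a (T z) p.1 then joinMarks a (T z).toNNReal p.1 p.2 else p.1)
      (hmF (hT.comp measurable_fst) (by fun_prop) (by fun_prop))
      (ae_of_all _ fun z => map_joinMarks_const a (T z))
  have hout := hmF (α := (ℕ → Mark) × (ℕ → Mark)) (hT.comp measurable_fst) measurable_fst
    measurable_snd
  rw [← hin.map_eq, Measure.map_map (by exact hout) hin.measurable]
  refine Eq.trans ?_ (hsp.comp hsk).map_eq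
  congr 1
  funext q
  have h1 : ∀ i < a, splice a q.2.1 q.1 i = q.2.1 i := fun i hi => by simp [splice, hi]
  have h2 : NoRing a (T q.1) (splice a q.2.1 q.1) ↔ NoRing a (T q.1) q.2.1 :=
    and_congr_right fun _ => forall₂_congr fun i hi => by rw [h1 i hi]
  simp only [Function.comp, hTa]
  by_cases hp : NoRing a (T q.1) q.2.1
  · rw [if_pos (h2.2 hp), if_pos hp]
    funext i
    by_cases hi : i < a <;> simp [joinMarks, splice, hi]
  · rw [if_neg fun h => hp (h2.1 h), if_neg hp]

/-- The labels `< a` of `u` continue with the marks of `v` after time `t`, and the displacement is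
the one of `v`. -/
def joinStep (a : ℕ) (t : ℝ≥0) (u v : Step) : Step := (joinMarks a t u.1 v.1, v.2)

/-- Relabel the marks. -/
def relabel (σ : Equiv.Perm ℕ) (w : Step) : Step := (fun i => w.1 (σ i), w.2)

theorem measurePreserving_relabel (J : Measure ℝ) [IsProbabilityMeasure J] (σ : Equiv.Perm ℕ) :
    MeasurePreserving (relabel σ) (stepLaw J) (stepLaw J) :=
  (map_comp_perm markLaw σ).prod (MeasurePreserving.id J)

-- No birth takes place while a sample is pending, so its displacement is replaced by that of the
-- continuation. Which of the two displacements is kept depends only on the marks, which are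
-- independent of both.
open scoped Classical in
theorem map_joinStep (J : Measure ℝ) [IsProbabilityMeasure J] (a : ℕ) (σ : Equiv.Perm ℕ)
    {T : (ℕ → Mark) → ENNReal} (hT : Measurable T) (hTa : ∀ x z, T (splice a x z) = T z) :
    ((stepLaw J).prod (stepLaw J)).map (fun p =>
      if NoRing a (T (relabel σ p.1).1) (relabel σ p.1).1
      then joinStep a (T (relabel σ p.1).1).toNNReal (relabel σ p.1) p.2
      else relabel σ p.1) = stepLaw J := by
  set M := Measure.infinitePi fun _ : ℕ => markLaw
  have hpend : MeasurableSet {p : (ℕ → Mark) × (ℕ → Mark) | NoRing a (T p.1) p.1} :=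
    measurableSet_noRing measurable_const (hT.comp measurable_fst) measurable_fst
  have h0 := (measurePreserving_relabel J σ).prod (MeasurePreserving.id (stepLaw J))
  have h1 := (measurePreserving_prodProdProdComm M J M J).comp h0
  have h2 : MeasurePreserving (fun p : (ℕ → Mark) × (ℕ → Mark) =>
      if NoRing a (T p.1) p.1 then joinMarks a (T p.1).toNNReal p.1 p.2 else p.1) (M.prod M) M :=
    ⟨Measurable.ite hpend (measurable_joinMarks measurable_const
      (hT.comp measurable_fst).ennreal_toNNReal measurable_fst measurable_snd) measurable_fst,
      map_joinMarks a hT hTa⟩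
  have h3 := h2.skew_product (μc := J.prod J) (μd := J)
    (g := fun p q => if NoRing a (T p.1) p.1 then q.2 else q.1)
    (Measurable.ite (measurable_fst hpend) (by fun_prop) (by fun_prop))
    (ae_of_all _ fun p => by
      by_cases hp : NoRing a (T p.1) p.1
      · simp only [hp, if_true]; exact Measure.map_snd_prod.trans (by simp)
      · simp only [hp, if_false]; exact Measure.map_fst_prod.trans (by simp))
  refine Eq.trans ?_ (h3.comp h1).map_eq
  congr 1
  funext p
  by_cases hp : NoRing a (T (relabel σ p.1).1) (relabel σ p.1).1 <;>
    simp [hp, joinStep]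

/-! ### Measurability of the evolution -/

/-- The noise of a step in the form which is used by the evolution. -/
def Step.noise (w : Step) : StepNoise where
  clock i := (w.1 i).1
  path i t := (w.1 i).2 t
  jump := w.2

/-- The noise of a sequence of steps. -/
def seqNoise (v : ℕ → Step) : ℕ → StepNoise := fun n => (v n).noise

/-- Configurations are determined by the number of particles and their positions. -/
instance : MeasurableSpace (List ℝ) :=
  MeasurableSpace.comap (fun l => (l.length, fun i => l.getD i 0)) inferInstance

section

variable {α : Type*} [MeasurableSpace α]

theorem measurable_list_iff {f : α → List ℝ} : Measurable f ↔
    (Measurable fun x => (f x).length) ∧ ∀ i, Measurable fun x => (f x).getD i 0 := by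
  constructor
  · intro hf
    have h : Measurable fun x => ((f x).length, fun i => (f x).getD i 0) :=
      (comap_measurable (fun l : List ℝ => (l.length, fun i => l.getD i 0))).comp hf
    exact ⟨measurable_fst.comp h, fun i => (measurable_pi_apply i).comp (measurable_snd.comp h)⟩
  · rintro ⟨h1, h2⟩
    exact measurable_comap_iff.2 (h1.prodMk (measurable_pi_lambda _ h2))

theorem measurable_length {f : α → List ℝ} (hf : Measurable f) : Measurable fun x => (f x).length :=
  (measurable_list_iff.1 hf).1

/-- Evaluation of a countable family of measurable functions at a measurable index. -/
theorem measurable_eval_nat {β : Type*} [MeasurableSpace β] {g : ℕ → α → β} {n : α → ℕ}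
    (hg : ∀ k, Measurable (g k)) (hn : Measurable n) : Measurable fun x => g (n x) x := by
  have h : Measurable fun q : ℕ × α => g q.1 q.2 := measurable_from_prod_countable_right hg
  exact h.comp (hn.prodMk measurable_id)

theorem measurable_getD {f : α → List ℝ} {i : α → ℕ} (hf : Measurable f) (hi : Measurable i) :
    Measurable fun x => (f x).getD (i x) 0 :=
  measurable_eval_nat (g := fun k x => (f x).getD k 0) (measurable_list_iff.1 hf).2 hi

theorem measurableSet_forall_lt {P : ℕ → α → Prop} {n : α → ℕ} (hn : Measurable n)
    (hP : ∀ i, MeasurableSet {x | P i x}) : MeasurableSet {x | ∀ i < n x, P i x} := by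
  have : {x | ∀ i < n x, P i x} = ⋂ i, ({x | i < n x}ᶜ ∪ {x | P i x}) := by
    ext x; simp [imp_iff_not_or]
  rw [this]
  exact MeasurableSet.iInter fun i => (measurableSet_lt measurable_const hn).compl.union (hP i)

theorem measurable_nat_sInf {P : ℕ → α → Prop} (hP : ∀ n, MeasurableSet {x | P n x}) :
    Measurable fun x => sInf {n | P n x} := by
  classical
  refine measurable_to_countable' fun n => ?_
  have : (fun x => sInf {n | P n x}) ⁻¹' {n} =
      ({x | P n x} ∩ {x | ∀ k < n, ¬ P k x}) ∪ {x | n = 0 ∧ ∀ k, ¬ P k x} := by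
    ext x
    simp only [Set.mem_preimage, Set.mem_singleton_iff, Set.mem_union, Set.mem_inter_iff,
      Set.mem_ofPred_eq]
    by_cases hex : ∃ n, P n x
    · have h0 : ({n | P n x} : Set ℕ).Nonempty := hex
      refine ⟨?_, ?_⟩
      · rintro rfl
        exact Or.inl ⟨Nat.sInf_mem h0, fun k hk hPk => Nat.notMem_of_lt_sInf hk hPk⟩
      · rintro (h | h)
        · exact le_antisymm (Nat.sInf_le h.1)
            (not_lt.1 fun hlt => h.2 _ hlt (Nat.sInf_mem h0))
        · obtain ⟨k, hk⟩ := hex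
          exact absurd hk (h.2 k)
    · have h0 : {n | P n x} = ∅ := Set.eq_empty_iff_forall_notMem.2 fun n hn => hex ⟨n, hn⟩
      push Not at hex
      rw [h0, Nat.sInf_empty]
      refine ⟨fun h => Or.inr ⟨h.symm, hex⟩, fun h => ?_⟩
      rcases h with h | h
      · exact absurd h.1 (hex n)
      · exact h.1.symm
  rw [this]
  refine ((hP n).inter (measurableSet_forall_lt measurable_const fun k => (hP k).compl)).union ?_
  have : {x | n = 0 ∧ ∀ k, ¬ P k x} = {_x | n = 0} ∩ ⋂ k, {x | P k x}ᶜ := by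
    ext x; simp
  rw [this]
  exact (MeasurableSet.const _).inter (MeasurableSet.iInter fun k => (hP k).compl)

theorem measurable_nat_sSup {P : ℕ → α → Prop} (hP : ∀ n, MeasurableSet {x | P n x}) :
    Measurable fun x => sSup {n | P n x} := by
  -- The supremum in `ℕ` is the least upper bound; for an unbounded set it is `0` by convention, as
  -- is the infimum of the empty set of upper bounds.
  have : (fun x => sSup {n | P n x}) = fun x => sInf {b | ∀ n, P n x → n ≤ b} := by
    funext x
    by_cases h : ∃ b, ∀ n ∈ {n | P n x}, n ≤ b
    · classical
      rw [Nat.sSup_def h, Nat.sInf_def (s := {b | ∀ n, P n x → n ≤ b}) h]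
    · have h0 : {b | ∀ n, P n x → n ≤ b} = ∅ :=
        Set.eq_empty_iff_forall_notMem.2 fun n hn => h ⟨n, hn⟩
      rw [h0, Nat.sInf_empty, csSup_of_not_bddAbove h]
      simp
  rw [this]
  refine measurable_nat_sInf fun b => ?_
  have : {x | ∀ n, P n x → n ≤ b} = ⋂ n, ({x | P n x}ᶜ ∪ {_x | n ≤ b}) := by
    ext x; simp [imp_iff_not_or]
  rw [this]
  exact MeasurableSet.iInter fun n => (hP n).compl.union (MeasurableSet.const _)

theorem length_move (y : List ℝ) (w : StepNoise) (s : ℝ≥0) : (move y w s).length = y.length := by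
  simp [move]

theorem getD_move (y : List ℝ) (w : StepNoise) (s : ℝ≥0) (i : ℕ) :
    (move y w s).getD i 0 = if i < y.length then y.getD i 0 + w.path i s else 0 := by
  split_ifs with h
  · simp [move, h]
  · simp [move, not_lt.1 h]

theorem list_ext_getD {l l' : List ℝ} (h : l.length = l'.length)
    (h' : ∀ i < l.length, l.getD i 0 = l'.getD i 0) : l = l' := by
  refine List.ext_getElem h fun i h1 h2 => ?_
  simpa [List.getD_eq_getElem, h1, h2] using h' i h1

theorem measurable_move {y : α → List ℝ} {w : α → Step} {s : α → ℝ≥0} (hy : Measurable y)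
    (hw : Measurable w) (hs : Measurable s) :
    Measurable fun x => move (y x) (w x).noise (s x) := by
  refine measurable_list_iff.2 ⟨by simpa only [length_move] using measurable_length hy, fun i => ?_⟩
  simp only [getD_move]
  refine Measurable.ite (measurableSet_lt measurable_const (measurable_length hy))
    ((measurable_getD hy measurable_const).add ?_) measurable_const
  exact Path.measurable_apply (measurable_snd.comp ((measurable_pi_apply i).comp
    (measurable_fst.comp hw))) hs

theorem length_addChild (y : List ℝ) (i : ℕ) (z : ℝ) :
    (addChild y i z).length = y.length + 1 := by simp [addChild]

theorem measurable_addChild {y : α → List ℝ} {i : α → ℕ} {z : α → ℝ} (hy : Measurable y)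
    (hi : Measurable i) (hz : Measurable z) : Measurable fun x => addChild (y x) (i x) (z x) := by
  refine measurable_list_iff.2
    ⟨by simpa only [length_addChild] using (measurable_length hy).add_const 1, fun k => ?_⟩
  have : (fun x => (addChild (y x) (i x) (z x)).getD k 0) = fun x => if k < (y x).length
      then (y x).getD k 0 else if k = (y x).length then (y x).getD (i x) 0 + z x else 0 := by
    funext x
    unfold addChild
    split_ifs with h1 h2
    · exact List.getD_append _ _ _ _ h1
    · subst h2; simp
    · exact List.getD_eq_default _ _ (by simp; omega)
  rw [this]
  exact Measurable.ite (measurableSet_lt measurable_const (measurable_length hy))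
    (measurable_getD hy measurable_const) (Measurable.ite
      (measurableSet_eq_fun measurable_const (measurable_length hy))
      ((measurable_getD hy hi).add hz) measurable_const)

theorem countP_eq_sum (p : ℝ → Prop) [DecidablePred p] (l : List ℝ) :
    l.countP (fun a => p a) = ∑ i ∈ Finset.range l.length, if p (l.getD i 0) then 1 else 0 := by
  induction l with
  | nil => simp
  | cons a l ih =>
    rw [List.length_cons, Finset.sum_range_succ', List.countP_cons, ih]
    simp

theorem measurable_countP {p : ℝ → Prop} [DecidablePred p] (hp : MeasurableSet {a | p a})
    {y : α → List ℝ} (hy : Measurable y) : Measurable fun x => (y x).countP fun a => p a := by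
  simp only [countP_eq_sum]
  refine measurable_eval_nat (g := fun n x => ∑ i ∈ Finset.range n,
    if p ((y x).getD i 0) then 1 else 0) (fun n => ?_) (measurable_length hy)
  refine Finset.measurable_sum _ fun i _ => Measurable.ite ?_ measurable_const measurable_const
  exact measurable_getD hy measurable_const hp

/-- Order statistics are expressed through counts, which do not change under sorting; this is what
makes sorting measurable. -/
theorem getD_le_iff_of_sorted {l : List ℝ} (hl : l.Pairwise (· ≤ ·)) {k : ℕ} (hk : k < l.length)
    (r : ℝ) : l.getD k 0 ≤ r ↔ k < l.countP fun a => a ≤ r := by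
  induction l generalizing k with
  | nil => simp at hk
  | cons a l ih =>
    rw [List.pairwise_cons] at hl
    rw [List.countP_cons]
    cases k with
    | zero =>
      simp only [List.getD_cons_zero]
      by_cases har : a ≤ r
      · simp [har]
      · have : l.countP (fun a => a ≤ r) = 0 := List.countP_eq_zero.2 fun b hb => by
          simpa using lt_of_lt_of_le (not_le.1 har) (hl.1 b hb)
        simp [har, this]
    | succ k =>
      have hk' : k < l.length := by simpa using hk
      rw [List.getD_cons_succ, ih hl.2 hk']
      by_cases har : a ≤ r
      · simp [har]
      · have : l.countP (fun a => a ≤ r) = 0 := List.countP_eq_zero.2 fun b hb => by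
          simpa using lt_of_lt_of_le (not_le.1 har) (hl.1 b hb)
        simp [har, this]

theorem measurable_insertionSort {y : α → List ℝ} (hy : Measurable y) :
    Measurable fun x => (y x).insertionSort (· ≤ ·) := by
  refine measurable_list_iff.2
    ⟨by simpa only [List.length_insertionSort] using measurable_length hy, fun k => ?_⟩
  refine measurable_of_Iic fun r => ?_
  have : (fun x => ((y x).insertionSort (· ≤ ·)).getD k 0) ⁻¹' Set.Iic r =
      ({x | k < (y x).length} ∩ {x | k < (y x).countP fun a => a ≤ r}) ∪
      ({x | k < (y x).length}ᶜ ∩ {_x | 0 ≤ r}) := by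
    ext x
    simp only [Set.mem_preimage, Set.mem_Iic, Set.mem_union, Set.mem_inter_iff, Set.mem_ofPred_eq,
      Set.mem_compl_iff]
    by_cases hk : k < (y x).length
    · rw [getD_le_iff_of_sorted (List.pairwise_insertionSort _ _)
        (by rwa [List.length_insertionSort]),
        (List.perm_insertionSort (· ≤ ·) (y x)).countP_eq]
      simp [hk]
    · rw [List.getD_eq_default _ _ (by simpa using hk)]
      simp [hk]
  rw [this]
  have h1 := measurableSet_lt (measurable_const (a := k)) (measurable_length hy)
  exact (h1.inter (measurableSet_lt measurable_const
    (measurable_countP measurableSet_Iic hy))).union (h1.compl.inter (MeasurableSet.const _))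

theorem measurable_deleteLeftmost {y : α → List ℝ} {m : α → ℕ} (hy : Measurable y)
    (hm : Measurable m) : Measurable fun x => deleteLeftmost (m x) (y x) := by
  refine measurable_list_iff.2 ⟨?_, fun k => ?_⟩
  · simp only [deleteLeftmost, List.length_drop, List.length_insertionSort]
    exact (measurable_length hy).sub hm
  · have : ∀ x, (deleteLeftmost (m x) (y x)).getD k 0 =
        ((y x).insertionSort (· ≤ ·)).getD (m x + k) 0 := fun x => by
      simp [deleteLeftmost, List.getD_eq_getElem?_getD]
    simp only [this]
    exact measurable_getD (measurable_insertionSort hy) (hm.add_const k)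

theorem measurable_keepRightmost (m : ℕ) : Measurable (keepRightmost m) :=
  measurable_deleteLeftmost measurable_id ((measurable_length measurable_id).sub_const m)

/-- Rules which are measurable and which add at most one particle. -/
structure IsRule (R : List ℝ → ℕ → ℝ → List ℝ) : Prop where
  measurable : Measurable fun p : List ℝ × ℕ × ℝ => R p.1 p.2.1 p.2.2
  length_le : ∀ y i z, (R y i z).length ≤ y.length + 1

theorem isRule_addChild : IsRule addChild where
  measurable := measurable_addChild (by fun_prop) (by fun_prop) (by fun_prop)
  length_le y i z := (length_addChild y i z).le

theorem length_deleteLeftmost (m : ℕ) (y : List ℝ) :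
    (deleteLeftmost m y).length = y.length - m := by simp [deleteLeftmost]

theorem length_addChildAndSelect (y : List ℝ) (i : ℕ) (z : ℝ) :
    (addChildAndSelect y i z).length = y.length := by
  simp [addChildAndSelect, length_deleteLeftmost, length_addChild]

theorem isRule_addChildAndSelect : IsRule addChildAndSelect where
  measurable := measurable_deleteLeftmost
    (measurable_addChild (by fun_prop) (by fun_prop) (by fun_prop)) measurable_const
  length_le y i z := by rw [length_addChildAndSelect]; omega

theorem isRule_addChildUpTo (N : ℕ) : IsRule (addChildUpTo N) where
  measurable := Measurable.ite
    (measurableSet_lt (measurable_length measurable_fst) measurable_const)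
    (measurable_addChild (by fun_prop) (by fun_prop) (by fun_prop)) (by fun_prop)
  length_le y i z := by
    unfold addChildUpTo
    split_ifs
    · rw [length_addChild]
    · omega

theorem firstRing_eq_iInf (y : List ℝ) (w : Step) :
    firstRing y w.noise = ⨅ i : ℕ, if i < y.length then ((w.1 i).1 : ENNReal) else ⊤ := by
  refine le_antisymm (le_iInf fun i => ?_) (le_iInf fun i => ?_)
  · split_ifs with h
    · exact (iInf_le _ (⟨i, h⟩ : Fin y.length)).trans (by simp [Step.noise])
    · exact le_top
  · exact (iInf_le _ (i : ℕ)).trans (by simp [Step.noise])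

theorem measurable_iInf_clock {p : ℕ → α → Prop} {w : α → Step}
    (hp : ∀ i, MeasurableSet {x | p i x}) [∀ i x, Decidable (p i x)] (hw : Measurable w) :
    Measurable fun x => ⨅ i : ℕ, if p i x then (((w x).1 i).1 : ENNReal) else ⊤ := by
  refine Measurable.iInf fun i => Measurable.ite (hp i) ?_ measurable_const
  exact measurable_coe_nnreal_ennreal.comp
    (measurable_fst.comp ((measurable_pi_apply i).comp (measurable_fst.comp hw)))

theorem measurable_firstRing {y : α → List ℝ} {w : α → Step} (hy : Measurable y)
    (hw : Measurable w) : Measurable fun x => firstRing (y x) (w x).noise := by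
  simp only [firstRing_eq_iInf]
  exact measurable_iInf_clock (p := fun i x => i < (y x).length)
    (fun i => measurableSet_lt measurable_const (measurable_length hy)) hw

theorem measurable_clock {w : α → Step} (hw : Measurable w) (i : ℕ) :
    Measurable fun x => ((w x).1 i).1 :=
  measurable_fst.comp ((measurable_pi_apply i).comp (measurable_fst.comp hw))

theorem measurable_ringingLabel {y : α → List ℝ} {w : α → Step} (hy : Measurable y)
    (hw : Measurable w) : Measurable fun x => ringingLabel (y x) (w x).noise := by
  refine measurable_nat_sInf fun i => ?_
  refine (measurableSet_lt measurable_const (measurable_length hy)).inter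
    (measurableSet_forall_lt (P := fun j x => (w x).noise.clock i ≤ (w x).noise.clock j)
      (measurable_length hy) fun j => ?_)
  exact measurableSet_le (measurable_coe_nnreal_real.comp (measurable_clock hw i))
    (measurable_coe_nnreal_real.comp (measurable_clock hw j))

theorem IsRule.measurable_comp {R : List ℝ → ℕ → ℝ → List ℝ} (hR : IsRule R) {y : α → List ℝ}
    {i : α → ℕ} {z : α → ℝ} (hy : Measurable y) (hi : Measurable i) (hz : Measurable z) :
    Measurable fun x => R (y x) (i x) (z x) := hR.measurable.comp (hy.prodMk (hi.prodMk hz))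

theorem IsRule.measurable_ringState {R : List ℝ → ℕ → ℝ → List ℝ} (hR : IsRule R)
    {y : α → List ℝ} {v : α → ℕ → Step} (hy : Measurable y) (hv : Measurable v) (n : ℕ) :
    Measurable fun x => ringState R (y x) (seqNoise (v x)) n := by
  induction n with
  | zero => exact measurable_const.prodMk hy
  | succ n ih =>
    have hw : Measurable fun x => v x n := (measurable_pi_apply n).comp hv
    have hy' : Measurable fun x => (ringState R (y x) (seqNoise (v x)) n).2 := measurable_snd.comp ih
    have hτ := measurable_firstRing hy' hw
    exact ((measurable_fst.comp ih).add hτ).prodMk (hR.measurable_comp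
      (measurable_move hy' hw hτ.ennreal_toNNReal) (measurable_ringingLabel hy' hw)
      (measurable_snd.comp hw))

theorem IsRule.measurable_evolve {R : List ℝ → ℕ → ℝ → List ℝ} (hR : IsRule R)
    {y : α → List ℝ} {v : α → ℕ → Step} (hy : Measurable y) (hv : Measurable v) (t : ℝ≥0) :
    Measurable fun x => evolve R (y x) (seqNoise (v x)) t := by
  refine measurable_eval_nat (g := fun n x => move (ringState R (y x) (seqNoise (v x)) n).2
    (v x n).noise (t - (ringState R (y x) (seqNoise (v x)) n).1.toNNReal)) (fun n => ?_)
    (measurable_nat_sSup (P := fun n x => (ringState R (y x) (seqNoise (v x)) n).1 ≤ t) fun n => ?_)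
  · have h := hR.measurable_ringState hy hv n
    exact measurable_move (measurable_snd.comp h) ((measurable_pi_apply n).comp hv)
      (measurable_const.sub (measurable_fst.comp h).ennreal_toNNReal)
  · exact measurableSet_le (measurable_fst.comp (hR.measurable_ringState hy hv n)) measurable_const

end

/-! ### The evolution up to the first ring and after it -/

section Recursion

variable (R : List ℝ → ℕ → ℝ → List ℝ) (y : List ℝ) (w : ℕ → StepNoise)

/-- The configuration right after the first ring. -/
noncomputable def afterRing (w : StepNoise) : List ℝ :=
  R (move y w (firstRing y w).toNNReal) (ringingLabel y w) w.jump

/-- The definition adds rings at the end; peeling off the first ring instead is what the inductions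
on trajectories need. -/
theorem ringState_succ' (n : ℕ) : ringState R y w (n + 1) =
    (firstRing y (w 0) + (ringState R (afterRing R y (w 0)) (tailSeq w) n).1,
      (ringState R (afterRing R y (w 0)) (tailSeq w) n).2) := by
  induction n with
  | zero => simp [ringState, afterRing]
  | succ n ih =>
    rw [ringState, ih]
    simp only [ringState, tailSeq_apply, add_assoc]

theorem monotone_ringState : Monotone fun n => (ringState R y w n).1 :=
  monotone_nat_of_le_succ fun n => by simp only [ringState]; exact le_self_add

variable {R y w}

theorem evolve_of_lt {t : ℝ≥0} (h : t < firstRing y (w 0)) :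
    evolve R y w t = move y (w 0) t := by
  have h0 : {n : ℕ | (ringState R y w n).1 ≤ (t : ENNReal)} = {0} := by
    ext n
    cases n with
    | zero => simp [ringState]
    | succ n =>
      simp only [Set.mem_ofPred_eq, ringState_succ', Set.mem_singleton_iff, Nat.add_eq_zero_iff,
        one_ne_zero, and_false, iff_false, not_le]
      exact h.trans_le le_self_add
  simp [evolve, h0, ringState]

/-- The condition `hb` excludes explosion before `t`: the number of the last ring is a supremum in
`ℕ`, whose default value `0` for an unbounded set would break the recursion. -/
theorem evolve_of_ge {t : ℝ≥0} (h : firstRing y (w 0) ≤ t)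
    (hb : ∃ n, (t : ENNReal) < (ringState R y w n).1) :
    evolve R y w t =
      evolve R (afterRing R y (w 0)) (tailSeq w) (t - (firstRing y (w 0)).toNNReal) := by
  have hfin : firstRing y (w 0) ≠ ⊤ := (h.trans_lt ENNReal.coe_lt_top).ne
  set τ := (firstRing y (w 0)).toNNReal with hτ
  have hτ' : firstRing y (w 0) = τ := (ENNReal.coe_toNNReal hfin).symm
  have hτt : τ ≤ t := by rw [hτ'] at h; exact_mod_cast h
  set S := fun n => (ringState R (afterRing R y (w 0)) (tailSeq w) n).1 with hS
  have hiff : ∀ n, (ringState R y w (n + 1)).1 ≤ (t : ENNReal) ↔ S n ≤ ((t - τ : ℝ≥0) : ENNReal) := by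
    intro n
    rw [ringState_succ', hτ', ENNReal.coe_sub]
    show (τ : ENNReal) + S n ≤ t ↔ _
    have := ENNReal.le_sub_iff_add_le_left (a := S n) (b := (t : ENNReal)) (c := (τ : ENNReal))
      ENNReal.coe_ne_top (by exact_mod_cast hτt)
    exact this.symm
  obtain ⟨b, hb⟩ := hb
  have hbdd : BddAbove {n : ℕ | S n ≤ ((t - τ : ℝ≥0) : ENNReal)} := by
    refine ⟨b, fun n hn => ?_⟩
    by_contra hlt
    have := (hiff n).2 hn
    exact absurd (hb.trans_le (monotone_ringState R y w (by omega : b ≤ n + 1))) (not_lt.2 this)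
  set m := sSup {n : ℕ | S n ≤ ((t - τ : ℝ≥0) : ENNReal)} with hm
  have hmem : S m ≤ ((t - τ : ℝ≥0) : ENNReal) :=
    Nat.sSup_mem (s := {n : ℕ | S n ≤ ((t - τ : ℝ≥0) : ENNReal)}) ⟨0, by simp [hS, ringState]⟩ hbdd
  have hsup : sSup {n : ℕ | (ringState R y w n).1 ≤ (t : ENNReal)} = m + 1 := by
    refine IsGreatest.csSup_eq ⟨(hiff m).2 hmem, fun n hn => ?_⟩
    cases n with
    | zero => omega
    | succ n => exact Nat.succ_le_succ (le_csSup hbdd ((hiff n).1 hn))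
  have hfinS : S m ≠ ⊤ := (hmem.trans_lt ENNReal.coe_lt_top).ne
  simp only [evolve]
  rw [hsup, ringState_succ', ← hm, hτ', ENNReal.toNNReal_add ENNReal.coe_ne_top hfinS,
    ENNReal.toNNReal_coe, tsub_add_eq_tsub_tsub]
  rfl

theorem evolve_nil {t : ℝ≥0} : evolve R [] w t = [] := by
  have : firstRing [] (w 0) = ⊤ := by
    have : IsEmpty (Fin ([] : List ℝ).length) := Fin.isEmpty
    exact iInf_of_empty _
  rw [evolve_of_lt (by rw [this]; exact ENNReal.coe_lt_top)]
  simp [move]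

end Recursion

/-! ### The clocks do not accumulate -/

/-- The first ring among the labels `< l`. -/
noncomputable def minClock (l : ℕ) (w : Step) : ENNReal :=
  ⨅ i : ℕ, if i < l then ((w.1 i).1 : ENNReal) else ⊤

theorem firstRing_eq (y : List ℝ) (w : Step) : firstRing y w.noise = minClock y.length w :=
  firstRing_eq_iInf y w

theorem minClock_le {l i : ℕ} (h : i < l) (w : Step) : minClock l w ≤ (w.1 i).1 :=
  (iInf_le _ i).trans (by simp [h])

theorem le_minClock_iff {l : ℕ} {w : Step} {t : ENNReal} :
    t ≤ minClock l w ↔ ∀ i < l, t ≤ (w.1 i).1 := by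
  rw [minClock, le_iInf_iff]
  refine forall_congr' fun i => ?_
  by_cases h : i < l <;> simp [h]

theorem minClock_anti {l l' : ℕ} (h : l ≤ l') (w : Step) : minClock l' w ≤ minClock l w :=
  le_minClock_iff.2 fun _ hi => minClock_le (hi.trans_le h) w

theorem minClock_ne_top {l : ℕ} (h : 0 < l) (w : Step) : minClock l w ≠ ⊤ :=
  ((minClock_le h w).trans_lt ENNReal.coe_lt_top).ne

theorem exists_minClock_eq {l : ℕ} (h : 0 < l) (w : Step) : ∃ i < l, minClock l w = (w.1 i).1 := by
  obtain ⟨i, hi, hmin⟩ := Finset.exists_min_image (Finset.range l) (fun i => (w.1 i).1) ⟨0, by simpa⟩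
  refine ⟨i, by simpa using hi, le_antisymm (minClock_le (by simpa using hi) w) ?_⟩
  exact le_minClock_iff.2 fun j hj => by exact_mod_cast hmin j (by simpa using hj)

theorem measurable_minClock (l : ℕ) : Measurable (minClock l) :=
  measurable_iInf_clock (w := fun w : Step => w) (p := fun i _ => i < l)
    (fun _ => MeasurableSet.const _) measurable_id

/-- However many particles there are at the beginning, the system which grows by at most one
particle per ring does not have infinitely many rings in finite time. -/
def NonExplosive (v : ℕ → Step) : Prop := ∀ L, ∑' n, minClock (L + n) (v n) = ⊤

/-- The quantifier over all initial sizes `L` absorbs the shift of the index, and the single term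
that is dropped or added is finite as soon as one label is present. -/
theorem nonExplosive_tailSeq {v : ℕ → Step} : NonExplosive (tailSeq v) ↔ NonExplosive v := by
  constructor
  · intro h L
    rw [tsum_eq_zero_add' ENNReal.summable]
    have : ∑' n, minClock (L + (n + 1)) (v (n + 1)) = ⊤ := by
      rw [← h (L + 1)]
      exact tsum_congr fun n => by rw [tailSeq_apply, show L + (n + 1) = L + 1 + n by omega]
    rw [this, add_top]
  · intro h L
    have h1 := h (L + 1)
    rw [tsum_eq_zero_add' ENNReal.summable, ENNReal.add_eq_top] at h1
    have h2 := h1.resolve_left (minClock_ne_top (by omega) _)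
    rw [← top_le_iff, ← h2]
    exact ENNReal.tsum_le_tsum fun n => minClock_anti (by omega) _

theorem IsRule.length_ringState {R : List ℝ → ℕ → ℝ → List ℝ} (hR : IsRule R) (y : List ℝ)
    (w : ℕ → StepNoise) (n : ℕ) : (ringState R y w n).2.length ≤ y.length + n := by
  induction n with
  | zero => simp [ringState]
  | succ n ih =>
    simp only [ringState]
    refine (hR.length_le _ _ _).trans ?_
    rw [length_move]
    omega

/-- After `n` rings there are at most `y.length + n` particles, so the next waiting time is at least
the minimum of that many clocks, and these minima sum to infinity. -/
theorem IsRule.exists_lt_ringState {R : List ℝ → ℕ → ℝ → List ℝ} (hR : IsRule R) (y : List ℝ)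
    {v : ℕ → Step} (hv : NonExplosive v) (t : ℝ≥0) :
    ∃ n, (t : ENNReal) < (ringState R y (seqNoise v) n).1 := by
  have h1 : ∀ n, ∑ k ∈ Finset.range n, minClock (y.length + k) (v k) ≤
      (ringState R y (seqNoise v) n).1 := by
    intro n
    induction n with
    | zero => simp
    | succ n ih =>
      rw [Finset.sum_range_succ]
      simp only [ringState]
      refine add_le_add ih ?_
      show _ ≤ firstRing _ (v n).noise
      rw [firstRing_eq]
      exact minClock_anti (hR.length_ringState _ _ _) _
  have h2 : (t : ENNReal) < ∑' n, minClock (y.length + n) (v n) := by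
    rw [hv]; exact ENNReal.coe_lt_top
  rw [ENNReal.tsum_eq_iSup_nat, lt_iSup_iff] at h2
  obtain ⟨n, hn⟩ := h2
  exact ⟨n, hn.trans_le (h1 n)⟩

theorem IsRule.evolve_of_ge {R : List ℝ → ℕ → ℝ → List ℝ} (hR : IsRule R) {y : List ℝ}
    {v : ℕ → Step} (hv : NonExplosive v) {t : ℝ≥0} (h : firstRing y (v 0).noise ≤ t) :
    evolve R y (seqNoise v) t = evolve R (afterRing R y (v 0).noise) (seqNoise (tailSeq v))
      (t - (firstRing y (v 0).noise).toNNReal) :=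
  ParticleSystem.evolve_of_ge h (hR.exists_lt_ringState y hv t)

theorem measurableSet_nonExplosive : MeasurableSet {v | NonExplosive v} := by
  simp only [NonExplosive, Set.ofPred_forall]
  refine MeasurableSet.iInter fun L => measurableSet_eq_fun ?_ measurable_const
  exact Measurable.tsum fun n => (measurable_minClock _).comp (measurable_pi_apply n)

/-! ### Restarting the noise before the first ring -/

theorem firstRing_joinStep (c : List ℝ) (hc : c ≠ []) (T : ℝ≥0) (u v : Step) :
    firstRing c (joinStep c.length T u v).noise = T + firstRing c v.noise := by
  have : Nonempty (Fin c.length) := ⟨⟨0, List.length_pos_iff.2 hc⟩⟩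
  unfold firstRing
  rw [ENNReal.add_iInf]
  refine iInf_congr fun i => ?_
  have h1 : ((joinStep c.length T u v).noise.clock i : ℝ) = ((T + (v.1 i).1 : ℝ≥0) : ℝ) := by
    simp [Step.noise, joinStep, joinMarks, Mark.join]
  rw [h1, ENNReal.ofReal_coe_nnreal, ENNReal.coe_add]
  simp [Step.noise]

theorem ringingLabel_joinStep (c : List ℝ) (T : ℝ≥0) (u v : Step) :
    ringingLabel c (joinStep c.length T u v).noise = ringingLabel c v.noise := by
  unfold ringingLabel
  congr 1
  ext i
  simp only [Set.mem_ofPred_eq]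
  refine and_congr_right fun hi => forall₂_congr fun j hj => ?_
  simp [Step.noise, joinStep, joinMarks, Mark.join, hi, hj]

theorem ringingLabel_congr {c c' : List ℝ} (h : c.length = c'.length) (w : StepNoise) :
    ringingLabel c w = ringingLabel c' w := by
  simp only [ringingLabel, h]

theorem move_joinStep_of_le (c : List ℝ) {T t : ℝ≥0} (h : t ≤ T) (u v : Step) :
    move c (joinStep c.length T u v).noise t = move c u.noise t := by
  refine list_ext_getD (by simp [length_move]) fun i hi => ?_
  rw [length_move] at hi
  rw [getD_move, getD_move]
  simp [hi, Step.noise, joinStep, joinMarks, Mark.join, Path.concat_of_le h]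

theorem move_joinStep_add (c : List ℝ) (T s : ℝ≥0) (u v : Step) :
    move c (joinStep c.length T u v).noise (T + s) = move (move c u.noise T) v.noise s := by
  refine list_ext_getD (by simp [length_move]) fun i hi => ?_
  rw [length_move] at hi
  simp only [getD_move, length_move]
  simp [hi, Step.noise, joinStep, joinMarks, Mark.join, Path.concat_add, add_assoc]

theorem evolve_joinStep_of_le (R : List ℝ → ℕ → ℝ → List ℝ) {c : List ℝ} (hc : c ≠ [])
    {T t : ℝ≥0} (h : t < T) (u : Step) (v : ℕ → Step) :
    evolve R c (seqNoise (consSeq (joinStep c.length T u (v 0)) (tailSeq v))) t =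
      move c u.noise t := by
  rw [evolve_of_lt]
  · exact move_joinStep_of_le c h.le u (v 0)
  · show _ < firstRing c (joinStep c.length T u (v 0)).noise
    rw [firstRing_joinStep c hc]
    exact lt_of_lt_of_le (by exact_mod_cast h) le_self_add

/-- All labels of `c` are renewed at the common time `T`, so the remaining waiting time, the ringing
label and the later increments are those of `v 0`. Hence the trajectory restarts at `T` with the
noise `v`. -/
theorem IsRule.evolve_joinStep_of_ge {R : List ℝ → ℕ → ℝ → List ℝ} (hR : IsRule R) {c : List ℝ}
    (hc : c ≠ []) {T t : ℝ≥0} (h : T ≤ t) (u : Step) {v : ℕ → Step} (hv : NonExplosive v) :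
    evolve R c (seqNoise (consSeq (joinStep c.length T u (v 0)) (tailSeq v))) t =
      evolve R (move c u.noise T) (seqNoise v) (t - T) := by
  set v' := consSeq (joinStep c.length T u (v 0)) (tailSeq v) with hv'
  have hne : NonExplosive v' := nonExplosive_tailSeq.1 (by
    rw [hv', tailSeq_consSeq]; exact nonExplosive_tailSeq.2 hv)
  have hlen : (move c u.noise T).length = c.length := length_move _ _ _
  have hf : firstRing (move c u.noise T) (v 0).noise = firstRing c (v 0).noise := by
    rw [firstRing_eq, firstRing_eq, hlen]
  have hfin : firstRing c (v 0).noise ≠ ⊤ := by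
    rw [firstRing_eq]; exact minClock_ne_top (List.length_pos_iff.2 hc) _
  obtain ⟨τ, hτ⟩ : ∃ τ : ℝ≥0, firstRing c (v 0).noise = τ := ⟨_, (ENNReal.coe_toNNReal hfin).symm⟩
  have hf' : firstRing c (v' 0).noise = (T + τ : ℝ≥0) := by
    rw [hv', consSeq_zero, firstRing_joinStep c hc, hτ, ENNReal.coe_add]
  obtain ⟨s, rfl⟩ := exists_add_of_le h
  rw [add_tsub_cancel_left]
  rcases lt_or_ge s τ with hs | hs
  · rw [evolve_of_lt (w := seqNoise v') (by
        show _ < firstRing c (v' 0).noise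
        rw [hf']; exact_mod_cast add_lt_add_right hs T),
      evolve_of_lt (w := seqNoise v) (by
        show _ < firstRing _ (v 0).noise
        rw [hf, hτ]; exact_mod_cast hs)]
    exact move_joinStep_add c T s u (v 0)
  · rw [hR.evolve_of_ge hne (by rw [hf']; exact_mod_cast add_le_add_right hs T),
      hR.evolve_of_ge hv (by rw [hf, hτ]; exact_mod_cast hs), hf', hf, hτ, ENNReal.toNNReal_coe,
      ENNReal.toNNReal_coe, add_tsub_add_eq_tsub_left]
    have : afterRing R c (v' 0).noise = afterRing R (move c u.noise T) (v 0).noise := by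
      unfold afterRing
      rw [hf', hf, hτ, ENNReal.toNNReal_coe, ENNReal.toNNReal_coe, hv', consSeq_zero,
        move_joinStep_add, ringingLabel_joinStep, ringingLabel_congr hlen]
      rfl
    rw [this]
    rfl

/-! ### Almost surely there is no explosion and there are no ties -/

theorem lintegral_prod_range {K : Type*} [MeasurableSpace K] (κ : Measure K)
    [IsProbabilityMeasure κ] (n : ℕ) (φ : ℕ → K → ENNReal) (hφ : ∀ k, Measurable (φ k)) :
    ∫⁻ v, ∏ k ∈ Finset.range n, φ k (v k) ∂(Measure.infinitePi fun _ : ℕ => κ) =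
      ∏ k ∈ Finset.range n, ∫⁻ w, φ k w ∂κ := by
  induction n generalizing φ with
  | zero => simp
  | succ n ih =>
    set κ' := Measure.infinitePi fun _ : ℕ => κ
    have hm : Measurable fun v : ℕ → K => ∏ k ∈ Finset.range n, φ (k + 1) (v k) :=
      Finset.measurable_prod _ fun k _ => (hφ _).comp (measurable_pi_apply k)
    calc ∫⁻ v, ∏ k ∈ Finset.range (n + 1), φ k (v k) ∂κ'
        = ∫⁻ v, φ 0 (v 0) * ∏ k ∈ Finset.range n, φ (k + 1) (tailSeq v k) ∂κ' := by
          simp_rw [Finset.prod_range_succ', mul_comm, tailSeq_apply]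
      _ = ∫⁻ p, φ 0 p.1 * ∏ k ∈ Finset.range n, φ (k + 1) (p.2 k) ∂(κ.prod κ') := by
          have hF : Measurable fun p : K × (ℕ → K) =>
              φ 0 p.1 * ∏ k ∈ Finset.range n, φ (k + 1) (p.2 k) :=
            ((hφ 0).comp measurable_fst).mul (hm.comp measurable_snd)
          rw [← map_head_tailSeq, lintegral_map hF (by fun_prop)]
      _ = _ := by
          rw [lintegral_prod_mul (hφ 0).aemeasurable hm.aemeasurable, ih _ fun k => hφ _,
            Finset.prod_range_succ', mul_comm]

section

variable (J : Measure ℝ) [IsProbabilityMeasure J]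

/-- None of the first `l` clocks rings before time `1 / l`. -/
def LateClocks (l : ℕ) : Set Step := {w | ∀ i < l, (1 / l : ℝ≥0) ≤ (w.1 i).1}

theorem measurableSet_lateClocks (l : ℕ) : MeasurableSet (LateClocks l) :=
  measurableSet_forall_lt measurable_const fun i =>
    measurableSet_le measurable_const (measurable_clock measurable_id i)

/-- Each of the `l` independent clocks exceeds `1 / l` with probability `exp (-1 / l)`, and the
product is `exp (-1)` whatever `l` is. -/
theorem stepLaw_lateClocks {l : ℕ} (hl : 0 < l) :
    ENNReal.ofReal (Real.exp (-1)) ≤ stepLaw J (LateClocks l) := by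
  have hS : MeasurableSet {q : Mark | (1 / l : ℝ≥0) ≤ q.1} :=
    measurableSet_le measurable_const measurable_fst
  have h1 : stepLaw J (LateClocks l) = ∏ _i ∈ Finset.range l,
      markLaw {q | (1 / l : ℝ≥0) ≤ q.1} := by
    rw [← infinitePi_range markLaw l (fun _ => {q | (1 / l : ℝ≥0) ≤ q.1}) fun _ => hS]
    have : LateClocks l = {v : ℕ → Mark | ∀ i < l, v i ∈ {q : Mark | (1 / l : ℝ≥0) ≤ q.1}} ×ˢ
        Set.univ := by
      ext w; simp [LateClocks]
    rw [this, stepLaw, Measure.prod_prod, measure_univ, mul_one]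
  have h2 : ENNReal.ofReal (Real.exp (-(1 / l : ℝ≥0))) ≤ markLaw {q | (1 / l : ℝ≥0) ≤ q.1} := by
    have : {q : Mark | (1 / l : ℝ≥0) ≤ q.1} = Set.Ici (1 / l : ℝ≥0) ×ˢ Set.univ := by
      ext q; simp
    rw [this, markLaw, Measure.prod_prod, measure_univ, mul_one, ← clockLaw_Ioi]
    exact measure_mono Set.Ioi_subset_Ici_self
  rw [h1]
  refine le_trans ?_ (Finset.prod_le_prod' fun _ _ => h2)
  rw [Finset.prod_const, Finset.card_range, ← ENNReal.ofReal_pow (Real.exp_pos _).le,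
    ← Real.exp_nat_mul]
  refine ENNReal.ofReal_le_ofReal (Real.exp_le_exp.2 (le_of_eq ?_))
  have : (l : ℝ) ≠ 0 := by positivity
  push_cast
  field_simp

open scoped Classical in
/-- A lower bound of the first ring among the labels `< l`. -/
noncomputable def lateTime (l : ℕ) (w : Step) : ℝ := if w ∈ LateClocks l then 1 / l else 0

theorem measurable_lateTime (l : ℕ) : Measurable (lateTime l) :=
  Measurable.ite (measurableSet_lateClocks l) measurable_const measurable_const

theorem lateTime_nonneg (l : ℕ) (w : Step) : 0 ≤ lateTime l w := by
  unfold lateTime; split_ifs <;> positivity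

theorem ofReal_lateTime_le (l : ℕ) (w : Step) : ENNReal.ofReal (lateTime l w) ≤ minClock l w := by
  unfold lateTime
  split_ifs with h
  · refine le_minClock_iff.2 fun i hi => ?_
    rw [show (1 / l : ℝ) = ((1 / l : ℝ≥0) : ℝ) by simp, ENNReal.ofReal_coe_nnreal]
    exact_mod_cast h i hi
  · simp

/-- With `p` the probability of `LateClocks`, the integral is `1 - p * (1 - exp (-1 / l))`. It is
bounded by means of `exp (-1 / l) ≤ l / (l + 1)`, `p ≥ exp (-1)` and `1 - x ≤ exp (-x)`. -/
theorem lintegral_exp_lateTime_le {l : ℕ} (hl : 0 < l) :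
    ∫⁻ w, ENNReal.ofReal (Real.exp (-lateTime l w)) ∂(stepLaw J) ≤
      ENNReal.ofReal (Real.exp (-(Real.exp (-1) / (l + 1)))) := by
  classical
  set G := LateClocks l
  have hG : MeasurableSet G := measurableSet_lateClocks l
  have hp := stepLaw_lateClocks J hl
  set p := (stepLaw J).real G with hpdef
  have hpe : stepLaw J G = ENNReal.ofReal p := by simp [hpdef]
  have hp1 : p ≤ 1 := measureReal_le_one
  have hp0 : Real.exp (-1) ≤ p := by
    rw [hpe] at hp
    exact (ENNReal.ofReal_le_ofReal_iff measureReal_nonneg).1 hp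
  have hl' : (0 : ℝ) < l := by exact_mod_cast hl
  have h1 : ∫⁻ w, ENNReal.ofReal (Real.exp (-lateTime l w)) ∂(stepLaw J) =
      ENNReal.ofReal (Real.exp (-(1 / l))) * ENNReal.ofReal p + ENNReal.ofReal (1 - p) := by
    rw [← lintegral_add_compl _ hG]
    congr 1
    · rw [setLIntegral_congr_fun hG (g := fun _ => ENNReal.ofReal (Real.exp (-(1 / l))))
        fun w hw => by simp [lateTime, show w ∈ LateClocks l from hw]]
      rw [setLIntegral_const, hpe]
    · rw [setLIntegral_congr_fun hG.compl (g := fun _ => 1)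
        fun w hw => by simp [lateTime, show w ∉ LateClocks l from hw]]
      rw [setLIntegral_const, one_mul, prob_compl_eq_one_sub hG, hpe, ← ENNReal.ofReal_one,
        ← ENNReal.ofReal_sub _ measureReal_nonneg]
  have hexp : Real.exp (-(1 / l)) ≤ l / (l + 1) := by
    rw [Real.exp_neg, inv_le_comm₀ (Real.exp_pos _) (by positivity)]
    refine le_trans (le_of_eq ?_) (Real.add_one_le_exp (1 / (l : ℝ)))
    field_simp
    ring
  rw [h1, ← ENNReal.ofReal_mul (Real.exp_pos _).le,
    ← ENNReal.ofReal_add (by positivity) (by linarith)]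
  refine ENNReal.ofReal_le_ofReal ?_
  have h2 : Real.exp (-(1 / l)) * p + (1 - p) ≤ 1 - Real.exp (-1) / (l + 1) := by
    have h3 : Real.exp (-(1 / l)) * p ≤ l / (l + 1) * p :=
      mul_le_mul_of_nonneg_right hexp measureReal_nonneg
    have h4 : l / (l + 1) * p = p - p / (l + 1) := by field_simp; ring
    have h5 : Real.exp (-1) / (l + 1) ≤ p / (l + 1) := by gcongr
    linarith
  refine h2.trans ?_
  have := Real.add_one_le_exp (-(Real.exp (-1) / (l + 1)))
  linarith

/-- By independence the mean of `exp (-∑ lateTime)` is at most the exponential of minus a multiple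
of a harmonic sum, hence tends to `0`. Markov's inequality then excludes that the sum of the waiting
times stays below any given constant. -/
theorem ae_tsum_minClock (L : ℕ) :
    ∀ᵐ v ∂(Measure.infinitePi fun _ : ℕ => stepLaw J), ∑' n, minClock (L + 1 + n) (v n) = ⊤ := by
  set M := Measure.infinitePi fun _ : ℕ => stepLaw J
  have hsum : Filter.Tendsto (fun n => ∑ k ∈ Finset.range n,
      Real.exp (-1) / (((L + 1 + k : ℕ) : ℝ) + 1)) Filter.atTop Filter.atTop := by
    have h1 : ¬ Summable fun k : ℕ => Real.exp (-1) / (((L + 1 + k : ℕ) : ℝ) + 1) := by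
      intro h
      have h2 : Summable fun k : ℕ => 1 / ((k + (L + 2) : ℕ) : ℝ) := by
        refine (h.mul_left (Real.exp 1)).congr fun k => ?_
        rw [← mul_div_assoc, ← Real.exp_add]
        norm_num
        ring
      exact Real.not_summable_one_div_natCast
        ((summable_nat_add_iff (f := fun n : ℕ => 1 / (n : ℝ)) (L + 2)).1 h2)
    exact (not_summable_iff_tendsto_nat_atTop_of_nonneg fun k => by positivity).1 h1
  have hprod : Filter.Tendsto (fun n => ENNReal.ofReal (Real.exp (-∑ k ∈ Finset.range n,
      Real.exp (-1) / (((L + 1 + k : ℕ) : ℝ) + 1)))) Filter.atTop (nhds 0) := by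
    rw [← ENNReal.ofReal_zero]
    exact ENNReal.tendsto_ofReal
      (Real.tendsto_exp_atBot.comp (Filter.tendsto_neg_atTop_atBot.comp hsum))
  have hbound : ∀ n, ∫⁻ v, ENNReal.ofReal (Real.exp (-∑ k ∈ Finset.range n,
      lateTime (L + 1 + k) (v k))) ∂M ≤ ENNReal.ofReal (Real.exp (-∑ k ∈ Finset.range n,
      Real.exp (-1) / (((L + 1 + k : ℕ) : ℝ) + 1))) := by
    intro n
    have h1 : ∀ a : ℕ → ℝ, ENNReal.ofReal (Real.exp (-∑ k ∈ Finset.range n, a k)) =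
        ∏ k ∈ Finset.range n, ENNReal.ofReal (Real.exp (-a k)) := fun a => by
      rw [← Finset.sum_neg_distrib, Real.exp_sum,
        ENNReal.ofReal_prod_of_nonneg fun _ _ => (Real.exp_pos _).le]
    simp_rw [h1]
    rw [lintegral_prod_range (stepLaw J) n
      (fun k w => ENNReal.ofReal (Real.exp (-lateTime (L + 1 + k) w))) fun k =>
        (Real.measurable_exp.comp (measurable_lateTime _).neg).ennreal_ofReal]
    exact Finset.prod_le_prod' fun k _ => lintegral_exp_lateTime_le J (by omega)
  have hC : ∀ C : ℕ, M {v | ∑' n, minClock (L + 1 + n) (v n) ≤ C} = 0 := by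
    intro C
    have h1 : ∀ n, ENNReal.ofReal (Real.exp (-C)) *
        M {v | ∑' n, minClock (L + 1 + n) (v n) ≤ C} ≤
        ENNReal.ofReal (Real.exp (-∑ k ∈ Finset.range n,
          Real.exp (-1) / (((L + 1 + k : ℕ) : ℝ) + 1))) := by
      intro n
      refine le_trans ?_ (hbound n)
      refine le_trans ?_ (mul_meas_ge_le_lintegral ?_ (ENNReal.ofReal (Real.exp (-C))))
      · refine mul_le_mul_right (measure_mono fun v hv => ?_) _
        refine ENNReal.ofReal_le_ofReal (Real.exp_le_exp.2 (neg_le_neg ?_))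
        have h2 : ENNReal.ofReal (∑ k ∈ Finset.range n, lateTime (L + 1 + k) (v k)) ≤ C := by
          rw [ENNReal.ofReal_sum_of_nonneg fun _ _ => lateTime_nonneg _ _]
          exact ((Finset.sum_le_sum fun k _ => ofReal_lateTime_le _ _).trans
            (ENNReal.sum_le_tsum _)).trans hv
        rw [← ENNReal.ofReal_natCast] at h2
        exact (ENNReal.ofReal_le_ofReal_iff (by positivity)).1 h2
      · refine (Real.measurable_exp.comp (Measurable.neg ?_)).ennreal_ofReal
        exact Finset.measurable_sum _ fun k _ =>
          (measurable_lateTime _).comp (measurable_pi_apply k)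
    have h2 := ge_of_tendsto' hprod h1
    rcases mul_eq_zero.1 (le_antisymm h2 zero_le) with h | h
    · exact absurd h (by simp [Real.exp_pos])
    · exact h
  have h : ∀ᵐ v ∂M, ∀ C : ℕ, ¬ ∑' n, minClock (L + 1 + n) (v n) ≤ C :=
    ae_all_iff.2 fun C => measure_eq_zero_iff_ae_notMem.1 (hC C)
  filter_upwards [h] with v hv
  by_contra hne
  obtain ⟨C, hC'⟩ := ENNReal.exists_nat_gt hne
  exact hv C hC'.le

theorem ae_nonExplosive : ∀ᵐ v ∂(Measure.infinitePi fun _ : ℕ => stepLaw J), NonExplosive v := by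
  filter_upwards [ae_all_iff.2 fun L => ae_tsum_minClock J L] with v hv L
  rw [← top_le_iff, ← hv L]
  exact ENNReal.tsum_le_tsum fun n => minClock_anti (by omega) _

/-- No two clocks are equal. -/
def TieFree (w : Step) : Prop := ∀ i j, i ≠ j → (w.1 i).1 ≠ (w.1 j).1

theorem measurableSet_tieFree : MeasurableSet {w | TieFree w} := by
  have : {w : Step | TieFree w} = ⋂ i, ⋂ j, ({_w | i ≠ j}ᶜ ∪ {w | (w.1 i).1 = (w.1 j).1}ᶜ) := by
    ext w
    simp only [TieFree, Set.mem_iInter, Set.mem_union, Set.mem_compl_iff, Set.mem_ofPred_eq,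
      imp_iff_not_or]
  rw [this]
  exact MeasurableSet.iInter fun i => MeasurableSet.iInter fun j =>
    (MeasurableSet.const _).compl.union (measurableSet_eq_fun (measurable_clock measurable_id i)
      (measurable_clock measurable_id j)).compl

theorem ae_tieFree : ∀ᵐ w ∂(stepLaw J), TieFree w := by
  refine ae_all_iff.2 fun i => ae_all_iff.2 fun j => ?_
  by_cases hij : i = j
  · exact ae_of_all _ fun w h => absurd hij h
  set M := Measure.infinitePi fun _ : ℕ => markLaw
  have hind : IndepFun (fun v : ℕ → Mark => v i) (fun v => v j) M := by
    have := iIndepFun_infinitePi (P := fun _ : ℕ => markLaw) (X := fun _ => id)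
      (fun _ => measurable_id)
    exact this.indepFun hij
  have hmap : M.map (fun v => (v i, v j)) = markLaw.prod markLaw := by
    rw [(indepFun_iff_map_prod_eq_prod_map_map
      (measurable_pi_apply i).aemeasurable (measurable_pi_apply j).aemeasurable).1 hind,
      Measure.infinitePi_map_eval (fun _ : ℕ => markLaw),
      Measure.infinitePi_map_eval (fun _ : ℕ => markLaw)]
  have hS : MeasurableSet {p : Mark × Mark | p.1.1 ≠ p.2.1} :=
    (measurableSet_eq_fun (by fun_prop) (by fun_prop)).compl
  have h1 : ∀ᵐ p ∂(markLaw.prod markLaw), p.1.1 ≠ p.2.1 := by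
    refine (Measure.ae_prod_iff_ae_ae hS).2 (ae_of_all _ fun p => ?_)
    have h2 : ∀ᵐ s ∂clockLaw, s ∉ ({p.1} : Set ℝ≥0) :=
      measure_eq_zero_iff_ae_notMem.1 (clockLaw_singleton _)
    filter_upwards [(measurePreserving_fst (μ := clockLaw) (ν := wiener)).quasiMeasurePreserving.ae
      h2] with q hq h
    exact hq h.symm
  rw [← hmap] at h1
  have h3 : ∀ᵐ v ∂M, (v i).1 ≠ (v j).1 :=
    ae_of_ae_map (f := fun v : ℕ → Mark => (v i, v j)) (p := fun p => p.1.1 ≠ p.2.1)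
      (by fun_prop) h1
  filter_upwards [(measurePreserving_fst (μ := M) (ν := J)).quasiMeasurePreserving.ae h3] with w hw _
  exact hw

theorem ae_forall_tieFree :
    ∀ᵐ v ∂(Measure.infinitePi fun _ : ℕ => stepLaw J), ∀ n, TieFree (v n) :=
  ae_all_iff.2 fun n =>
    (measurePreserving_eval_infinitePi (fun _ : ℕ => stepLaw J) n).quasiMeasurePreserving.ae
      (ae_tieFree J)

end

/-! ### Trajectories made of blocks -/

section Blocks

variable {flow : List ℝ → (ℕ → StepNoise) → ℝ≥0 → List ℝ} {cut : List ℝ → List ℝ} {δ : ℝ≥0}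
  {c : List ℝ} {w : ℕ → ℕ → StepNoise}

theorem blockStart_succ' (k : ℕ) : blockStart flow cut δ c w (k + 1) =
    blockStart flow cut δ (cut (flow c (w 0) δ)) (tailSeq w) k := by
  induction k with
  | zero => rfl
  | succ k ih => rw [blockStart, ih]; rfl

theorem blockPath_of_lt {t : ℝ≥0} (h : t < δ) :
    blockPath flow cut δ c w t = flow c (w 0) t := by
  have hf : ⌊t / δ⌋₊ = 0 := Nat.floor_eq_zero.2 ((div_lt_one (pos_of_gt h)).2 h)
  simp [blockPath, hf, blockStart]

theorem blockPath_of_ge {t : ℝ≥0} (hδ : 0 < δ) (h : δ ≤ t) : blockPath flow cut δ c w t =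
    blockPath flow cut δ (cut (flow c (w 0) δ)) (tailSeq w) (t - δ) := by
  obtain ⟨s, rfl⟩ := exists_add_of_le h
  have hf : ⌊(δ + s) / δ⌋₊ = ⌊s / δ⌋₊ + 1 := by
    rw [add_div, div_self hδ.ne', add_comm, Nat.floor_add_one zero_le]
  simp only [blockPath, hf, blockStart_succ', add_tsub_cancel_left]
  congr 1
  push_cast
  rw [add_mul, one_mul, add_comm _ δ, add_tsub_add_eq_tsub_left]

theorem blockPath_nil {R : List ℝ → ℕ → ℝ → List ℝ} (t : ℝ≥0) :
    blockPath (evolve R) id δ [] w t = [] := by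
  have : ∀ k, blockStart (evolve R) id δ [] w k = [] := fun k => by
    induction k with
    | zero => rfl
    | succ k ih => rw [blockStart, ih]; exact evolve_nil
  simp only [blockPath, this]
  exact evolve_nil

end Blocks

namespace Merger

variable {α K S : Type*} (A : Merger α K S)

theorem orbit_succ' (n : ℕ) (p : S × α) : A.orbit (n + 1) p =
    (A.step (A.orbit n p).1 (A.head (A.orbit n p).2), A.rest (A.orbit n p).1 (A.orbit n p).2) := by
  induction n generalizing p with
  | zero => rfl
  | succ n ih => rw [orbit, ih]; rfl

theorem pend_orbit {s : S} {x : α} (h : ∀ n, A.count n s x = 0) (k : ℕ) :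
    A.pend (A.orbit k (s, x)).1 (A.head (A.orbit k (s, x)).2) := by
  have h1 := h (k + 1)
  rw [count_add] at h1
  by_contra hp
  simp [count, hp] at h1

end Merger

/-! ### Joining the blocks -/

open scoped Classical in
/-- The machine which reads the noise of the blocks and produces the noise of a trajectory without
blocks. The state consists of the configuration and the remaining time of the block. -/
noncomputable def blockMerger (R : List ℝ → ℕ → ℝ → List ℝ) (δ : ℝ≥0) :
    Merger (ℕ → ℕ → Step) Step (List ℝ × ℝ≥0) where
  head x := x 0 0
  rest s x := if NoRing s.1.length s.2 (x 0 0).1 then tailSeq x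
    else consSeq (tailSeq (x 0)) (tailSeq x)
  pend s w := NoRing s.1.length s.2 w.1
  join s w v := joinStep s.1.length s.2 w v
  out _ w := w
  step s w := if NoRing s.1.length s.2 w.1 then (move s.1 w.noise s.2, δ)
    else (afterRing R s.1 w.noise, s.2 - (firstRing s.1 w.noise).toNNReal)
  base x := x 0

theorem IsRule.measurable_afterRing {R : List ℝ → ℕ → ℝ → List ℝ} (hR : IsRule R) {α : Type*}
    [MeasurableSpace α] {y : α → List ℝ} {w : α → Step} (hy : Measurable y) (hw : Measurable w) :
    Measurable fun x => afterRing R (y x) (w x).noise :=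
  hR.measurable_comp (measurable_move hy hw (measurable_firstRing hy hw).ennreal_toNNReal)
    (measurable_ringingLabel hy hw) (measurable_snd.comp hw)

theorem measurable_joinStep {α : Type*} [MeasurableSpace α] {a : α → ℕ} {t : α → ℝ≥0}
    {u v : α → Step} (ha : Measurable a) (ht : Measurable t) (hu : Measurable u)
    (hv : Measurable v) : Measurable fun p => joinStep (a p) (t p) (u p) (v p) :=
  (measurable_joinMarks ha ht (measurable_fst.comp hu) (measurable_fst.comp hv)).prodMk
    (measurable_snd.comp hv)

section BlockMerger

variable (J : Measure ℝ) [IsProbabilityMeasure J] {R : List ℝ → ℕ → ℝ → List ℝ}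

/-- The law of the noise of a sequence of steps. -/
noncomputable abbrev seqLaw : Measure (ℕ → Step) := Measure.infinitePi fun _ => stepLaw J

/-- The law of the noise of a sequence of blocks. -/
noncomputable abbrev blockLaw : Measure (ℕ → ℕ → Step) := Measure.infinitePi fun _ => seqLaw J

/-- If no ring occurs before the end of the block, the unread samples of the block are discarded;
this decision uses only the sample just read, and the remaining source is a fresh family of blocks
in either case. The gluing time is the remaining time of the block, which is constant given the
state. -/
theorem lawful_blockMerger (hR : IsRule R) (δ : ℝ≥0) :
    (blockMerger R δ).Lawful (blockLaw J) (stepLaw J) where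
  measurable_head := (measurable_pi_apply 0).comp (measurable_pi_apply 0)
  measurable_rest := by
    have h0 : Measurable fun p : (List ℝ × ℝ≥0) × (ℕ → ℕ → Step) => p.2 0 := by fun_prop
    have h00 : Measurable fun p : (List ℝ × ℝ≥0) × (ℕ → ℕ → Step) => p.2 0 0 := by fun_prop
    exact Measurable.ite (measurableSet_noRing (measurable_length (by fun_prop))
      (by fun_prop) (measurable_fst.comp h00)) (measurable_tailSeq.comp measurable_snd)
      ((measurable_tailSeq.comp h0).consSeq (measurable_tailSeq.comp measurable_snd))
  measurableSet_pend := measurableSet_noRing (measurable_length (by fun_prop)) (by fun_prop)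
    (by fun_prop)
  measurable_join := measurable_joinStep (measurable_length (by fun_prop)) (by fun_prop)
    (by fun_prop) (by fun_prop)
  measurable_out := measurable_snd
  measurable_step := by
    refine Measurable.ite (measurableSet_noRing (measurable_length (by fun_prop)) (by fun_prop)
      (by fun_prop)) ((measurable_move (by fun_prop) measurable_snd (by fun_prop)).prodMk
      measurable_const) ?_
    have h : Measurable fun p : (List ℝ × ℝ≥0) × Step => p.1.1 := by fun_prop
    exact (hR.measurable_afterRing h measurable_snd).prodMk (Measurable.sub (by fun_prop)
      (measurable_firstRing h measurable_snd).ennreal_toNNReal)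
  measurable_base := measurable_pi_apply 0
  map_rest s := by
    have h1 : MeasurePreserving (fun v : ℕ → Step => (v 0, tailSeq v)) (seqLaw J)
      ((stepLaw J).prod (seqLaw J)) := ⟨by fun_prop, map_head_tailSeq _⟩
    have h2 : MeasurePreserving (fun x : ℕ → ℕ → Step => (x 0, tailSeq x)) (blockLaw J)
      ((seqLaw J).prod (blockLaw J)) := ⟨by fun_prop, map_head_tailSeq _⟩
    have h3 := (measurePreserving_prodAssoc (stepLaw J) (seqLaw J) (blockLaw J)).comp
      ((h1.prod (MeasurePreserving.id (blockLaw J))).comp h2)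
    classical
    have h4 := (MeasurePreserving.id (stepLaw J)).skew_product (μc := (seqLaw J).prod (blockLaw J))
      (μd := blockLaw J)
      (g := fun w q => if NoRing s.1.length s.2 w.1 then q.2 else consSeq q.1 q.2)
      (Measurable.ite (measurableSet_noRing measurable_const measurable_const (by fun_prop))
        (by fun_prop) (Measurable.consSeq (by fun_prop) (by fun_prop)))
      (ae_of_all _ fun w => by
        by_cases hw : NoRing s.1.length s.2 w.1
        · simp only [hw, if_true]; exact Measure.map_snd_prod.trans (by simp)
        · simp only [hw, if_false]; exact map_consSeq _)
    exact (h4.comp h3).map_eq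
  map_base := Measure.infinitePi_map_eval (fun _ => seqLaw J) 0
  map_single s := map_joinStep J s.1.length 1 (T := fun _ => s.2) measurable_const fun _ _ => rfl

/-- A sample that is never completed would stretch over infinitely many block ends, all but the
first of them `δ` apart. Label `0` serves as the clock because a pending configuration is nonempty.
-/
theorem ae_productive_blockMerger (hR : IsRule R) {δ : ℝ≥0} (hδ : 0 < δ) (s : List ℝ × ℝ≥0) :
    ∀ᵐ x ∂(blockLaw J), (blockMerger R δ).Productive s x := by
  refine (lawful_blockMerger J hR δ).ae_productive (clock := fun w => ((w.1 0).1 : ENNReal))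
    (measurable_coe_nnreal_ennreal.comp (measurable_clock measurable_id 0))
    (ae_of_all _ fun w => ENNReal.coe_lt_top) (fun s _ => s.2) (fun s w v hp => ?_)
    (fun s => ae_of_all _ fun x h => ?_) s
  · have h0 : 0 < s.1.length := hp.1
    simp [blockMerger, joinStep, joinMarks, h0, Mark.join]
  · rw [tsum_eq_zero_add' ENNReal.summable]
    have : ∀ k, ((blockMerger R δ).orbit (k + 1) (s, x)).1.2 = δ := fun k => by
      rw [Merger.orbit_succ']
      have := (blockMerger R δ).pend_orbit h k
      simp only [blockMerger] at this ⊢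
      rw [if_pos this]
    simp only [this]
    rw [ENNReal.tsum_const_eq_top_of_ne_zero (by exact_mod_cast hδ.ne'), add_top]

theorem nonExplosive_output_next {A : Merger α Step S} {s : S} {x : α}
    (hp : A.Productive s x) (h : NonExplosive (A.output s x)) :
    NonExplosive (A.output (A.step s (A.head x)) (A.rest s x)) := by
  rw [hp.output_eq, Merger.combine] at h
  split_ifs at h with hc
  · rw [← nonExplosive_tailSeq, tailSeq_consSeq, nonExplosive_tailSeq] at h
    exact h
  · rwa [← nonExplosive_tailSeq, tailSeq_consSeq] at h

theorem noRing_iff {a : ℕ} {t : ENNReal} {w : Step} :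
    NoRing a t w.1 ↔ 0 < a ∧ t < minClock a w := by
  refine and_congr_right fun ha => ⟨fun h => ?_, fun h i hi => h.trans_le (minClock_le hi w)⟩
  obtain ⟨i, hi, he⟩ := exists_minClock_eq ha w
  rw [he]
  exact h i hi

/-- The outer induction is on the number `k` of block ends still needed to pass `t`, the inner one
on the number `n` of rings that bring the current block past its end `r`. A pending step crosses a
block end and is handled by restarting the joined noise; any other step is one ring peeled off both
trajectories. -/
theorem IsRule.evolve_blockMerger (hR : IsRule R) {δ : ℝ≥0} (hδ : 0 < δ) (k : ℕ) {c : List ℝ}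
    {r : ℝ≥0} {x : ℕ → ℕ → Step} (hp : (blockMerger R δ).Productive (c, r) x)
    (hx : ∀ k, NonExplosive (x k)) (ho : NonExplosive ((blockMerger R δ).output (c, r) x))
    {t : ℝ≥0} (ht : t < r + k * δ) :
    evolve R c (seqNoise ((blockMerger R δ).output (c, r) x)) t =
      if t < r then evolve R c (seqNoise (x 0)) t else
        blockPath (evolve R) id δ (evolve R c (seqNoise (x 0)) r)
          (fun k => seqNoise (tailSeq x k)) (t - r) := by
  induction k using Nat.strong_induction_on generalizing c r x t with
  | _ k ihk =>
  obtain ⟨n, hn⟩ := hR.exists_lt_ringState c (hx 0) r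
  induction n generalizing c r x t with
  | zero => simp [ringState] at hn
  | succ n ihn =>
  rcases eq_or_ne c [] with rfl | hc
  · simp only [evolve_nil, blockPath_nil, ite_self]
  have hlen : 0 < c.length := List.length_pos_iff.2 hc
  have hnext := hp.next
  have honext := nonExplosive_output_next hp ho
  by_cases hpend : NoRing c.length r (x 0 0).1
  · have hout : (blockMerger R δ).output (c, r) x = consSeq (joinStep c.length r (x 0 0)
        ((blockMerger R δ).output (move c (x 0 0).noise r, δ) (tailSeq x) 0))
        (tailSeq ((blockMerger R δ).output (move c (x 0 0).noise r, δ) (tailSeq x))) := by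
      rw [hp.output_eq]
      simp [Merger.combine, blockMerger, hpend]
    have hs : (blockMerger R δ).step (c, r) ((blockMerger R δ).head x) =
        (move c (x 0 0).noise r, δ) := by simp [blockMerger, hpend]
    have hr : (blockMerger R δ).rest (c, r) x = tailSeq x := by simp [blockMerger, hpend]
    rw [hs, hr] at hnext honext
    have hlt : (r : ENNReal) < firstRing c (x 0 0).noise := by
      rw [firstRing_eq]; exact (noRing_iff.1 hpend).2
    rw [hout]
    split_ifs with htr
    · rw [evolve_joinStep_of_le R hc htr]
      exact (evolve_of_lt (w := seqNoise (x 0)) (lt_trans (by exact_mod_cast htr) hlt)).symm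
    · push Not at htr
      rw [hR.evolve_joinStep_of_ge hc htr _ honext, evolve_of_lt (w := seqNoise (x 0)) hlt]
      have hk : k ≠ 0 := by
        rintro rfl
        simp only [Nat.cast_zero, zero_mul, add_zero] at ht
        exact absurd ht (not_lt.2 htr)
      obtain ⟨k, rfl⟩ := Nat.exists_eq_succ_of_ne_zero hk
      have ht' : t - r < δ + k * δ := by
        rw [tsub_lt_iff_left htr]
        refine ht.trans_eq ?_
        push_cast; ring
      rw [ihk k (Nat.lt_succ_self k) hnext (fun k => hx _) honext ht']
      split_ifs with h
      · exact (blockPath_of_lt (flow := evolve R) (cut := id)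
          (w := fun k => seqNoise (tailSeq x k)) h).symm
      · exact (blockPath_of_ge (flow := evolve R) (cut := id)
          (w := fun k => seqNoise (tailSeq x k)) hδ (not_lt.1 h)).symm
  · have hout : (blockMerger R δ).output (c, r) x = consSeq (x 0 0)
        ((blockMerger R δ).output (afterRing R c (x 0 0).noise,
          r - (firstRing c (x 0 0).noise).toNNReal) (consSeq (tailSeq (x 0)) (tailSeq x))) := by
      rw [hp.output_eq]
      simp [Merger.combine, blockMerger, hpend]
    have hs : (blockMerger R δ).step (c, r) ((blockMerger R δ).head x) =
        (afterRing R c (x 0 0).noise, r - (firstRing c (x 0 0).noise).toNNReal) := by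
      simp [blockMerger, hpend]
    have hr : (blockMerger R δ).rest (c, r) x = consSeq (tailSeq (x 0)) (tailSeq x) := by
      simp [blockMerger, hpend]
    rw [hs, hr] at hnext honext
    have hle : firstRing c (x 0 0).noise ≤ r := by
      rw [noRing_iff] at hpend
      push Not at hpend
      rw [firstRing_eq]
      exact hpend hlen
    have hfin : firstRing c (x 0 0).noise ≠ ⊤ := (hle.trans_lt ENNReal.coe_lt_top).ne
    set τ := (firstRing c (x 0 0).noise).toNNReal with hτdef
    have hτ : firstRing c (x 0 0).noise = τ := (ENNReal.coe_toNNReal hfin).symm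
    have hτr : τ ≤ r := by rw [hτ] at hle; exact_mod_cast hle
    rcases lt_or_ge t τ with htτ | htτ
    · have h1 : (t : ENNReal) < firstRing c (x 0 0).noise := by rw [hτ]; exact_mod_cast htτ
      rw [if_pos (htτ.trans_le hτr), hout, evolve_of_lt (by exact h1), evolve_of_lt (by exact h1)]
      rfl
    · have h1 : firstRing c (x 0 0).noise ≤ t := by rw [hτ]; exact_mod_cast htτ
      have hx' : ∀ k, NonExplosive (consSeq (tailSeq (x 0)) (tailSeq x) k) := fun k => by
        cases k with
        | zero => exact nonExplosive_tailSeq.2 (hx 0)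
        | succ k => exact hx _
      have ht' : t - τ < r - τ + k * δ := by
        rw [tsub_lt_iff_left htτ, ← add_assoc, add_tsub_cancel_of_le hτr]
        exact ht
      have hn' : ((r - τ : ℝ≥0) : ENNReal) < (ringState R (afterRing R c (x 0 0).noise)
          (seqNoise (tailSeq (x 0))) n).1 := by
        rw [ringState_succ'] at hn
        change (r : ENNReal) < firstRing c (x 0 0).noise + _ at hn
        rw [hτ] at hn
        rw [ENNReal.coe_sub]
        exact ENNReal.sub_lt_of_lt_add (by exact_mod_cast hτr) (by rwa [add_comm] at hn)
      have key := ihn hnext hx' honext ht' hn'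
      rw [hR.evolve_of_ge ho (by rw [hout]; exact h1)]
      have h2 : seqNoise (tailSeq ((blockMerger R δ).output (c, r) x)) =
        seqNoise ((blockMerger R δ).output (afterRing R c (x 0 0).noise, r - τ)
          (consSeq (tailSeq (x 0)) (tailSeq x))) := by rw [hout]; rfl
      have h3 : (blockMerger R δ).output (c, r) x 0 = x 0 0 := by rw [hout]; rfl
      rw [h2, h3, ← hτdef, key]
      have h4 : (t - τ < r - τ) ↔ t < r := tsub_lt_tsub_iff_right htτ
      simp only [h4]
      split_ifs with htr
      · rw [hR.evolve_of_ge (hx 0) h1]; rfl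
      · rw [hR.evolve_of_ge (hx 0) hle, tsub_tsub_tsub_cancel_right hτr]; rfl

/-- The blocks are read completely and the clocks do not accumulate. -/
def BlockGood (R : List ℝ → ℕ → ℝ → List ℝ) (δ : ℝ≥0) (s : List ℝ × ℝ≥0) (x : ℕ → ℕ → Step) : Prop :=
  (blockMerger R δ).Productive s x ∧ (∀ k, NonExplosive (x k)) ∧
    NonExplosive ((blockMerger R δ).output s x)

theorem measurableSet_blockGood (hR : IsRule R) (δ : ℝ≥0) :
    MeasurableSet {p : (List ℝ × ℝ≥0) × (ℕ → ℕ → Step) | BlockGood R δ p.1 p.2} := by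
  have hl := lawful_blockMerger (Measure.dirac 0) hR δ
  refine hl.measurableSet_productive.inter (MeasurableSet.inter ?_
    (hl.measurable_output measurableSet_nonExplosive))
  show MeasurableSet {p : (List ℝ × ℝ≥0) × (ℕ → ℕ → Step) | ∀ k, NonExplosive (p.2 k)}
  rw [Set.ofPred_forall]
  refine MeasurableSet.iInter fun k => ?_
  have h : Measurable fun p : (List ℝ × ℝ≥0) × (ℕ → ℕ → Step) => p.2 k := by fun_prop
  exact h measurableSet_nonExplosive

theorem ae_blockGood (hR : IsRule R) {δ : ℝ≥0} (hδ : 0 < δ) (s : List ℝ × ℝ≥0) :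
    ∀ᵐ x ∂(blockLaw J), BlockGood R δ s x := by
  have hpr := ae_productive_blockMerger J hR hδ s
  have h1 : ∀ᵐ x ∂(blockLaw J), ∀ k, NonExplosive (x k) := ae_all_iff.2 fun k =>
    (measurePreserving_eval_infinitePi (fun _ => seqLaw J) k).quasiMeasurePreserving.ae
      (ae_nonExplosive J)
  have h2 : ∀ᵐ x ∂(blockLaw J), NonExplosive ((blockMerger R δ).output s x) := by
    have := ae_nonExplosive J
    rw [← (lawful_blockMerger J hR δ).map_output hpr] at this
    exact ae_of_ae_map ((lawful_blockMerger J hR δ).measurable_output.comp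
      (measurable_const.prodMk measurable_id)).aemeasurable this
  filter_upwards [hpr, h1, h2] with x hp hx ho using ⟨hp, hx, ho⟩

theorem BlockGood.evolve_eq_blockPath (hR : IsRule R) {δ : ℝ≥0} (hδ : 0 < δ) {c : List ℝ}
    {x : ℕ → ℕ → Step} (h : BlockGood R δ (c, δ) x) (t : ℝ≥0) :
    evolve R c (seqNoise ((blockMerger R δ).output (c, δ) x)) t =
      blockPath (evolve R) id δ c (fun k => seqNoise (x k)) t := by
  obtain ⟨k, hk⟩ := exists_nat_gt (t / δ)
  have ht : t < δ + k * δ := by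
    rw [div_lt_iff₀ hδ] at hk
    exact hk.trans_le le_add_self
  rw [hR.evolve_blockMerger hδ k h.1 h.2.1 h.2.2 ht]
  split_ifs with h
  · exact (blockPath_of_lt (flow := evolve R) (cut := id) (w := fun k => seqNoise (x k)) h).symm
  · exact (blockPath_of_ge (flow := evolve R) (cut := id) (w := fun k => seqNoise (x k)) hδ
      (not_lt.1 h)).symm

end BlockMerger

/-! ### Domination and matchings -/

/-- `z` has at least as many particles as `c` on each half line `[r, ∞)`. -/
def Dominated (c z : List ℝ) : Prop :=
  ∀ r : ℝ, c.countP (fun a => r ≤ a) ≤ z.countP fun a => r ≤ a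

theorem countingMeasure_Ici (x : List ℝ) (r : ℝ) :
    countingMeasure x (Set.Ici r) = (x.countP fun a => r ≤ a : ℕ) := by
  induction x with
  | nil => simp [countingMeasure]
  | cons a x ih =>
    simp only [countingMeasure, List.map_cons, List.sum_cons, Measure.add_apply] at ih ⊢
    rw [ih, List.countP_cons, Measure.dirac_apply' _ measurableSet_Ici]
    by_cases h : r ≤ a <;> simp [h, add_comm]

theorem Dominated.massTransportLE {c z : List ℝ} (h : Dominated c z) :
    MassTransportLE (countingMeasure c) (countingMeasure z) := fun r => by
  rw [countingMeasure_Ici, countingMeasure_Ici]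
  exact_mod_cast h r

theorem dominated_nil (z : List ℝ) : Dominated [] z := fun r => by simp

theorem Dominated.trans {a b c : List ℝ} (h : Dominated a b) (h' : Dominated b c) :
    Dominated a c := fun r => (h r).trans (h' r)

theorem Dominated.length_le {c z : List ℝ} (h : Dominated c z) : c.length ≤ z.length := by
  obtain ⟨r, hr⟩ : ∃ r : ℝ, ∀ a ∈ c, r ≤ a := by
    obtain ⟨r, hr⟩ := (c.toFinset : Set ℝ).toFinite.bddBelow
    exact ⟨r, fun a ha => hr (by simpa using ha)⟩
  have h1 : c.countP (fun a => r ≤ a) = c.length := List.countP_eq_length.2 fun a ha => by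
    simpa using hr a ha
  rw [← h1]
  exact (h r).trans List.countP_le_length

theorem countP_drop_of_sorted {l : List ℝ} (hl : l.Pairwise (· ≤ ·)) (m : ℕ) (r : ℝ) :
    (l.drop m).countP (fun a => r ≤ a) = min (l.countP fun a => r ≤ a) (l.length - m) := by
  induction l generalizing m with
  | nil => simp
  | cons a l ih =>
    rw [List.pairwise_cons] at hl
    cases m with
    | zero => exact (min_eq_left List.countP_le_length).symm
    | succ m =>
      rw [List.drop_succ_cons, ih hl.2, List.countP_cons, List.length_cons]
      by_cases har : r ≤ a
      · have : l.countP (fun a => r ≤ a) = l.length := List.countP_eq_length.2 fun b hb => by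
          simpa using har.trans (hl.1 b hb)
        rw [this]
        simp only [har, decide_true, if_true]
        omega
      · simp only [har, decide_false, Bool.false_eq_true, if_false]
        omega

/-- The survivors are the rightmost particles, so every tail count is merely capped at their number.
Domination after selection thus becomes an inequality between minima. -/
theorem countP_deleteLeftmost (m : ℕ) (y : List ℝ) (r : ℝ) :
    (deleteLeftmost m y).countP (fun a => r ≤ a) =
      min (y.countP fun a => r ≤ a) (y.length - m) := by
  rw [deleteLeftmost, countP_drop_of_sorted (List.pairwise_insertionSort _ _),
    (List.perm_insertionSort (· ≤ ·) y).countP_eq, List.length_insertionSort]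

theorem countP_keepRightmost (m : ℕ) (y : List ℝ) (r : ℝ) :
    (keepRightmost m y).countP (fun a => r ≤ a) = min (y.countP fun a => r ≤ a) m := by
  have : y.countP (fun a => r ≤ a) ≤ y.length := List.countP_le_length
  rw [keepRightmost, countP_deleteLeftmost]
  omega

theorem deleteLeftmost_dominated (m : ℕ) (y : List ℝ) : Dominated (deleteLeftmost m y) y :=
  fun r => by rw [countP_deleteLeftmost]; exact min_le_left _ _

theorem countP_addChild (y : List ℝ) (i : ℕ) (z r : ℝ) :
    (addChild y i z).countP (fun a => r ≤ a) =
      y.countP (fun a => r ≤ a) + if r ≤ y.getD i 0 + z then 1 else 0 := by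
  rw [addChild, List.countP_append]
  simp [List.countP_cons]

theorem countP_addChildAndSelect (y : List ℝ) (i : ℕ) (z r : ℝ) :
    (addChildAndSelect y i z).countP (fun a => r ≤ a) =
      min (y.countP (fun a => r ≤ a) + if r ≤ y.getD i 0 + z then 1 else 0) y.length := by
  rw [addChildAndSelect, countP_deleteLeftmost, countP_addChild, length_addChild]
  simp

theorem countP_eq_card (p : ℝ → Prop) [DecidablePred p] (l : List ℝ) :
    l.countP (fun a => p a) = ((Finset.range l.length).filter fun i => p (l.getD i 0)).card := by
  rw [countP_eq_sum, Finset.card_filter]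

/-- `σ` pairs each particle of `c` with a particle of `z` which is not to the left of it. -/
def Matched (c z : List ℝ) (σ : Equiv.Perm ℕ) : Prop :=
  ∀ i < c.length, σ i < z.length ∧ c.getD i 0 ≤ z.getD (σ i) 0

theorem Matched.dominated {c z : List ℝ} {σ : Equiv.Perm ℕ} (h : Matched c z σ) :
    Dominated c z := fun r => by
  rw [countP_eq_card, countP_eq_card]
  refine Finset.card_le_card_of_injOn σ (fun i hi => ?_) σ.injective.injOn
  simp only [Finset.coe_filter, Finset.mem_range, Set.mem_ofPred_eq] at hi ⊢
  exact ⟨(h i hi.1).1, hi.2.trans (h i hi.1).2⟩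

/-- The permutation of `ℕ` which extends a permutation of an initial segment. -/
def extendPerm (q : Σ b : ℕ, Equiv.Perm (Fin b)) : Equiv.Perm ℕ :=
  q.2.extendDomain Fin.equivSubtype

/-- Hall's condition for a set `s` of particles of `c` is checked at its leftmost member: by
domination, the particles of `z` to the right of it are at least as many as those of `c`, hence at
least `s.card`. The injection is extended to a permutation of an initial segment, so that matchings
range over a countable set and can be selected measurably. -/
theorem Dominated.exists_matched {c z : List ℝ} (h : Dominated c z) :
    ∃ q, Matched c z (extendPerm q) := by
  classical
  have hall : ∀ s : Finset (Fin c.length), s.card ≤ (s.biUnion fun i =>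
      (Finset.univ : Finset (Fin z.length)).filter fun j : Fin z.length => c.getD i 0 ≤ z.getD j 0).card := by
    intro s
    rcases s.eq_empty_or_nonempty with rfl | hs
    · simp
    obtain ⟨i₀, hi₀, hmin⟩ := Finset.exists_min_image s (fun i => c.getD i 0) hs
    have h1 : s.card ≤ c.countP fun a => c.getD i₀ 0 ≤ a := by
      rw [countP_eq_card]
      refine Finset.card_le_card_of_injOn (fun i => (i : ℕ)) (fun i hi => ?_)
        Fin.val_injective.injOn
      simp only [Finset.coe_filter, Finset.mem_range, Set.mem_ofPred_eq]
      exact ⟨i.2, hmin i hi⟩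
    have h2 : (z.countP fun a => c.getD i₀ 0 ≤ a) = ((Finset.univ : Finset (Fin z.length)).filter
        fun j : Fin z.length => c.getD i₀ 0 ≤ z.getD j 0).card := by
      rw [countP_eq_sum, Finset.card_filter, Finset.sum_range]
    refine (h1.trans (h _)).trans (h2.le.trans (Finset.card_le_card ?_))
    exact Finset.subset_biUnion_of_mem (fun i : Fin c.length =>
      (Finset.univ : Finset (Fin z.length)).filter fun j : Fin z.length => c.getD i 0 ≤ z.getD j 0) hi₀
  obtain ⟨f, hf, hfm⟩ := (Finset.all_card_le_biUnion_card_iff_exists_injective _).1 hall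
  have hle := h.length_le
  let F : Fin z.length → Fin z.length := fun i => if hi : (i : ℕ) < c.length then f ⟨i, hi⟩ else i
  obtain ⟨g, hg⟩ := Finset.exists_equiv_extend_of_card_eq (α := Fin z.length)
    (t := (Finset.univ : Finset (Fin z.length))) (by simp)
    (s := Finset.univ.filter fun i => (i : ℕ) < c.length) (f := F) (Finset.subset_univ _) (by
      intro i hi j hj hij
      simp only [Finset.coe_filter, Finset.mem_univ, true_and, Set.mem_ofPred_eq] at hi hj
      simp only [F, hi, hj, dif_pos] at hij
      exact Fin.ext (by simpa using hf hij))
  refine ⟨⟨z.length, g.trans (Equiv.subtypeUnivEquiv fun _ => Finset.mem_univ _)⟩, fun i hi => ?_⟩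
  have hiz : i < z.length := hi.trans_le hle
  have h1 : extendPerm ⟨z.length, g.trans (Equiv.subtypeUnivEquiv fun _ => Finset.mem_univ _)⟩ i =
      (f ⟨i, hi⟩ : ℕ) := by
    have h2 := Equiv.Perm.extendDomain_apply_image
      (g.trans (Equiv.subtypeUnivEquiv fun _ => Finset.mem_univ _)) Fin.equivSubtype
      (⟨i, hiz⟩ : Fin z.length)
    have h3 : (g ⟨i, hiz⟩ : Fin z.length) = f ⟨i, hi⟩ := by
      rw [hg ⟨i, hiz⟩ (by simpa using hi)]
      simp [F, hi]
    refine h2.trans ?_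
    show ((g ⟨i, hiz⟩ : Fin z.length) : ℕ) = _
    rw [h3]
  rw [h1]
  exact ⟨(f ⟨i, hi⟩).2, by simpa using hfm ⟨i, hi⟩⟩

/-- An enumeration of permutations. -/
noncomputable def permSeq (n : ℕ) : Equiv.Perm ℕ :=
  extendPerm ((exists_surjective_nat (Σ b : ℕ, Equiv.Perm (Fin b))).choose n)

/-- The number of a permutation which matches the particles of the two configurations. -/
noncomputable def matchingIndex (s : List ℝ × List ℝ) : ℕ := sInf {n | Matched s.1 s.2 (permSeq n)}

/-- A permutation which matches the particles of the two configurations. -/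
noncomputable def matching (s : List ℝ × List ℝ) : Equiv.Perm ℕ := permSeq (matchingIndex s)

theorem Dominated.matched {c z : List ℝ} (h : Dominated c z) : Matched c z (matching (c, z)) := by
  obtain ⟨q, hq⟩ := h.exists_matched
  obtain ⟨n, rfl⟩ := (exists_surjective_nat (Σ b : ℕ, Equiv.Perm (Fin b))).choose_spec q
  exact Nat.sInf_mem (s := {n | Matched c z (permSeq n)}) ⟨n, hq⟩

theorem measurable_matchingIndex : Measurable matchingIndex := by
  refine measurable_nat_sInf fun n => measurableSet_forall_lt
    (P := fun i (s : List ℝ × List ℝ) => permSeq n i < s.2.length ∧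
      s.1.getD i 0 ≤ s.2.getD (permSeq n i) 0) (measurable_length measurable_fst) fun i => ?_
  exact (measurableSet_lt measurable_const (measurable_length measurable_snd)).inter
    (measurableSet_le (measurable_getD measurable_fst measurable_const)
      (measurable_getD measurable_snd measurable_const))

theorem measurable_relabel_matching {α : Type*} [MeasurableSpace α] {s : α → List ℝ × List ℝ}
    {w : α → Step} (hs : Measurable s) (hw : Measurable w) :
    Measurable fun x => relabel (matching (s x)) (w x) := by
  refine Measurable.prodMk (measurable_pi_lambda _ fun i => ?_) (measurable_snd.comp hw)
  exact measurable_eval_nat (g := fun n x => (w x).1 (permSeq n i))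
    (fun n => (measurable_pi_apply _).comp (measurable_fst.comp hw))
    (measurable_matchingIndex.comp hs)

theorem Matched.move {c z : List ℝ} {σ : Equiv.Perm ℕ} (h : Matched c z σ) (w : Step) (t : ℝ≥0) :
    Matched (move c (relabel σ w).noise t) (move z w.noise t) σ := by
  intro i hi
  rw [length_move] at hi
  rw [length_move, getD_move, getD_move, if_pos hi, if_pos (h i hi).1]
  exact ⟨(h i hi).1, add_le_add_left (h i hi).2 _⟩

theorem relabel_tieFree {w : Step} (h : TieFree w) (σ : Equiv.Perm ℕ) : TieFree (relabel σ w) :=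
  fun _ _ hij => h _ _ fun e => hij (σ.injective e)

theorem ringingLabel_eq {y : List ℝ} {w : Step} (hw : TieFree w) {i : ℕ} (hi : i < y.length)
    (h : minClock y.length w = (w.1 i).1) : ringingLabel y w.noise = i := by
  have : {k | k < y.length ∧ ∀ j < y.length, w.noise.clock k ≤ w.noise.clock j} = {i} := by
    ext k
    simp only [Set.mem_ofPred_eq, Set.mem_singleton_iff]
    constructor
    · rintro ⟨hk, hmin⟩
      by_contra hne
      have h1 : (w.1 k).1 ≤ (w.1 i).1 := by exact_mod_cast hmin i hi
      have h2 : ((w.1 i).1 : ENNReal) ≤ (w.1 k).1 := h ▸ minClock_le hk w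
      exact hw k i hne (le_antisymm h1 (by exact_mod_cast h2))
    · rintro rfl
      refine ⟨hi, fun j hj => ?_⟩
      have h2 : ((w.1 k).1 : ENNReal) ≤ (w.1 j).1 := h ▸ minClock_le hj w
      exact_mod_cast h2
  rw [ringingLabel, this, csInf_singleton]

/-! ### Coupling of two evolutions -/

/-- The first ring among the unmatched particles of the second configuration, when the marks are
labelled according to the matching. -/
noncomputable def unmatchedRing (s : List ℝ × List ℝ) (u : Step) : ENNReal :=
  ⨅ i : ℕ, if s.1.length ≤ i ∧ matching s i < s.2.length then ((u.1 i).1 : ENNReal) else ⊤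

theorem measurable_unmatchedRing {α : Type*} [MeasurableSpace α] {s : α → List ℝ × List ℝ}
    {u : α → Step} (hs : Measurable s) (hu : Measurable u) :
    Measurable fun x => unmatchedRing (s x) (u x) := by
  refine measurable_iInf_clock (p := fun i x => (s x).1.length ≤ i ∧ matching (s x) i <
    (s x).2.length) (fun i => ?_) hu
  refine (measurableSet_le (measurable_length (measurable_fst.comp hs)) measurable_const).inter
    (measurableSet_lt ?_ (measurable_length (measurable_snd.comp hs)))
  exact measurable_eval_nat (g := fun n _ => permSeq n i) (fun _ => measurable_const)
    (measurable_matchingIndex.comp hs)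

theorem minClock_le_unmatchedRing (s : List ℝ × List ℝ) (w : Step) :
    minClock s.2.length w ≤ unmatchedRing s (relabel (matching s) w) := by
  refine le_iInf fun i => ?_
  split_ifs with h
  · exact minClock_le h.2 w
  · exact le_top

/-- The particles of the first configuration follow the particles of the second one which are
matched to them, until an unmatched particle branches. -/
def Waiting (s : List ℝ × List ℝ) (w : Step) : Prop :=
  NoRing s.1.length (unmatchedRing s (relabel (matching s) w)) (relabel (matching s) w).1

open scoped Classical in
/-- The machine which transforms the noise of the evolution of the second configuration into the
noise of the evolution of the first one. -/
noncomputable def couplingMerger (Rc Rf : List ℝ → ℕ → ℝ → List ℝ) :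
    Merger (ℕ → Step) Step (List ℝ × List ℝ) where
  head x := x 0
  rest _ x := tailSeq x
  pend := Waiting
  join s w v := joinStep s.1.length (unmatchedRing s (relabel (matching s) w)).toNNReal
    (relabel (matching s) w) v
  out s w := relabel (matching s) w
  step s w := (if Waiting s w then move s.1 (relabel (matching s) w).noise
      (unmatchedRing s (relabel (matching s) w)).toNNReal
    else afterRing Rc s.1 (relabel (matching s) w).noise, afterRing Rf s.2 w.noise)
  base x := x

section

variable (J : Measure ℝ) [IsProbabilityMeasure J] {Rc Rf : List ℝ → ℕ → ℝ → List ℝ}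

theorem measurableSet_waiting :
    MeasurableSet {p : (List ℝ × List ℝ) × Step | Waiting p.1 p.2} := by
  have h := measurable_relabel_matching (s := fun p : (List ℝ × List ℝ) × Step => p.1)
    measurable_fst measurable_snd
  exact measurableSet_noRing (measurable_length (by fun_prop))
    (measurable_unmatchedRing measurable_fst h) (measurable_fst.comp h)

/-- After relabelling by the matching, the marks of `c` have the labels `< c.length`, whereas the
time of gluing is a minimum over labels `≥ c.length`. This is the independence needed to renew the
former at that time. -/
theorem lawful_couplingMerger (hc : IsRule Rc) (hf : IsRule Rf) :
    (couplingMerger Rc Rf).Lawful (seqLaw J) (stepLaw J) where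
  measurable_head := measurable_pi_apply 0
  measurable_rest := measurable_tailSeq.comp measurable_snd
  measurableSet_pend := measurableSet_waiting
  measurable_join := by
    have h := measurable_relabel_matching
      (s := fun p : ((List ℝ × List ℝ) × Step) × Step => p.1.1) (by fun_prop)
      (w := fun p => p.1.2) (by fun_prop)
    exact measurable_joinStep (measurable_length (by fun_prop))
      (measurable_unmatchedRing (by fun_prop) h).ennreal_toNNReal h measurable_snd
  measurable_out := measurable_relabel_matching measurable_fst measurable_snd
  measurable_step := by
    have h := measurable_relabel_matching (s := fun p : (List ℝ × List ℝ) × Step => p.1)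
      measurable_fst measurable_snd
    have h1 : Measurable fun p : (List ℝ × List ℝ) × Step => p.1.1 := by fun_prop
    exact (Measurable.ite measurableSet_waiting (measurable_move h1 h
      (measurable_unmatchedRing measurable_fst h).ennreal_toNNReal)
      (hc.measurable_afterRing h1 h)).prodMk
      (hf.measurable_afterRing (by fun_prop) measurable_snd)
  measurable_base := measurable_id
  map_rest _ := map_head_tailSeq _
  map_base := Measure.map_id
  map_single s := map_joinStep J s.1.length (matching s)
    (T := fun u => unmatchedRing s (u, 0))
    (measurable_unmatchedRing (u := fun u : ℕ → Mark => ((u, (0 : ℝ)) : Step)) measurable_const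
      (measurable_id.prodMk measurable_const))
    fun x z => by
      refine iInf_congr fun i => ?_
      by_cases h : s.1.length ≤ i
      · simp [h, splice, not_lt.2 h]
      · simp [h]

/-- Each waiting time is at least the first ring of the second configuration, which after `k` steps
has at most `s.2.length + k` particles. Non-explosion makes these times sum to infinity. -/
theorem ae_productive_couplingMerger (hc : IsRule Rc) (hf : IsRule Rf) (s : List ℝ × List ℝ) :
    ∀ᵐ x ∂(seqLaw J), (couplingMerger Rc Rf).Productive s x := by
  set A := couplingMerger Rc Rf
  refine (lawful_couplingMerger J hc hf).ae_productive (clock := fun w => ((w.1 0).1 : ENNReal))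
    (measurable_coe_nnreal_ennreal.comp (measurable_clock measurable_id 0))
    (ae_of_all _ fun w => ENNReal.coe_lt_top)
    (fun s w => unmatchedRing s (relabel (matching s) w)) (fun s w v hp => ?_) (fun s => ?_) s
  · have h0 : 0 < s.1.length := hp.1
    have hfin : unmatchedRing s (relabel (matching s) w) ≠ ⊤ := ne_top_of_lt (hp.2 0 h0)
    simp [couplingMerger, joinStep, joinMarks, h0, Mark.join, ENNReal.coe_toNNReal hfin]
  · filter_upwards [ae_nonExplosive J] with x hx _
    have horb : ∀ k, A.head (A.orbit k (s, x)).2 = x k ∧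
        (A.orbit k (s, x)).1.2.length ≤ s.2.length + k := by
      intro k
      have h1 : (A.orbit k (s, x)).2 = fun n => x (n + k) := by
        induction k with
        | zero => rfl
        | succ k ih =>
          rw [Merger.orbit_succ']
          refine (congrArg tailSeq ih).trans ?_
          funext n
          simp only [tailSeq_apply]
          congr 1; omega
      refine ⟨by rw [h1]; show x (0 + k) = x k; rw [zero_add], ?_⟩
      clear h1
      induction k with
      | zero => exact le_rfl
      | succ k ih =>
        rw [Merger.orbit_succ']
        refine (hf.length_le _ _ _).trans ?_
        rw [length_move]
        omega
    rw [← top_le_iff, ← hx s.2.length]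
    refine ENNReal.tsum_le_tsum fun k => ?_
    refine le_trans ?_ (minClock_le_unmatchedRing _ _)
    rw [(horb k).1]
    exact minClock_anti (horb k).2 _

/-- `z` dominates `c` and has at least `N` particles. -/
def DominatedBy (N : ℕ) (c z : List ℝ) : Prop := Dominated c z ∧ N ≤ z.length

/-- The rules `Rc` and `Rf` preserve the domination when a pair of matched particles branches, and
when a particle of the second configuration branches. -/
structure Compatible (N : ℕ) (Rc Rf : List ℝ → ℕ → ℝ → List ℝ) : Prop where
  pair : ∀ c z i j a, DominatedBy N c z → i < c.length → j < z.length →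
    c.getD i 0 ≤ z.getD j 0 → DominatedBy N (Rc c i a) (Rf z j a)
  single : ∀ c z j a, DominatedBy N c z → j < z.length → DominatedBy N c (Rf z j a)

/-- Induction on the rings of the second trajectory. Up to its first ring the matched pairs move in
parallel. At the ring, either an unmatched particle branches and the first configuration goes on
with a joined sample, or both members of a pair branch simultaneously with the same displacement;
afterwards a new matching is chosen. -/
theorem Compatible.dominated_evolve {N : ℕ} (hR : Compatible N Rc Rf) (hc : IsRule Rc)
    (hf : IsRule Rf) {c z : List ℝ} (hD : DominatedBy N c z) {x : ℕ → Step}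
    (hp : (couplingMerger Rc Rf).Productive (c, z) x) (hx : NonExplosive x)
    (ho : NonExplosive ((couplingMerger Rc Rf).output (c, z) x)) (ht : ∀ n, TieFree (x n))
    (t : ℝ≥0) :
    Dominated (evolve Rc c (seqNoise ((couplingMerger Rc Rf).output (c, z) x)) t)
      (evolve Rf z (seqNoise x) t) := by
  classical
  obtain ⟨n, hn⟩ := hf.exists_lt_ringState z hx t
  induction n generalizing c z x t with
  | zero => simp [ringState] at hn
  | succ n ihn =>
  rcases eq_or_ne c [] with rfl | hc0
  · rw [evolve_nil]; exact dominated_nil _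
  have hcl : 0 < c.length := List.length_pos_iff.2 hc0
  have hzl : 0 < z.length := hcl.trans_le hD.1.length_le
  set σ := matching (c, z) with hσ
  have hm : Matched c z σ := hD.1.matched
  set w := x 0 with hw
  set u := relabel σ w with hu
  have hwt : TieFree w := ht 0
  have hut : TieFree u := relabel_tieFree hwt σ
  obtain ⟨I, hI, hImin⟩ := exists_minClock_eq hzl w
  have hIr : ringingLabel z w.noise = I := ringingLabel_eq hwt hI hImin
  set τ : ℝ≥0 := (w.1 I).1 with hτ
  have hfr : firstRing z w.noise = τ := by rw [firstRing_eq, hImin]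
  have hnext := hp.next
  have honext := nonExplosive_output_next hp ho
  have hafter : afterRing Rf z w.noise = Rf (move z w.noise τ) I w.2 := by
    rw [afterRing, hfr, hIr, ENNReal.toNNReal_coe]; rfl
  have hDmove : ∀ s, DominatedBy N (move c u.noise s) (move z w.noise s) := fun s =>
    ⟨(hm.move w s).dominated, by rw [length_move]; exact hD.2⟩
  have hn' : τ ≤ t → ((t - τ : ℝ≥0) : ENNReal) < (ringState Rf (afterRing Rf z w.noise)
      (seqNoise (tailSeq x)) n).1 := by
    intro hτt
    rw [ringState_succ'] at hn
    change (t : ENNReal) < firstRing z w.noise + _ at hn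
    rw [hfr] at hn
    rw [ENNReal.coe_sub]
    exact ENNReal.sub_lt_of_lt_add (by exact_mod_cast hτt) (by rwa [add_comm] at hn)
  have hfine_lt : t < τ → evolve Rf z (seqNoise x) t = move z w.noise t := fun h =>
    evolve_of_lt (w := seqNoise x) (by
      show _ < firstRing z w.noise
      rw [hfr]; exact_mod_cast h)
  have hfine_ge : τ ≤ t → evolve Rf z (seqNoise x) t =
      evolve Rf (afterRing Rf z w.noise) (seqNoise (tailSeq x)) (t - τ) := fun h => by
    rw [hf.evolve_of_ge hx (by rw [← hw, hfr]; exact_mod_cast h), ← hw, hfr,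
      ENNReal.toNNReal_coe]
  by_cases hpend : Waiting (c, z) w
  · have hTτ : unmatchedRing (c, z) u = τ := by
      -- A partner in `c` of the ringing particle would ring at `τ`, but while waiting the clocks of
      -- `c` are later than the first unmatched ring, which is not before `τ`.
      have hIlt : c.length ≤ σ.symm I := by
        by_contra hlt
        push Not at hlt
        have h1 : unmatchedRing (c, z) u < (u.1 (σ.symm I)).1 := hpend.2 _ hlt
        have h2 : u.1 (σ.symm I) = w.1 I := by simp [hu, relabel]
        rw [h2] at h1
        exact absurd (h1.trans_le (hImin.symm.le)) (not_lt.2 (minClock_le_unmatchedRing (c, z) w))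
      refine le_antisymm ?_ ?_
      · refine (iInf_le _ (σ.symm I)).trans ?_
        rw [if_pos ⟨hIlt, by simpa [hσ] using hI⟩]
        simp [hu, relabel, hτ]
      · exact hImin.symm.le.trans (minClock_le_unmatchedRing (c, z) w)
    have hs : (couplingMerger Rc Rf).step (c, z) ((couplingMerger Rc Rf).head x) =
        (move c u.noise τ, afterRing Rf z w.noise) := by
      show (if Waiting (c, z) w then _ else _, _) = _
      rw [if_pos hpend]
      show (move c u.noise (unmatchedRing (c, z) u).toNNReal, afterRing Rf z w.noise) = _
      rw [hTτ]; rfl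
    rw [hs] at hnext honext
    change (couplingMerger Rc Rf).Productive _ (tailSeq x) at hnext
    change NonExplosive ((couplingMerger Rc Rf).output _ (tailSeq x)) at honext
    have hout : (couplingMerger Rc Rf).output (c, z) x = consSeq (joinStep c.length τ u
        ((couplingMerger Rc Rf).output (move c u.noise τ, afterRing Rf z w.noise) (tailSeq x) 0))
        (tailSeq ((couplingMerger Rc Rf).output (move c u.noise τ, afterRing Rf z w.noise)
          (tailSeq x))) := by
      rw [hp.output_eq, hs, Merger.combine, if_pos (by exact hpend)]
      show consSeq (joinStep c.length (unmatchedRing (c, z) u).toNNReal u _) _ = _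
      rw [hTτ]; rfl
    rw [hout]
    rcases lt_or_ge t τ with h | h
    · rw [evolve_joinStep_of_le Rc hc0 h, hfine_lt h]
      exact (hDmove t).1
    · rw [hc.evolve_joinStep_of_ge hc0 h _ honext, hfine_ge h]
      refine ihn ?_ hnext (nonExplosive_tailSeq.2 hx) honext (fun n => ht _) _ (hn' h)
      rw [hafter]
      exact hR.single _ _ _ _ (hDmove τ) (by rwa [length_move])
  · have hs : (couplingMerger Rc Rf).step (c, z) ((couplingMerger Rc Rf).head x) =
        (afterRing Rc c u.noise, afterRing Rf z w.noise) := by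
      show (if Waiting (c, z) w then _ else _, _) = _
      rw [if_neg hpend]
      rfl
    have hout : (couplingMerger Rc Rf).output (c, z) x = consSeq u
        ((couplingMerger Rc Rf).output (afterRing Rc c u.noise, afterRing Rf z w.noise)
          (tailSeq x)) := by
      rw [hp.output_eq, hs, Merger.combine, if_neg (by exact hpend)]
      rfl
    rw [hs] at hnext honext
    change (couplingMerger Rc Rf).Productive _ (tailSeq x) at hnext
    change NonExplosive ((couplingMerger Rc Rf).output _ (tailSeq x)) at honext
    -- If the ringing particle had no partner, all matched clocks would be strictly later in the
    -- absence of ties, and `c` would be waiting.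
    have hi : σ.symm I < c.length := by
      by_contra hge
      push Not at hge
      apply hpend
      refine ⟨hcl, fun i hi => ?_⟩
      have h1 : unmatchedRing (c, z) u ≤ τ := by
        refine (iInf_le _ (σ.symm I)).trans ?_
        rw [if_pos ⟨hge, by simpa [hσ] using hI⟩]
        simp [hu, relabel, hτ]
      refine h1.trans_lt ?_
      have h2 : (τ : ENNReal) ≤ (w.1 (σ i)).1 := hImin ▸ minClock_le (hm i hi).1 w
      have h3 : τ ≠ (w.1 (σ i)).1 := hwt _ _ fun e => by
        rw [e, Equiv.symm_apply_apply] at hge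
        exact absurd hi (not_lt.2 hge)
      exact lt_of_le_of_ne h2 (by exact_mod_cast h3)
    set i := σ.symm I with hidef
    have hσi : σ i = I := by simp [hidef]
    have hui : (u.1 i).1 = τ := by simp only [hu, relabel, hσi, hτ]
    -- The clocks of `c` are some of those of `z`, including the earliest one, so both
    -- configurations ring at `τ`.
    have humin : minClock c.length u = (u.1 i).1 := by
      refine le_antisymm (minClock_le hi u) (le_minClock_iff.2 fun j hj => ?_)
      rw [hui, ← hImin]
      exact minClock_le (hm j hj).1 w
    have hcr : ringingLabel c u.noise = i := ringingLabel_eq hut hi humin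
    have hcf : firstRing c u.noise = τ := by rw [firstRing_eq, humin, hui]
    have hcafter : afterRing Rc c u.noise = Rc (move c u.noise τ) i w.2 := by
      rw [afterRing, hcf, hcr, ENNReal.toNNReal_coe]; rfl
    rcases lt_or_ge t τ with h | h
    · rw [hfine_lt h, hout, evolve_of_lt (by
        show _ < firstRing c u.noise
        rw [hcf]; exact_mod_cast h)]
      exact (hDmove t).1
    · have h0 : (couplingMerger Rc Rf).output (c, z) x 0 = u := by rw [hout]; rfl
      have h1 : tailSeq ((couplingMerger Rc Rf).output (c, z) x) =
          (couplingMerger Rc Rf).output (afterRing Rc c u.noise, afterRing Rf z w.noise)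
            (tailSeq x) := by rw [hout]; rfl
      rw [hfine_ge h, hc.evolve_of_ge ho (by rw [h0, hcf]; exact_mod_cast h), h0, h1, hcf,
        ENNReal.toNNReal_coe]
      refine ihn ?_ hnext (nonExplosive_tailSeq.2 hx) honext (fun n => ht _) _ (hn' h)
      rw [hafter, hcafter]
      refine hR.pair _ _ _ _ _ (hDmove τ) (by rwa [length_move]) (by rwa [length_move]) ?_
      have := hm.move w τ i (by rwa [length_move])
      rw [hσi] at this
      exact this.2

/-- The child in `c` is not to the right of the child in `z`, and the deletion in `c` only lowers
counts. No minimal size of `z` is required, hence `0`. -/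
theorem compatible_addChildAndSelect_addChild :
    Compatible 0 addChildAndSelect addChild where
  pair c z i j a h _ _ hij := by
    refine ⟨fun r => ?_, Nat.zero_le _⟩
    rw [countP_addChildAndSelect, countP_addChild]
    refine (min_le_left _ _).trans (add_le_add (h.1 r) ?_)
    split_ifs <;> first | omega | skip
    exact absurd (show r ≤ z.getD j 0 + a by linarith) ‹_›
  single c z j a h _ := ⟨fun r => by
    rw [countP_addChild]; exact (h.1 r).trans le_self_add, Nat.zero_le _⟩

/-- The deletion in `z` caps its counts at its unchanged size. Domination already bounds `c.length`
by this size, and a particle is added to `c` only if `c.length < N`, so the cap does not interfere.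
-/
theorem compatible_addChildUpTo_addChildAndSelect (N : ℕ) :
    Compatible N (addChildUpTo N) addChildAndSelect where
  pair c z i j a h hi _ hij := by
    refine ⟨fun r => ?_, by rw [length_addChildAndSelect]; exact h.2⟩
    have h1 := h.1 r
    have h2 : z.countP (fun a => r ≤ a) ≤ z.length := List.countP_le_length
    have h3 : c.countP (fun a => r ≤ a) ≤ c.length := List.countP_le_length
    have h4 := h.2
    rw [countP_addChildAndSelect]
    have hle : (if r ≤ c.getD i 0 + a then 1 else 0) ≤ if r ≤ z.getD j 0 + a then 1 else 0 := by
      split_ifs <;> first | omega | skip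
      exact absurd (show r ≤ z.getD j 0 + a by linarith) ‹_›
    have hle1 : (if r ≤ c.getD i 0 + a then 1 else 0) ≤ 1 := by split_ifs <;> simp
    by_cases hN : c.length < N
    · rw [addChildUpTo, if_pos hN, countP_addChild]
      exact le_min (by omega) (by omega)
    · rw [addChildUpTo, if_neg hN]
      exact le_min (by omega) (by omega)
  single c z j a h _ := by
    refine ⟨fun r => ?_, by rw [length_addChildAndSelect]; exact h.2⟩
    have h1 := h.1 r
    have h2 : z.countP (fun a => r ≤ a) ≤ z.length := List.countP_le_length
    rw [countP_addChildAndSelect]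
    exact le_min (by omega) (by omega)

end

/-! ### Canonical noise -/

/-- The noise with index set `ι` which is given by a family of random steps. -/
def canonicalNoise {ι Ω : Type*} (V : Ω → ι → Step) : Noise ι Ω where
  clock k i ω := ((V ω k).1 i).1
  path k i t ω := ((V ω k).1 i).2 t
  jump k ω := (V ω k).2

theorem map_coe_clockLaw : clockLaw.map ((↑) : ℝ≥0 → ℝ) = expMeasure 1 := by
  rw [clockLaw, Measure.map_map measurable_coe_nnreal_real measurable_real_toNNReal]
  conv_rhs => rw [← Measure.map_id (μ := expMeasure 1)]
  refine Measure.map_congr ?_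
  have h : expMeasure 1 (Set.Iic 0) = 0 := by
    rw [← ofReal_cdf, cdf_expMeasure_eq one_pos]
    simp
  filter_upwards [measure_eq_zero_iff_ae_notMem.1 h] with x hx
  simp only [Set.mem_Iic, not_le] at hx
  exact Real.coe_toNNReal x hx.le

theorem iIndep_of_cofinal {Ω I : Type*} [MeasurableSpace Ω] {P : Measure Ω}
    [IsProbabilityMeasure P] {m : I → MeasurableSpace Ω}
    (h : ∀ s : Finset I, ∃ s' : Finset I, s ⊆ s' ∧ ∀ f : I → Set Ω,
      (∀ i, MeasurableSet[m i] (f i)) → P (⋂ i ∈ s', f i) = ∏ i ∈ s', P (f i)) :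
    iIndep m P := by
  classical
  refine (iIndep_iff m P).2 fun s f hf => ?_
  obtain ⟨s', hs, h'⟩ := h s
  have h1 := h' (fun i => if i ∈ s then f i else Set.univ) fun i => by
    split_ifs with hi
    · exact hf i hi
    · exact MeasurableSet.univ
  have h2 : (⋂ i ∈ s', if i ∈ s then f i else Set.univ) = ⋂ i ∈ s, f i := by
    ext ω
    simp only [Set.mem_iInter]
    refine ⟨fun h i hi => by simpa [hi] using h i (hs hi), fun h i _ => ?_⟩
    split_ifs with hi
    exacts [h i hi, trivial]
  rw [h2] at h1
  rw [h1, ← Finset.prod_subset hs]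
  · exact Finset.prod_congr rfl fun i hi => by simp [hi]
  · intro i _ hi; simp [hi]

section Driving

variable {ι Ω : Type*} [MeasurableSpace Ω] {P : Measure Ω} [IsProbabilityMeasure P] {N : ℕ}
  {ρ₀ q : ℝ → ℝ} [IsProbabilityMeasure (densityMeasure ρ₀)] [IsProbabilityMeasure (densityMeasure q)]
  {Φ : Ω → (Fin N → ℝ) × (ι → Step)}

/-- The law of the initial positions and of a family of independent steps. -/
noncomputable abbrev driveLaw (N : ℕ) (ρ₀ q : ℝ → ℝ) [IsProbabilityMeasure (densityMeasure ρ₀)]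
    [IsProbabilityMeasure (densityMeasure q)] (ι : Type*) : Measure ((Fin N → ℝ) × (ι → Step)) :=
  (Measure.infinitePi fun _ : Fin N => densityMeasure ρ₀).prod
    (Measure.infinitePi fun _ : ι => stepLaw (densityMeasure q))

theorem driveLaw_rectangle (S : Finset ι) (n : ℕ) {A : Fin N → Set ℝ} {B : ι → ℕ → Set ℝ≥0}
    {C : ι → ℕ → Set Path} {D : ι → Set ℝ} (hA : ∀ a, MeasurableSet (A a))
    (hB : ∀ k i, MeasurableSet (B k i)) (hC : ∀ k i, MeasurableSet (C k i))
    (hD : ∀ k, MeasurableSet (D k)) :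
    driveLaw N ρ₀ q ι {p | (∀ a, p.1 a ∈ A a) ∧ ∀ k ∈ S,
      (∀ i < n, ((p.2 k).1 i).1 ∈ B k i ∧ ((p.2 k).1 i).2 ∈ C k i) ∧ (p.2 k).2 ∈ D k} =
    (∏ a, densityMeasure ρ₀ (A a)) * ∏ k ∈ S,
      (∏ i ∈ Finset.range n, clockLaw (B k i) * wiener (C k i)) * densityMeasure q (D k) := by
  have h1 : {p : (Fin N → ℝ) × (ι → Step) | (∀ a, p.1 a ∈ A a) ∧ ∀ k ∈ S,
      (∀ i < n, ((p.2 k).1 i).1 ∈ B k i ∧ ((p.2 k).1 i).2 ∈ C k i) ∧ (p.2 k).2 ∈ D k} =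
      ((Finset.univ : Finset (Fin N)) : Set (Fin N)).pi A ×ˢ (S : Set ι).pi fun k =>
        {v : ℕ → Mark | ∀ i < n, v i ∈ B k i ×ˢ C k i} ×ˢ D k := by
    ext p
    simp [Set.mem_pi]
  have hS : ∀ k, MeasurableSet {v : ℕ → Mark | ∀ i < n, v i ∈ B k i ×ˢ C k i} := fun k =>
    measurableSet_forall_lt (P := fun i (v : ℕ → Mark) => v i ∈ B k i ×ˢ C k i) measurable_const
      fun i => (measurable_pi_apply i) ((hB k i).prod (hC k i))
  rw [h1, driveLaw, Measure.prod_prod, Measure.infinitePi_pi _ fun a _ => hA a,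
    Measure.infinitePi_pi _ fun k _ => (hS k).prod (hD k)]
  congr 1
  refine Finset.prod_congr rfl fun k _ => ?_
  rw [stepLaw, Measure.prod_prod, infinitePi_range markLaw n _ fun i => (hB k i).prod (hC k i)]
  congr 1
  exact Finset.prod_congr rfl fun i _ => by rw [markLaw, Measure.prod_prod]

/-- For the mutual independence, any finite set of variables is enlarged to all initial positions
together with all marks `< n` and the displacements of the steps in a finite set `S`. The
corresponding events form a rectangle, whose probability factorises. -/
theorem isDrivingNoise (hΦ : MeasurePreserving Φ P (driveLaw N ρ₀ q ι)) :
    IsDrivingNoise P ρ₀ q (fun i ω => (Φ ω).1 i) (canonicalNoise fun ω => (Φ ω).2) := by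
  classical
  have hx : ∀ i, MeasurePreserving (fun ω => (Φ ω).1 i) P (densityMeasure ρ₀) := fun i =>
    (measurePreserving_eval_infinitePi (fun _ : Fin N => densityMeasure ρ₀) i).comp
      (measurePreserving_fst.comp hΦ)
  have hk : ∀ k, MeasurePreserving (fun ω => (Φ ω).2 k) P (stepLaw (densityMeasure q)) := fun k =>
    (measurePreserving_eval_infinitePi (fun _ : ι => stepLaw (densityMeasure q)) k).comp
      (measurePreserving_snd.comp hΦ)
  have hj : ∀ k, MeasurePreserving (fun ω => ((Φ ω).2 k).2) P (densityMeasure q) := fun k =>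
    measurePreserving_snd.comp (hk k)
  have hm : ∀ k i, MeasurePreserving (fun ω => ((Φ ω).2 k).1 i) P markLaw := fun k i =>
    (measurePreserving_eval_infinitePi (fun _ : ℕ => markLaw) i).comp
      (measurePreserving_fst.comp (hk k))
  have hc : ∀ k i, MeasurePreserving (fun ω => (((Φ ω).2 k).1 i).1) P clockLaw := fun k i =>
    measurePreserving_fst.comp (hm k i)
  have hp : ∀ k i, MeasurePreserving (fun ω => (((Φ ω).2 k).1 i).2) P wiener := fun k i =>
    measurePreserving_snd.comp (hm k i)
  refine ⟨fun i => (hx i).measurable, fun k i => measurable_coe_nnreal_real.comp (hc k i).measurable,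
    fun k i t => (Path.measurable_eval t).comp (hp k i).measurable, fun k => (hj k).measurable,
    fun i => ⟨(hx i).measurable.aemeasurable, (hx i).map_eq⟩, fun k i => ?_, fun k i => ?_,
    fun k => ⟨(hj k).measurable.aemeasurable, (hj k).map_eq⟩, ?_⟩
  · have h : MeasurePreserving ((↑) : ℝ≥0 → ℝ) clockLaw (expMeasure 1) :=
      ⟨measurable_coe_nnreal_real, map_coe_clockLaw⟩
    exact ⟨(h.comp (hc k i)).measurable.aemeasurable, (h.comp (hc k i)).map_eq⟩
  · have hW := isBrownianReal_wiener
    refine ⟨⟨fun I => ?_⟩, ae_of_all _ fun ω => (((Φ ω).2 k).1 i).2.continuous⟩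
    exact (hW.hasLaw I).fun_comp ⟨(hp k i).measurable.aemeasurable, (hp k i).map_eq⟩
  · refine iIndep_of_cofinal fun s => ?_
    obtain ⟨S, n, hs⟩ : ∃ (S : Finset ι) (n : ℕ), s ⊆ Finset.univ.disjSum
        ((S ×ˢ Finset.range n).disjSum ((S ×ˢ Finset.range n).disjSum S)) := by
      have hlab : ∀ e : Fin N ⊕ (ι × ℕ) ⊕ (ι × ℕ) ⊕ ι, ∃ (S : Finset ι) (n : ℕ),
          e ∈ (Finset.univ : Finset (Fin N)).disjSum
            ((S ×ˢ Finset.range n).disjSum ((S ×ˢ Finset.range n).disjSum S)) := by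
        rintro (a | ⟨k, i⟩ | ⟨k, i⟩ | k)
        · exact ⟨∅, 0, by simp⟩
        · exact ⟨{k}, i + 1, by simp⟩
        · exact ⟨{k}, i + 1, by simp⟩
        · exact ⟨{k}, 0, by simp⟩
      choose S n h using hlab
      refine ⟨s.biUnion S, s.sup n, fun e he => ?_⟩
      have hS : S e ⊆ s.biUnion S := Finset.subset_biUnion_of_mem S he
      have hn : Finset.range (n e) ⊆ Finset.range (s.sup n) :=
        Finset.range_mono (Finset.le_sup (f := n) he)
      exact Finset.disjSum_mono le_rfl (Finset.disjSum_mono (Finset.product_subset_product hS hn)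
        (Finset.disjSum_mono (Finset.product_subset_product hS hn) hS)) (h e)
    refine ⟨_, hs, fun f hf => ?_⟩
    have h1 : ∀ a, ∃ A, MeasurableSet A ∧ (fun ω => (Φ ω).1 a) ⁻¹' A = f (.inl a) :=
      fun a => hf (.inl a)
    have h2 : ∀ e : ι × ℕ, ∃ B, MeasurableSet B ∧
        (fun ω => ((((Φ ω).2 e.1).1 e.2).1 : ℝ)) ⁻¹' B = f (.inr (.inl e)) :=
      fun e => hf (.inr (.inl e))
    have h3 : ∀ e : ι × ℕ, ∃ C, MeasurableSet C ∧
        (fun ω t => (((Φ ω).2 e.1).1 e.2).2 t) ⁻¹' C = f (.inr (.inr (.inl e))) :=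
      fun e => hf (.inr (.inr (.inl e)))
    have h4 : ∀ k, ∃ D, MeasurableSet D ∧
        (fun ω => ((Φ ω).2 k).2) ⁻¹' D = f (.inr (.inr (.inr k))) :=
      fun k => hf (.inr (.inr (.inr k)))
    choose A hA hAf using h1
    choose B hB hBf using h2
    choose C hC hCf using h3
    choose D hD hDf using h4
    have hB' : ∀ e, MeasurableSet (((↑) : ℝ≥0 → ℝ) ⁻¹' B e) := fun e =>
      measurable_coe_nnreal_real (hB e)
    have hC' : ∀ e, MeasurableSet ((fun (g : Path) (t : ℝ≥0) => g t) ⁻¹' C e) := fun e =>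
      Path.measurable_coe (hC e)
    have hrect := driveLaw_rectangle (ρ₀ := ρ₀) (q := q) S n hA
      (B := fun k i => ((↑) : ℝ≥0 → ℝ) ⁻¹' B (k, i))
      (C := fun k i => (fun (g : Path) (t : ℝ≥0) => g t) ⁻¹' C (k, i))
      (fun k i => hB' (k, i)) (fun k i => hC' (k, i)) hD
    have hset : (⋂ i ∈ (Finset.univ : Finset (Fin N)).disjSum
        ((S ×ˢ Finset.range n).disjSum ((S ×ˢ Finset.range n).disjSum S)), f i) =
        Φ ⁻¹' {p | (∀ a, p.1 a ∈ A a) ∧ ∀ k ∈ S,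
          (∀ i < n, ((p.2 k).1 i).1 ∈ ((↑) : ℝ≥0 → ℝ) ⁻¹' B (k, i) ∧
            ((p.2 k).1 i).2 ∈ (fun (g : Path) (t : ℝ≥0) => g t) ⁻¹' C (k, i)) ∧
          (p.2 k).2 ∈ D k} := by
      ext ω
      simp only [Set.mem_iInter, Finset.mem_disjSum, Finset.mem_univ, true_and, Finset.mem_product,
        Finset.mem_range, Set.mem_preimage, Set.mem_ofPred_eq]
      constructor
      · intro h
        refine ⟨fun a => ?_, fun k hk => ⟨fun i hi => ⟨?_, ?_⟩, ?_⟩⟩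
        · have := h (.inl a) (by simp); rw [← hAf] at this; exact this
        · have := h (.inr (.inl (k, i))) (by simp [hk, hi]); rw [← hBf] at this; exact this
        · have := h (.inr (.inr (.inl (k, i)))) (by simp [hk, hi]); rw [← hCf] at this; exact this
        · have := h (.inr (.inr (.inr k))) (by simp [hk]); rw [← hDf] at this; exact this
      · rintro ⟨ha, hS⟩ (a | ⟨k, i⟩ | ⟨k, i⟩ | k) he
        · rw [← hAf]; exact ha a
        · have hki : k ∈ S ∧ i < n := by simpa using he
          rw [← hBf]; exact ((hS k hki.1).1 i hki.2).1
        · have hki : k ∈ S ∧ i < n := by simpa using he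
          rw [← hCf]; exact ((hS k hki.1).1 i hki.2).2
        · have hkS : k ∈ S := by simpa using he
          rw [← hDf]; exact (hS k hkS).2
    have hfac1 : ∀ a, P (f (.inl a)) = densityMeasure ρ₀ (A a) := fun a => by
      rw [← hAf]; exact (hx a).measure_preimage (hA a).nullMeasurableSet
    have hfac2 : ∀ e : ι × ℕ, P (f (.inr (.inl e))) = clockLaw (((↑) : ℝ≥0 → ℝ) ⁻¹' B e) :=
      fun e => by rw [← hBf]; exact (hc e.1 e.2).measure_preimage (hB' e).nullMeasurableSet
    have hfac3 : ∀ e : ι × ℕ, P (f (.inr (.inr (.inl e)))) =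
        wiener ((fun (g : Path) (t : ℝ≥0) => g t) ⁻¹' C e) :=
      fun e => by rw [← hCf]; exact (hp e.1 e.2).measure_preimage (hC' e).nullMeasurableSet
    have hfac4 : ∀ k, P (f (.inr (.inr (.inr k)))) = densityMeasure q (D k) := fun k => by
      rw [← hDf]; exact (hj k).measure_preimage (hD k).nullMeasurableSet
    have hmeas : MeasurableSet {p : (Fin N → ℝ) × (ι → Step) | (∀ a, p.1 a ∈ A a) ∧ ∀ k ∈ S,
          (∀ i < n, ((p.2 k).1 i).1 ∈ ((↑) : ℝ≥0 → ℝ) ⁻¹' B (k, i) ∧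
            ((p.2 k).1 i).2 ∈ (fun (g : Path) (t : ℝ≥0) => g t) ⁻¹' C (k, i)) ∧
          (p.2 k).2 ∈ D k} := by
      have e1 : ∀ a, Measurable fun p : (Fin N → ℝ) × (ι → Step) => p.1 a := fun a => by fun_prop
      have e2 : ∀ k, Measurable fun p : (Fin N → ℝ) × (ι → Step) => p.2 k := fun k => by fun_prop
      have e3 : ∀ k i, Measurable fun p : (Fin N → ℝ) × (ι → Step) => (p.2 k).1 i := fun k i =>
        (measurable_pi_apply i).comp (measurable_fst.comp (e2 k))
      simp only [Set.ofPred_and, Set.ofPred_forall]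
      refine (MeasurableSet.iInter fun a => e1 a (hA a)).inter
        (Finset.measurableSet_biInter S fun k _ => ?_)
      refine MeasurableSet.inter (MeasurableSet.iInter fun i => MeasurableSet.iInter fun _ => ?_)
        ((measurable_snd.comp (e2 k)) (hD k))
      exact ((measurable_fst.comp (e3 k i)) (hB' _)).inter
        ((measurable_snd.comp (e3 k i)) (hC' _))
    rw [hset, hΦ.measure_preimage hmeas.nullMeasurableSet, hrect]
    simp only [Finset.prod_disjSum, hfac1, hfac2, hfac3, hfac4, Finset.prod_product,
      Finset.prod_mul_distrib]
    ring

end Driving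

/-! ### Coupling of block trajectories -/

theorem length_ringState_of_preserving {R : List ℝ → ℕ → ℝ → List ℝ}
    (hR : ∀ y i z, (R y i z).length = y.length) (y : List ℝ) (w : ℕ → StepNoise) (n : ℕ) :
    (ringState R y w n).2.length = y.length := by
  induction n with
  | zero => rfl
  | succ n ih =>
    simp only [ringState]
    rw [hR, length_move, ih]

theorem length_evolve_of_preserving {R : List ℝ → ℕ → ℝ → List ℝ}
    (hR : ∀ y i z, (R y i z).length = y.length) (y : List ℝ) (w : ℕ → StepNoise) (t : ℝ≥0) :
    (evolve R y w t).length = y.length := by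
  simp only [evolve]
  rw [length_move, length_ringState_of_preserving hR]

/-- The machine which transforms the noise of the blocks of the second trajectory into the noise of
the blocks of the first one. -/
noncomputable def rowsMerger (Rc Rf : List ℝ → ℕ → ℝ → List ℝ) (cutc cutf : List ℝ → List ℝ)
    (δ : ℝ≥0) : Merger (ℕ → ℕ → Step) (ℕ → Step) (List ℝ × List ℝ) where
  head x := x 0
  rest _ x := tailSeq x
  pend _ _ := False
  join _ w _ := w
  out s w := (couplingMerger Rc Rf).output s w
  step s w := (cutc (evolve Rc s.1 (seqNoise ((couplingMerger Rc Rf).output s w)) δ),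
    cutf (evolve Rf s.2 (seqNoise w) δ))
  base x := x

namespace Merger

variable {α K S : Type*} {A : Merger α K S}

theorem productive_of_not_pend (h : ∀ s w, ¬ A.pend s w) (s : S) (x : α) : A.Productive s x := by
  have : ∀ n s x, A.count n s x = n := fun n => by
    induction n with
    | zero => intro s x; rfl
    | succ n ih => intro s x; rw [count, ih, if_neg (h _ _)]
  exact fun m => ⟨m + 1, by rw [this]; omega⟩

theorem output_apply_of_not_pend (h : ∀ s w, ¬ A.pend s w) (s : S) (x : α) (k : ℕ) :
    A.output s x k = A.out (A.orbit k (s, x)).1 (A.head (A.orbit k (s, x)).2) := by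
  induction k generalizing s x with
  | zero => rw [(productive_of_not_pend h s x).output_eq, combine, if_neg (h _ _)]; rfl
  | succ k ih =>
    rw [(productive_of_not_pend h s x).output_eq, combine, if_neg (h _ _), consSeq_succ, ih]
    rfl

end Merger

section Rows

variable (J : Measure ℝ) [IsProbabilityMeasure J] {Rc Rf : List ℝ → ℕ → ℝ → List ℝ}
  {cutc cutf : List ℝ → List ℝ} {δ : ℝ≥0}

/-- No step is pending. For each fixed pair of configurations at the start of a block, the coupling
sends the law of a row to itself; the output rows are therefore again i.i.d., although the state
that determines the coupling is random. -/
theorem lawful_rowsMerger (hc : IsRule Rc) (hf : IsRule Rf) (hcc : Measurable cutc)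
    (hcf : Measurable cutf) (δ : ℝ≥0) :
    (rowsMerger Rc Rf cutc cutf δ).Lawful (blockLaw J) (seqLaw J) where
  measurable_head := measurable_pi_apply 0
  measurable_rest := measurable_tailSeq.comp measurable_snd
  measurableSet_pend := by simp [rowsMerger]
  measurable_join := measurable_snd.comp measurable_fst
  measurable_out := (lawful_couplingMerger J hc hf).measurable_output
  measurable_step := (hcc.comp (hc.measurable_evolve (measurable_fst.comp measurable_fst)
    (lawful_couplingMerger J hc hf).measurable_output δ)).prodMk
      (hcf.comp (hf.measurable_evolve (measurable_snd.comp measurable_fst) measurable_snd δ))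
  measurable_base := measurable_id
  map_rest _ := map_head_tailSeq _
  map_base := Measure.map_id
  map_single s := by
    have h := (lawful_couplingMerger J hc hf).map_output (ae_productive_couplingMerger J hc hf s)
    have hm : Measurable ((couplingMerger Rc Rf).output s) :=
      (lawful_couplingMerger J hc hf).measurable_output.comp
        (measurable_const.prodMk measurable_id)
    have h2 : MeasurePreserving ((couplingMerger Rc Rf).output s) (seqLaw J) (seqLaw J) := ⟨hm, h⟩
    refine Eq.trans ?_ (h2.comp (measurePreserving_fst (μ := seqLaw J) (ν := seqLaw J))).map_eq
    congr 1
    funext p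
    exact if_neg not_false

/-- The domination at the beginning of a block is preserved until the beginning of the next one. -/
structure BlockCompatible (N : ℕ) (Rc Rf : List ℝ → ℕ → ℝ → List ℝ) (cutc cutf : List ℝ → List ℝ)
    (I : List ℝ → List ℝ → Prop) : Prop where
  dominatedBy : ∀ c z, I c z → DominatedBy N c z
  cut : ∀ c z v w t, I c z → Dominated (evolve Rc c v t) (evolve Rf z w t) →
    I (cutc (evolve Rc c v t)) (cutf (evolve Rf z w t))

/-- The noise of a block is completely transformed and the clocks do not accumulate. -/
def RowGood (Rc Rf : List ℝ → ℕ → ℝ → List ℝ) (s : List ℝ × List ℝ) (v : ℕ → Step) : Prop :=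
  ((couplingMerger Rc Rf).Productive s v ∧ NonExplosive v) ∧
    NonExplosive ((couplingMerger Rc Rf).output s v) ∧ ∀ n, TieFree (v n)

theorem measurableSet_rowGood (hc : IsRule Rc) (hf : IsRule Rf) :
    MeasurableSet {p : (List ℝ × List ℝ) × (ℕ → Step) | RowGood Rc Rf p.1 p.2} := by
  have hl := lawful_couplingMerger (Measure.dirac 0) hc hf
  refine (hl.measurableSet_productive.inter (measurable_snd measurableSet_nonExplosive)).inter
    ((hl.measurable_output measurableSet_nonExplosive).inter ?_)
  show MeasurableSet {p : (List ℝ × List ℝ) × (ℕ → Step) | ∀ n, TieFree (p.2 n)}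
  rw [Set.ofPred_forall]
  refine MeasurableSet.iInter fun n => ?_
  have h : Measurable fun p : (List ℝ × List ℝ) × (ℕ → Step) => p.2 n := by fun_prop
  exact h measurableSet_tieFree

theorem ae_rowGood (hc : IsRule Rc) (hf : IsRule Rf) (s : List ℝ × List ℝ) :
    ∀ᵐ v ∂(seqLaw J), RowGood Rc Rf s v := by
  have hl := lawful_couplingMerger J hc hf
  have h1 := ae_productive_couplingMerger J hc hf s
  have h2 : ∀ᵐ v ∂(seqLaw J), NonExplosive ((couplingMerger Rc Rf).output s v) := by
    have := ae_nonExplosive J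
    rw [← hl.map_output h1] at this
    exact ae_of_ae_map (hl.measurable_output.comp
      (measurable_const.prodMk measurable_id)).aemeasurable this
  filter_upwards [h1, ae_nonExplosive J, h2, ae_forall_tieFree J] with v a b c d
  exact ⟨⟨a, b⟩, c, d⟩

/-- All blocks are good. -/
def RowsGood (Rc Rf : List ℝ → ℕ → ℝ → List ℝ) (cutc cutf : List ℝ → List ℝ) (δ : ℝ≥0)
    (s : List ℝ × List ℝ) (x : ℕ → ℕ → Step) : Prop :=
  ∀ k, RowGood Rc Rf ((rowsMerger Rc Rf cutc cutf δ).orbit k (s, x)).1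
    (((rowsMerger Rc Rf cutc cutf δ).orbit k (s, x)).2 0)

theorem measurableSet_rowGood_head (hc : IsRule Rc) (hf : IsRule Rf) :
    MeasurableSet {p : (List ℝ × List ℝ) × (ℕ → ℕ → Step) | RowGood Rc Rf p.1 (p.2 0)} := by
  have h : Measurable fun p : (List ℝ × List ℝ) × (ℕ → ℕ → Step) => (p.1, p.2 0) := by fun_prop
  exact h (measurableSet_rowGood hc hf)

theorem measurableSet_rowsGood (hc : IsRule Rc) (hf : IsRule Rf) (hcc : Measurable cutc)
    (hcf : Measurable cutf) :
    MeasurableSet {p : (List ℝ × List ℝ) × (ℕ → ℕ → Step) |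
      RowsGood Rc Rf cutc cutf δ p.1 p.2} := by
  simp only [RowsGood, Set.ofPred_forall]
  exact MeasurableSet.iInter fun k => (lawful_rowsMerger (Measure.dirac 0) hc hf hcc hcf δ).measurable_orbit k
    (measurableSet_rowGood_head hc hf)

theorem ae_rowsGood (hc : IsRule Rc) (hf : IsRule Rf) (hcc : Measurable cutc)
    (hcf : Measurable cutf) (s : List ℝ × List ℝ) :
    ∀ᵐ x ∂(blockLaw J), RowsGood Rc Rf cutc cutf δ s x := by
  refine ae_all_iff.2 fun k => ?_
  refine (lawful_rowsMerger J hc hf hcc hcf δ).ae_orbit (Q := fun p => RowGood Rc Rf p.1 (p.2 0))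
    (measurableSet_rowGood_head hc hf) (fun s => ?_) k s
  exact (measurePreserving_eval_infinitePi (fun _ : ℕ => seqLaw J) 0).quasiMeasurePreserving.ae
    (ae_rowGood J hc hf s)

/-- The state of the machine after `k` steps is the pair of configurations from which the two
trajectories start block `k`. The relation `I` between them propagates from block to block, and
within each block the domination of evolutions applies. -/
theorem RowsGood.dominated_blockPath {N : ℕ} {I : List ℝ → List ℝ → Prop}
    (hR : Compatible N Rc Rf) (hI : BlockCompatible N Rc Rf cutc cutf I) (hc : IsRule Rc)
    (hf : IsRule Rf) {c z : List ℝ} (hcz : I c z) {x : ℕ → ℕ → Step}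
    (hx : RowsGood Rc Rf cutc cutf δ (c, z) x) (t : ℝ≥0) :
    Dominated (blockPath (evolve Rc) cutc δ c
        (fun k => seqNoise ((rowsMerger Rc Rf cutc cutf δ).output (c, z) x k)) t)
      (blockPath (evolve Rf) cutf δ z (fun k => seqNoise (x k)) t) := by
  set A := rowsMerger Rc Rf cutc cutf δ with hA
  set B := couplingMerger Rc Rf with hB
  have hnp : ∀ s w, ¬ A.pend s w := fun _ _ h => h
  have hsrc : ∀ k, (A.orbit k ((c, z), x)).2 0 = x k := by
    have : ∀ k, (A.orbit k ((c, z), x)).2 = fun n => x (n + k) := fun k => by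
      induction k with
      | zero => rfl
      | succ k ih =>
        rw [Merger.orbit_succ']
        refine (congrArg tailSeq ih).trans ?_
        funext n
        simp only [tailSeq_apply]
        congr 1; omega
    intro k
    rw [this]
    show x (0 + k) = x k
    rw [zero_add]
  have hout : ∀ k, A.output (c, z) x k = B.output (A.orbit k ((c, z), x)).1 (x k) := fun k => by
    rw [Merger.output_apply_of_not_pend hnp, ← hsrc k]
    rfl
  have hdom : ∀ k, I (A.orbit k ((c, z), x)).1.1 (A.orbit k ((c, z), x)).1.2 → ∀ t, Dominated
      (evolve Rc (A.orbit k ((c, z), x)).1.1 (seqNoise (A.output (c, z) x k)) t)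
      (evolve Rf (A.orbit k ((c, z), x)).1.2 (seqNoise (x k)) t) := fun k hk t => by
    obtain ⟨⟨g1, g2⟩, g3, g4⟩ := hx k
    rw [hsrc] at g1 g2 g3 g4
    rw [hout]
    exact hR.dominated_evolve hc hf (hI.dominatedBy _ _ hk) g1 g2 g3 g4 t
  have hmain : ∀ k, blockStart (evolve Rc) cutc δ c (fun k => seqNoise (A.output (c, z) x k)) k =
        (A.orbit k ((c, z), x)).1.1 ∧
      blockStart (evolve Rf) cutf δ z (fun k => seqNoise (x k)) k =
        (A.orbit k ((c, z), x)).1.2 ∧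
      I (A.orbit k ((c, z), x)).1.1 (A.orbit k ((c, z), x)).1.2 := by
    intro k
    induction k with
    | zero => exact ⟨rfl, rfl, hcz⟩
    | succ k ih =>
      obtain ⟨h1, h2, h3⟩ := ih
      have hstep : (A.orbit (k + 1) ((c, z), x)).1 =
          (cutc (evolve Rc (A.orbit k ((c, z), x)).1.1 (seqNoise (A.output (c, z) x k)) δ),
            cutf (evolve Rf (A.orbit k ((c, z), x)).1.2 (seqNoise (x k)) δ)) := by
        rw [Merger.orbit_succ', hout, ← hsrc k]
        rfl
      rw [hstep, blockStart, blockStart, h1, h2]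
      exact ⟨rfl, rfl, hI.cut _ _ _ _ _ h3 (hdom k h3 δ)⟩
  obtain ⟨h1, h2, h3⟩ := hmain ⌊t / δ⌋₊
  simp only [blockPath]
  rw [h1, h2]
  exact hdom _ h3 _

end Rows

/-! ### The two barriers -/

/-- The true process conserves its number of particles, so the lower configuration never has more
than `N`, and keeping the `N` rightmost particles of the upper one loses nothing in the comparison.
-/
theorem blockCompatible_upper (N : ℕ) :
    BlockCompatible 0 addChildAndSelect addChild id (keepRightmost N)
      (fun c z => Dominated c z ∧ c.length ≤ N) where
  dominatedBy _ _ h := ⟨h.1, Nat.zero_le _⟩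
  cut c z v w t h hd := by
    have hlen := length_evolve_of_preserving length_addChildAndSelect c v t
    refine ⟨fun r => ?_, by rw [id, hlen]; exact h.2⟩
    rw [countP_keepRightmost]
    exact le_min (hd r) (List.countP_le_length.trans (hlen.le.trans h.2))

/-- The cut is applied to the lower configuration and only decreases it, while the true process
keeps its number of particles. -/
theorem blockCompatible_lower (N M : ℕ) :
    BlockCompatible N (addChildUpTo N) addChildAndSelect (keepRightmost M) id
      (DominatedBy N) where
  dominatedBy _ _ h := h
  cut c z v w t h hd := by
    refine ⟨Dominated.trans (deleteLeftmost_dominated _ _) hd, ?_⟩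
    rw [id, length_evolve_of_preserving length_addChildAndSelect]
    exact h.2

theorem isProbabilityMeasure_densityMeasure {f : ℝ → ℝ} (hf : ∀ r, 0 ≤ f r) (h : ∫ r, f r = 1) :
    IsProbabilityMeasure (densityMeasure f) := by
  have hi : Integrable f := by
    by_contra hn
    rw [integral_undef hn] at h
    exact one_ne_zero h.symm
  refine ⟨?_⟩
  rw [densityMeasure, withDensity_apply _ MeasurableSet.univ, Measure.restrict_univ,
    ← ofReal_integral_eq_lintegral_ofReal hi (ae_of_all _ hf), h, ENNReal.ofReal_one]

theorem measurable_ofFn (N : ℕ) : Measurable fun a : Fin N → ℝ => List.ofFn a := by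
  refine measurable_list_iff.2 ⟨by simp, fun i => ?_⟩
  by_cases h : i < N
  · simpa [List.getD_eq_getElem, h] using measurable_pi_apply (⟨i, h⟩ : Fin N)
  · simp [h]

theorem measurePreserving_uncurry (J : Measure ℝ) [IsProbabilityMeasure J] :
    MeasurePreserving (fun (x : ℕ → ℕ → Step) (e : ℕ × ℕ) => x e.1 e.2) (blockLaw J)
      (Measure.infinitePi fun _ : ℕ × ℕ => stepLaw J) :=
  ⟨(MeasurableEquiv.curry ℕ ℕ Step).symm.measurable,
    Measure.infinitePi_map_curry_symm fun _ _ => stepLaw J⟩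

/-! ### Assembly of the two couplings -/

section Assembly

variable {N : ℕ} (ρ₀ q : ℝ → ℝ) [IsProbabilityMeasure (densityMeasure ρ₀)]
  [IsProbabilityMeasure (densityMeasure q)] {δ : ℝ≥0}

/-- The law of the initial positions and of independent blocks of steps. -/
noncomputable abbrev blockDriveLaw (N : ℕ) (ρ₀ q : ℝ → ℝ)
    [IsProbabilityMeasure (densityMeasure ρ₀)] [IsProbabilityMeasure (densityMeasure q)] :
    Measure ((Fin N → ℝ) × (ℕ → ℕ → Step)) :=
  (Measure.infinitePi fun _ : Fin N => densityMeasure ρ₀).prod (blockLaw (densityMeasure q))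

theorem measurePreserving_rows {Rc Rf : List ℝ → ℕ → ℝ → List ℝ} {cutc cutf : List ℝ → List ℝ}
    (hc : IsRule Rc) (hf : IsRule Rf) (hcc : Measurable cutc) (hcf : Measurable cutf)
    {s : (Fin N → ℝ) → List ℝ × List ℝ} (hs : Measurable s) :
    MeasurePreserving (fun ω : (Fin N → ℝ) × (ℕ → ℕ → Step) =>
        (ω.1, (rowsMerger Rc Rf cutc cutf δ).output (s ω.1) ω.2))
      (blockDriveLaw N ρ₀ q) (blockDriveLaw N ρ₀ q) :=
  have hl := lawful_rowsMerger (densityMeasure q) hc hf hcc hcf δ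
  (MeasurePreserving.id _).skew_product
    (g := fun a x => (rowsMerger Rc Rf cutc cutf δ).output (s a) x)
    (hl.measurable_output.comp ((hs.comp measurable_fst).prodMk measurable_snd))
    (ae_of_all _ fun _ => hl.map_output (ae_of_all _ fun x =>
      Merger.productive_of_not_pend (fun _ _ h => h) _ x))

theorem measurePreserving_joinBlocks {R : List ℝ → ℕ → ℝ → List ℝ} (hR : IsRule R) (hδ : 0 < δ)
    {c : (Fin N → ℝ) → List ℝ} (hc : Measurable c) :
    MeasurePreserving (fun ω : (Fin N → ℝ) × (ℕ → ℕ → Step) =>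
        (ω.1, (blockMerger R δ).output (c ω.1, δ) ω.2))
      (blockDriveLaw N ρ₀ q) (driveLaw N ρ₀ q ℕ) :=
  have hl := lawful_blockMerger (densityMeasure q) hR δ
  (MeasurePreserving.id _).skew_product (g := fun a x => (blockMerger R δ).output (c a, δ) x)
    (hl.measurable_output.comp (((hc.comp measurable_fst).prodMk measurable_const).prodMk
      measurable_snd))
    (ae_of_all _ fun _ => hl.map_output (ae_productive_blockMerger _ hR hδ _))

theorem measurePreserving_uncurryBlocks :
    MeasurePreserving (fun ω : (Fin N → ℝ) × (ℕ → ℕ → Step) =>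
        (ω.1, fun e : ℕ × ℕ => ω.2 e.1 e.2))
      (blockDriveLaw N ρ₀ q) (driveLaw N ρ₀ q (ℕ × ℕ)) :=
  (MeasurePreserving.id _).prod (measurePreserving_uncurry (densityMeasure q))

theorem ae_blockDriveLaw {S : Type*} [MeasurableSpace S] {Q : S → (ℕ → ℕ → Step) → Prop}
    (hQ : MeasurableSet {p : S × (ℕ → ℕ → Step) | Q p.1 p.2}) {s : (Fin N → ℝ) → S}
    (hs : Measurable s) (h : ∀ a, ∀ᵐ x ∂(blockLaw (densityMeasure q)), Q a x) :
    ∀ᵐ ω ∂(blockDriveLaw N ρ₀ q), Q (s ω.1) ω.2 := by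
  have hm : Measurable fun ω : (Fin N → ℝ) × (ℕ → ℕ → Step) => (s ω.1, ω.2) :=
    (hs.comp measurable_fst).prodMk measurable_snd
  exact (Measure.ae_prod_iff_ae_ae (hm hQ)).2 (ae_of_all _ fun a => h (s a))

/-- The coupling with the upper barrier: the noise of the blocks of the barrier is transformed into
the noise of the blocks of a true process, which are then joined. -/
theorem exists_coupling_upper (hδ : 0 < δ) :
    ∃ (Ω : Type) (_ : MeasurableSpace Ω) (P : Measure Ω) (_ : IsProbabilityMeasure P)
      (x₀ : Fin N → Ω → ℝ) (X Y : ℝ≥0 → Ω → List ℝ),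
      IsTrueProcess P ρ₀ q x₀ X ∧ IsUpperBarrier P ρ₀ q δ x₀ Y ∧
      ∀ᵐ ω ∂P, ∀ t : ℝ≥0, MassTransportLE (countingMeasure (X t ω)) (countingMeasure (Y t ω)) := by
  let A := rowsMerger addChildAndSelect addChild id (keepRightmost N) δ
  let B := blockMerger addChildAndSelect δ
  let Ω := (Fin N → ℝ) × (ℕ → ℕ → Step)
  let c : (Fin N → ℝ) → List ℝ := List.ofFn
  have hc : Measurable c := measurable_ofFn N
  have hcc : Measurable fun a => (c a, c a) := hc.prodMk hc
  let H : Ω → ℕ → ℕ → Step := fun ω => A.output (c ω.1, c ω.1) ω.2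
  let V : Ω → ℕ → Step := fun ω => B.output (c ω.1, δ) (H ω)
  have hH : MeasurePreserving (fun ω : Ω => (ω.1, H ω)) (blockDriveLaw N ρ₀ q)
      (blockDriveLaw N ρ₀ q) := measurePreserving_rows ρ₀ q isRule_addChildAndSelect
    isRule_addChild measurable_id (measurable_keepRightmost N) hcc
  have hV : MeasurePreserving (fun ω : Ω => (ω.1, V ω)) (blockDriveLaw N ρ₀ q)
      (driveLaw N ρ₀ q ℕ) :=
    (measurePreserving_joinBlocks ρ₀ q isRule_addChildAndSelect hδ hc).comp hH
  refine ⟨Ω, inferInstance, blockDriveLaw N ρ₀ q, inferInstance, fun i ω => ω.1 i,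
    fun t ω => truePath (c ω.1) (seqNoise (V ω)) t,
    fun t ω => upperPath N δ (c ω.1) (fun k => seqNoise (ω.2 k)) t,
    ⟨_, isDrivingNoise hV, fun _ _ => rfl⟩,
    ⟨_, isDrivingNoise (measurePreserving_uncurryBlocks ρ₀ q), fun _ _ => rfl⟩, ?_⟩
  have h1 := ae_blockDriveLaw ρ₀ q (measurableSet_rowsGood (δ := δ)
    isRule_addChildAndSelect isRule_addChild measurable_id (measurable_keepRightmost N)) hcc
    (ae_rowsGood _ isRule_addChildAndSelect isRule_addChild measurable_id
      (measurable_keepRightmost N))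
  -- The blocks to be joined are the transformed ones; since they have the law of block noise, the
  -- almost sure property holds for them too.
  have h2 := hH.quasiMeasurePreserving.ae (ae_blockDriveLaw ρ₀ q
    (measurableSet_blockGood isRule_addChildAndSelect δ)
    (hc.prodMk (measurable_const (a := δ))) (ae_blockGood _ isRule_addChildAndSelect hδ))
  filter_upwards [h1, h2] with ω hrows hblock t
  refine Dominated.massTransportLE ?_
  have h3 := hblock.evolve_eq_blockPath isRule_addChildAndSelect hδ t
  have h4 := hrows.dominated_blockPath compatible_addChildAndSelect_addChild
    (blockCompatible_upper N) isRule_addChildAndSelect isRule_addChild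
    ⟨fun _ => le_rfl, (List.length_ofFn).le⟩ t
  show Dominated (evolve addChildAndSelect (c ω.1) (seqNoise (V ω)) t) _
  rw [h3]
  exact h4

/-- The coupling with the lower barrier: the noise of the blocks of a true process is joined, and
it is transformed into the noise of the blocks of the barrier. -/
theorem exists_coupling_lower (hδ : 0 < δ) (M : ℕ) :
    ∃ (Ω : Type) (_ : MeasurableSpace Ω) (P : Measure Ω) (_ : IsProbabilityMeasure P)
      (x₀ : Fin N → Ω → ℝ) (X Y : ℝ≥0 → Ω → List ℝ),
      IsTrueProcess P ρ₀ q x₀ X ∧ IsLowerBarrier P ρ₀ q δ M x₀ Y ∧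
      ∀ᵐ ω ∂P, ∀ t : ℝ≥0, MassTransportLE (countingMeasure (Y t ω)) (countingMeasure (X t ω)) := by
  let A := rowsMerger (addChildUpTo N) addChildAndSelect (keepRightmost (N - M)) id δ
  let B := blockMerger addChildAndSelect δ
  let Ω := (Fin N → ℝ) × (ℕ → ℕ → Step)
  let c : (Fin N → ℝ) → List ℝ := List.ofFn
  have hc : Measurable c := measurable_ofFn N
  have hcc : Measurable fun a => (deleteLeftmost M (c a), c a) :=
    (measurable_deleteLeftmost hc measurable_const).prodMk hc
  let H : Ω → ℕ → ℕ → Step := fun ω => A.output (deleteLeftmost M (c ω.1), c ω.1) ω.2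
  let V : Ω → ℕ → Step := fun ω => B.output (c ω.1, δ) ω.2
  have hH : MeasurePreserving (fun ω : Ω => (ω.1, H ω)) (blockDriveLaw N ρ₀ q)
      (blockDriveLaw N ρ₀ q) := measurePreserving_rows ρ₀ q (isRule_addChildUpTo N)
    isRule_addChildAndSelect (measurable_keepRightmost (N - M)) measurable_id hcc
  have hV : MeasurePreserving (fun ω : Ω => (ω.1, V ω)) (blockDriveLaw N ρ₀ q)
      (driveLaw N ρ₀ q ℕ) :=
    measurePreserving_joinBlocks ρ₀ q isRule_addChildAndSelect hδ hc
  refine ⟨Ω, inferInstance, blockDriveLaw N ρ₀ q, inferInstance, fun i ω => ω.1 i,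
    fun t ω => truePath (c ω.1) (seqNoise (V ω)) t,
    fun t ω => lowerPath N M δ (c ω.1) (fun k => seqNoise (H ω k)) t,
    ⟨_, isDrivingNoise hV, fun _ _ => rfl⟩,
    ⟨_, isDrivingNoise ((measurePreserving_uncurryBlocks ρ₀ q).comp hH), fun _ _ => rfl⟩, ?_⟩
  have h1 := ae_blockDriveLaw ρ₀ q (measurableSet_rowsGood (δ := δ)
    (isRule_addChildUpTo N) isRule_addChildAndSelect (measurable_keepRightmost (N - M))
    measurable_id) hcc (ae_rowsGood _ (isRule_addChildUpTo N) isRule_addChildAndSelect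
      (measurable_keepRightmost (N - M)) measurable_id)
  have h2 := ae_blockDriveLaw ρ₀ q
    (measurableSet_blockGood isRule_addChildAndSelect δ)
    (hc.prodMk (measurable_const (a := δ))) (ae_blockGood _ isRule_addChildAndSelect hδ)
  filter_upwards [h1, h2] with ω hrows hblock t
  refine Dominated.massTransportLE ?_
  have h3 := hblock.evolve_eq_blockPath isRule_addChildAndSelect hδ t
  have h4 := hrows.dominated_blockPath (compatible_addChildUpTo_addChildAndSelect N)
    (blockCompatible_lower N (N - M)) (isRule_addChildUpTo N) isRule_addChildAndSelect
    ⟨deleteLeftmost_dominated M _, (List.length_ofFn).ge⟩ t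
  show Dominated _ (evolve addChildAndSelect (c ω.1) (seqNoise (V ω)) t)
  rw [h3]
  exact h4

end Assembly

end ParticleSystem

theorem mainTheorem5
    (ρ₀ : ℝ → ℝ) (p : ℝ → ℝ → ℝ) (A ξ : ℝ)
    (hρ₀_smooth : ContDiff ℝ (⊤ : ℕ∞) ρ₀) (hρ₀_nonneg : ∀ r, 0 ≤ ρ₀ r) (hρ₀_int : ∫ r, ρ₀ r = 1)
    (hA : 0 < A) (hρ₀_supp : ∀ r, r ∉ Set.Icc (-A) A → ρ₀ r = 0)
    (hp_transl : ∀ x y, p x y = p 0 (y - x))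
    (hp_smooth : ContDiff ℝ (⊤ : ℕ∞) (p 0)) (hp_nonneg : ∀ z, 0 ≤ p 0 z) (hp_int : ∫ z, p 0 z = 1)
    (hξ : 0 < ξ) (hp_supp : ∀ z, ξ ≤ |z| → p 0 z = 0)
    (N : ℕ) (δ : ℝ≥0) (hδ : 0 < δ) :
    (∃ (Ω : Type) (_ : MeasurableSpace Ω) (P : Measure Ω) (_ : IsProbabilityMeasure P)
        (x₀ : Fin N → Ω → ℝ) (X Y : ℝ≥0 → Ω → List ℝ),
        ParticleSystem.IsTrueProcess P ρ₀ (p 0) x₀ X ∧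
        ParticleSystem.IsUpperBarrier P ρ₀ (p 0) δ x₀ Y ∧
        ∀ᵐ ω ∂P, ∀ t : ℝ≥0, ParticleSystem.MassTransportLE
          (ParticleSystem.countingMeasure (X t ω)) (ParticleSystem.countingMeasure (Y t ω))) ∧
    (∀ α₀ : ℝ, 1 / 2 < α₀ → α₀ < 1 →
      ∀ M : ℕ, |(M : ℝ) - ParticleSystem.removalNumber N δ α₀| < 1 →
      ∃ (Ω : Type) (_ : MeasurableSpace Ω) (P : Measure Ω) (_ : IsProbabilityMeasure P)
        (x₀ : Fin N → Ω → ℝ) (X Y : ℝ≥0 → Ω → List ℝ),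
        ParticleSystem.IsTrueProcess P ρ₀ (p 0) x₀ X ∧
        ParticleSystem.IsLowerBarrier P ρ₀ (p 0) δ M x₀ Y ∧
        ∀ᵐ ω ∂P, ∀ t : ℝ≥0, ParticleSystem.MassTransportLE
          (ParticleSystem.countingMeasure (Y t ω)) (ParticleSystem.countingMeasure (X t ω))) := by
  have := ParticleSystem.isProbabilityMeasure_densityMeasure hρ₀_nonneg hρ₀_int
  have := ParticleSystem.isProbabilityMeasure_densityMeasure hp_nonneg hp_int
  exact ⟨ParticleSystem.exists_coupling_upper ρ₀ (p 0) hδ,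
    fun α₀ _ _ M _ => ParticleSystem.exists_coupling_lower ρ₀ (p 0) hδ M⟩
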